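/- **Theorem (Lipschitz continuity of the peridynamic force in $H^2$).** Let $d\in\{2,3\}$ and let $D\subset\mathbb R^d$ be a bounded open set with $C^1$ boundary. Let $W=H^2(D;\mathbb R^d)\cap H^1_0(D;\mathbb R^d)$ with the $H^2$ norm $\|u\|_2=(\|u\|^2+\|\nabla u\|^2+\|\nabla^2u\|^2)^{1/2}$ ($\|\cdot\|$ the $L^2(D)$ norm), and extend every $u\in W$ by zero outside $D$. *Data.* Let $f:[0,\infty)\to\mathbb R$ be smooth, concave, positive on $(0,\infty)$, with $\lim_{r\to0^+}f(r)/r=f'(0)$, $\lim_{r\to\infty}f(r)=f_\infty<\infty$, and with $C_k=\sup_{r\in\mathbb R}|F_1^{(k)}(r)|<\infty$ for $1\le k\le4$, where $F_1(r)=f(r^2)$. Let $J:[0,\infty)\to[0,\infty)$ be measurable and bounded with $J=0$ on $[1,\infty)$; $\omega_d$ is the volume of the unit ball, $H_r(x)$ the ball of radius $r$ centred at $x$, and $\bar J_\alpha=\frac1{\omega_d}\int_{H_1(0)}J(|\xi|)|\xi|^{-\alpha}\,d\xi$. For $\epsilon\in(0,1)$ and constants $C_{\omega_1},C_{\omega_2}\ge0$,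 an admissible boundary function is a continuous $\omega:\mathbb R^d\to[0,1]$ with $\omega=0$ outside $D$, $\omega=1$ at the points of $D$ at distance at least $\epsilon$ from $\partial D$, such that for all $|\xi|<1$ the function $\bar\omega_\xi(x)=\omega(x)\omega(x+\epsilon\xi)$ is $C^2$ in $D$ with $|\nabla\bar\omega_\xi|\le C_{\omega_1}$ and $|\nabla^2\bar\omega_\xi|\le C_{\omega_2}$ there (Euclidean norms). *Force.* With $e_{y-x}=\frac{y-x}{|y-x|}$, $S(y,x;u)=\frac{u(y)-u(x)}{|y-x|}\cdot e_{y-x}$ and $W^\epsilon(S,y-x)=\omega(x)\omega(y)\frac{J(|y-x|/\epsilon)}{\epsilon|y-x|}f(|y-x|S^2)$, put $$-\nabla PD^\epsilon(u)(x)=\frac{2}{\epsilon^d\omega_d}\int_{H_\epsilon(x)}\partial_SW^\epsilon(S(y,x;u),y-x)\,e_{y-x}\,dy .$$ *Claim.* There are finite constants $C_{e_1},C_{e_2}\ge0$ with $\|u\|_{L^\infty(D)}\le C_{e_1}\|u\|_2$ and $\|\nabla u\|_{L^4(D)}\le C_{e_2}\|u\|_2$ for all $u\in W$; moreover $\bar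 J_1,\bar J_{3/2}<\infty$, and $\bar J_2<\infty$ if $d=3$. For any such $C_{e_1},C_{e_2}$ put $L_1=4C_2\bar J_1$, $L_2=8C_3C_{e_1}\bar J_{3/2}$, $L_4=16C_3C_{e_2}^2\bar J_{3/2}$ and $$\bar L_1=\bar L_4=(4+3C_{\omega_1}+C_{\omega_2})L_1,\qquad \bar L_2=(1+2C_{\omega_1})L_2+L_4,\qquad \bar L_5=L_4 .$$ Then there is a finite constant $\bar L_3\ge0$, depending only on $d,D,f,J,C_{e_1},C_{e_2}$, and equal to $16C_4C_{e_1}C_{e_2}^2\bar J_2$ whenever $\bar J_2<\infty$, such that for all $C_{\omega_1},C_{\omega_2}\ge0$, all $\epsilon\in(0,1)$, all admissible $\omega$ and all $u,v\in W$, the functions $-\nabla PD^\epsilon(u)$ and $-\nabla PD^\epsilon(v)$ belong to $H^2(D;\mathbb R^d)$ and $$\|-\nabla PD^\epsilon(u)-(-\nabla PD^\epsilon(v))\|_2\le\frac{\bar L_1+\bar L_2(\|u\|_2+\|v\|_2)+\bar L_3(\|u\|_2+\|v\|_2)^2}{\epsilon^3}\,\|u-v\|_2,$$ $$\|-\nabla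 PD^\epsilon(u)\|_2\le\frac{\bar L_4\|u\|_2+\bar L_5\|u\|_2^2}{\epsilon^{5/2}} .$$ -/

import Mathlib

open MeasureTheory Set Filter Topology
open scoped ContDiff NNReal

noncomputable section

namespace Peridynamics

/-- The Euclidean space `ℝ^d`. -/
abbrev Sp (d : ℕ) : Type := EuclideanSpace ℝ (Fin d)

variable {d : ℕ}

/-- The `i`-th standard basis vector of `ℝ^d`. -/
def basisVec (i : Fin d) : Sp d := EuclideanSpace.single i (1 : ℝ)

/-! ### Domains with `C¹` boundary -/

/-- Near every boundary point, `D` is the negativity set of a `C¹` function whose derivative does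
not vanish at that point (equivalently, after a rigid motion, the region on one side of the graph
of a `C¹` function). -/
def HasC1Boundary (D : Set (Sp d)) : Prop :=
  ∀ p ∈ frontier D, ∃ U : Set (Sp d), IsOpen U ∧ p ∈ U ∧
    ∃ ψ : Sp d → ℝ, ContDiffOn ℝ 1 ψ U ∧ fderiv ℝ ψ p ≠ 0 ∧ D ∩ U = {x ∈ U | ψ x < 0}

/-! ### Sobolev spaces `H¹(D; ℝ^d)`, `H²(D; ℝ^d)`, `H¹₀(D; ℝ^d)` -/

/-- `g` is a weak `i`-th partial derivative of `u` on the open set `D`. -/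
def IsWeakPartial (D : Set (Sp d)) (i : Fin d) (u g : Sp d → Sp d) : Prop :=
  ∀ φ : Sp d → ℝ, ContDiff ℝ ∞ φ → HasCompactSupport φ → tsupport φ ⊆ D →
    ∫ x in D, (fderiv ℝ φ x (basisVec i)) • u x = - ∫ x in D, φ x • g x

/-- `u ∈ L²(D; ℝ^d)`. -/
def MemL2 (D : Set (Sp d)) (u : Sp d → Sp d) : Prop :=
  MemLp u 2 (volume.restrict D)

/-- `u ∈ H¹(D; ℝ^d)`. -/
def MemH1 (D : Set (Sp d)) (u : Sp d → Sp d) : Prop :=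
  MemL2 D u ∧ ∀ i : Fin d, ∃ g : Sp d → Sp d, MemL2 D g ∧ IsWeakPartial D i u g

open Classical in
/-- The weak `i`-th partial derivative in `L²(D; ℝ^d)` (unique almost everywhere on `D`), and `0`
if there is none. -/
def weakPartial (D : Set (Sp d)) (i : Fin d) (u : Sp d → Sp d) : Sp d → Sp d :=
  if h : ∃ g : Sp d → Sp d, MemL2 D g ∧ IsWeakPartial D i u g then h.choose else 0

/-- `u ∈ H²(D; ℝ^d)`. -/
def MemH2 (D : Set (Sp d)) (u : Sp d → Sp d) : Prop :=
  MemH1 D u ∧ ∀ i : Fin d, MemH1 D (weakPartial D i u)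

/-- The `L²(D; ℝ^d)` norm. -/
def normL2 (D : Set (Sp d)) (u : Sp d → Sp d) : ℝ :=
  (eLpNorm u 2 (volume.restrict D)).toReal

/-- The `H¹(D; ℝ^d)` norm. -/
def normH1 (D : Set (Sp d)) (u : Sp d → Sp d) : ℝ :=
  √(normL2 D u ^ 2 + ∑ i, normL2 D (weakPartial D i u) ^ 2)

/-- The `H²(D; ℝ^d)` norm. -/
def normH2 (D : Set (Sp d)) (u : Sp d → Sp d) : ℝ :=
  √(normL2 D u ^ 2 + ∑ i, normL2 D (weakPartial D i u) ^ 2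
    + ∑ i, ∑ j, normL2 D (weakPartial D j (weakPartial D i u)) ^ 2)

/-- `u ∈ H¹₀(D; ℝ^d)`, the closure in the `H¹` norm of the smooth functions with compact support
in `D`. -/
def MemH1Zero (D : Set (Sp d)) (u : Sp d → Sp d) : Prop :=
  MemH1 D u ∧ ∀ δ : ℝ, 0 < δ → ∃ φ : Sp d → Sp d,
    ContDiff ℝ ∞ φ ∧ HasCompactSupport φ ∧ tsupport φ ⊆ D ∧ normH1 D (u - φ) < δ

/-- `u ∈ W = H²(D; ℝ^d) ∩ H¹₀(D; ℝ^d)`. -/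
def MemW (D : Set (Sp d)) (u : Sp d → Sp d) : Prop :=
  MemH2 D u ∧ MemH1Zero D u

/-- The pointwise (Frobenius) norm `|∇u(x)|` of the weak gradient. -/
def gradNorm (D : Set (Sp d)) (u : Sp d → Sp d) (x : Sp d) : ℝ :=
  √(∑ i, ‖weakPartial D i u x‖ ^ 2)

/-- `c₁` and `c₂` are constants of the embeddings of `W` into `L^∞` and, for the gradient, into
`L⁴`: `‖u‖_{L^∞(D)} ≤ c₁ ‖u‖₂` and `‖∇u‖_{L⁴(D)} ≤ c₂ ‖u‖₂` for all `u ∈ W`. -/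
def AreEmbeddingConstants (D : Set (Sp d)) (c₁ c₂ : ℝ≥0) : Prop :=
  ∀ u : Sp d → Sp d, MemW D u →
    eLpNorm u ⊤ (volume.restrict D) ≤ ENNReal.ofReal (c₁ * normH2 D u) ∧
    eLpNorm (gradNorm D u) 4 (volume.restrict D) ≤ ENNReal.ofReal (c₂ * normH2 D u)

/-! ### The data of the model -/

/-- `C_k = sup_r |F₁^{(k)}(r)|`, where `F₁(r) = f(r²)`. -/
def supDeriv (f : ℝ → ℝ) (k : ℕ) : ℝ :=
  ⨆ r : ℝ, |iteratedDeriv k (fun s : ℝ => f (s ^ 2)) r|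

/-- The potential function `f : [0, ∞) → ℝ` (its values at negative arguments play no role). -/
structure IsPotential (f : ℝ → ℝ) : Prop where
  pos : ∀ r : ℝ, 0 < r → 0 < f r
  smooth : ContDiffOn ℝ ∞ f (Ici 0)
  concave : ConcaveOn ℝ (Ici 0) f
  lim_zero : Tendsto (fun r => f r / r) (𝓝[>] 0) (𝓝 (derivWithin f (Ici 0) 0))
  lim_top : ∃ fInf : ℝ, Tendsto f atTop (𝓝 fInf)
  bdd : ∀ k : ℕ, 1 ≤ k → k ≤ 4 →
    BddAbove (range fun r : ℝ => |iteratedDeriv k (fun s : ℝ => f (s ^ 2)) r|)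

/-- The influence function `J`, as a function of `|ξ|`. -/
structure IsInfluence (J : ℝ → ℝ) : Prop where
  meas : Measurable J
  nonneg : ∀ r : ℝ, 0 ≤ r → 0 ≤ J r
  bdd : ∃ M : ℝ, ∀ r : ℝ, 0 ≤ r → r < 1 → J r ≤ M
  supp : ∀ r : ℝ, 1 ≤ r → J r = 0

/-- `ω̄_ξ(x) = ω(x) ω(x + ε ξ)`. -/
def omegaBar (w : Sp d → ℝ) (ε : ℝ) (ξ x : Sp d) : ℝ := w x * w (x + ε • ξ)

/-- The boundary function `ω` (written `w`), extended by zero outside `D`: it is continuous with values in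
`[0, 1]`, equals `1` at the points of `D` at distance at least `ε` from the boundary, and the
products `ω̄_ξ`, `|ξ| < 1`, are `C²` in `D` with `|∇ω̄_ξ| ≤ c₁` and `|∇²ω̄_ξ| ≤ c₂` (Euclidean
norm of the array of second derivatives). -/
structure IsBoundaryFunction (D : Set (Sp d)) (ε c₁ c₂ : ℝ) (w : Sp d → ℝ) : Prop where
  cont : Continuous w
  nonneg : ∀ x, 0 ≤ w x
  le_one : ∀ x, w x ≤ 1
  eq_zero : ∀ x, x ∉ D → w x = 0
  eq_one : ∀ x ∈ D, ε ≤ Metric.infDist x (frontier D) → w x = 1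
  smooth : ∀ ξ : Sp d, ‖ξ‖ < 1 → ContDiffOn ℝ 2 (omegaBar w ε ξ) D
  grad_le : ∀ ξ : Sp d, ‖ξ‖ < 1 → ∀ x ∈ D, ‖fderiv ℝ (omegaBar w ε ξ) x‖ ≤ c₁
  hess_le : ∀ ξ : Sp d, ‖ξ‖ < 1 → ∀ x ∈ D,
    √(∑ i : Fin d, ∑ j : Fin d,
      iteratedFDeriv ℝ 2 (omegaBar w ε ξ) x ![basisVec i, basisVec j] ^ 2) ≤ c₂

/-! ### The peridynamic force -/

/-- `ω_d`, the volume of the unit ball of `ℝ^d`. -/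
def unitBallVol (d : ℕ) : ℝ := volume.real (Metric.ball (0 : Sp d) 1)

/-- The unit vector `e_{y-x} = (y - x) / |y - x|`. -/
def bondDir (x y : Sp d) : Sp d := ‖y - x‖⁻¹ • (y - x)

/-- The linearized strain `S(y, x; u) = ((u(y) - u(x)) / |y - x|) · e_{y-x}`. -/
def strain (u : Sp d → Sp d) (x y : Sp d) : ℝ :=
  inner ℝ (‖y - x‖⁻¹ • (u y - u x)) (bondDir x y)

/-- The two-point potential
`W^ε(S, y - x) = ω(x) ω(y) (J(|y - x| / ε) / (ε |y - x|)) f(|y - x| S²)`. -/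
def pairPotential (f J : ℝ → ℝ) (w : Sp d → ℝ) (ε : ℝ) (x y : Sp d) (S : ℝ) : ℝ :=
  w x * w y * (J (‖y - x‖ / ε) / (ε * ‖y - x‖)) * f (‖y - x‖ * S ^ 2)

/-- The peridynamic force
`-∇PD^ε(u)(x) = 2 / (ε^d ω_d) ∫_{H_ε(x)} ∂_S W^ε(S(y, x; u), y - x) e_{y-x} dy`,
where `u` is extended by zero outside `D`. -/
def force (D : Set (Sp d)) (f J : ℝ → ℝ) (w : Sp d → ℝ) (ε : ℝ) (u : Sp d → Sp d)
    (x : Sp d) : Sp d :=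
  (2 / (ε ^ d * unitBallVol d)) •
    ∫ y in Metric.ball x ε,
      deriv (pairPotential f J w ε x y) (strain (D.indicator u) x y) • bondDir x y

/-! ### The constants -/

/-- `J̄_α = (1 / ω_d) ∫_{H_1(0)} J(|ξ|) |ξ|^{-α} dξ`. -/
def Jbar (d : ℕ) (J : ℝ → ℝ) (α : ℝ) : ℝ :=
  1 / unitBallVol d * ∫ ξ in Metric.ball (0 : Sp d) 1, J ‖ξ‖ / ‖ξ‖ ^ α

/-- `J̄_α < ∞`. -/
def JbarFinite (d : ℕ) (J : ℝ → ℝ) (α : ℝ) : Prop :=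
  IntegrableOn (fun ξ : Sp d => J ‖ξ‖ / ‖ξ‖ ^ α) (Metric.ball (0 : Sp d) 1)

/-- `L₁ = 4 C₂ J̄₁`. -/
def constL1 (d : ℕ) (f J : ℝ → ℝ) : ℝ := 4 * supDeriv f 2 * Jbar d J 1

/-- `L₂ = 8 C₃ C_{e₁} J̄_{3/2}`. -/
def constL2 (d : ℕ) (f J : ℝ → ℝ) (ce1 : ℝ) : ℝ := 8 * supDeriv f 3 * ce1 * Jbar d J (3 / 2)

/-- `L₃ = 16 C₄ C_{e₁} C_{e₂}² J̄₂`. -/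
def constL3 (d : ℕ) (f J : ℝ → ℝ) (ce1 ce2 : ℝ) : ℝ :=
  16 * supDeriv f 4 * ce1 * ce2 ^ 2 * Jbar d J 2

/-- `L₄ = 16 C₃ C_{e₂}² J̄_{3/2}`. -/
def constL4 (d : ℕ) (f J : ℝ → ℝ) (ce2 : ℝ) : ℝ :=
  16 * supDeriv f 3 * ce2 ^ 2 * Jbar d J (3 / 2)

/-- `L̄₁ = L̄₄ = (4 + 3 C_{ω₁} + C_{ω₂}) L₁`. -/
def constLbar1 (d : ℕ) (f J : ℝ → ℝ) (cw1 cw2 : ℝ) : ℝ :=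
  (4 + 3 * cw1 + cw2) * constL1 d f J

/-- `L̄₂ = (1 + 2 C_{ω₁}) L₂ + L₄`. -/
def constLbar2 (d : ℕ) (f J : ℝ → ℝ) (ce1 ce2 cw1 : ℝ) : ℝ :=
  (1 + 2 * cw1) * constL2 d f J ce1 + constL4 d f J ce2

end Peridynamics

end

open Peridynamics

namespace Peridynamics
noncomputable section

variable {d : ℕ}

/-! ### Mollification -/

/-! Put F(r) = f(r²). Along a bond y = x + εξ the potential is F at the scaled strain A(x) =
(ε|ξ|)^(-1/2) (u(x + εξ) - u(x)) · ξ/|ξ|. The force is therefore a superposition over ξ of ω̄_ξ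
F'(A) ξ/|ξ| against an explicit measure on the unit ball (`deriv_pairPotential_smul`,
`force_ae_eq`). The problem is solved one bond at a time, and the bonds are then added by
Minkowski's integral inequality (`memH2_superpose`). Each strain factor costs s = (ε|ξ|)^(-1/2)
(`normLe_frob_bondStrain`), and the integrals of s, s², s³ are 2J̄₁/ε², 2J̄_{3/2}/ε^{5/2}, 2J̄₂/ε³
(`bondDensity_mul_bondScale_pow`).

For one bond, two derivatives of ω̄ F'(A) give terms linear in A, ∇A, ∇²A and the single quadratic
term F'''(A) ∇A ⊗ ∇A. F is even, so F'(0) = 0 and |F'(A)| ≤ C₂|A|. The quadratic term is in L²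
because ∇u is in L⁴. Differences are treated in the same way. The top-order coefficient difference
(F'''(A) - F'''(B)) ∇A ⊗ ∇A brings in C₄ and the dependence on the squares of the norms
(`frob_bondTermDD_sub_le`).

Regularity needs care at the boundary. Since u is in H¹₀, its extension by zero is weakly
differentiable on the whole space, and A has weak first derivatives on D. The zero extension of ∇u
need not be weakly differentiable across ∂D, so ∇A can be differentiated only on E, the set of x in
D with x + εξ in D. On D outside E the weight ω̄ vanishes, and being nonnegative and smooth it
vanishes there with its gradient. This suffices for the second derivative to exist weakly on all of
D (`integral_weak_chain_rule_of_weight`).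

The embeddings come from a bootstrap on the zero extension (`hasBounds`). Gradient bounds give value
bounds by the Sobolev and Morrey inequalities. Conversely, ∫ |∂ᵢv|^{2(κ+1)} is controlled by
integrating by parts once, with no boundary term, against a truncation of |∂ᵢv|^{2κ} ∂ᵢv
(`lintegral_one_add_sq_rpow_le`). The chain of exponents is ∇v ∈ L², v ∈ L⁶, ∇v ∈ L³, v ∈ L¹⁴, ∇v ∈
L^{7/2}, v ∈ L^∞, ∇v ∈ L⁴.

If J̄₂ is infinite then d = 2. The factor s³ is then avoided: Morrey's inequality with p = 4 makes u
- v Hölder continuous of exponent 1/2, so A - B is bounded with no factor s at all, and only the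
integral of s² is needed (`exists_cubic_constant`). -/

/-- A bump function supported in the ball of radius `1 / (n + 1)`. -/
def mollBump (d n : ℕ) : ContDiffBump (0 : Sp d) where
  rIn := 1 / (2 * (n + 1))
  rOut := 1 / (n + 1)
  rIn_pos := by positivity
  rIn_lt_rOut := by
    have : (0 : ℝ) < n + 1 := by positivity
    rw [div_lt_div_iff_of_pos_left one_pos (by positivity) this]; linarith

open scoped Convolution in
/-- The mollification of `g` at scale `1 / (n + 1)`. -/
def moll (n : ℕ) (g : Sp d → ℝ) : Sp d → ℝ :=
  (mollBump d n).normed volume ⋆[ContinuousLinearMap.lsmul ℝ ℝ, volume] g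

theorem mollBump_rOut_tendsto : Tendsto (fun n => (mollBump d n).rOut) atTop (𝓝 0) :=
  tendsto_one_div_add_atTop_nhds_zero_nat

theorem moll_apply (n : ℕ) (g : Sp d → ℝ) (x : Sp d) :
    moll n g x = ∫ t, (mollBump d n).normed volume t * g (x - t) := rfl

theorem moll_contDiff (n : ℕ) {g : Sp d → ℝ} (hg : LocallyIntegrable g volume) :
    ContDiff ℝ ∞ (moll n g) :=
  (mollBump d n).hasCompactSupport_normed.contDiff_convolution_left _
    (mollBump d n).contDiff_normed hg

theorem moll_ae_tendsto {g : Sp d → ℝ} (hg : LocallyIntegrable g volume) :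
    ∀ᵐ x, Tendsto (fun n => moll n g x) atTop (𝓝 (g x)) := by
  -- `K = 2` is the ratio of outer to inner radius; it has to stay bounded for Lebesgue
  -- differentiation to apply.
  refine ContDiffBump.ae_convolution_tendsto_right_of_locallyIntegrable (K := 2)
    mollBump_rOut_tendsto (Eventually.of_forall fun n => ?_) hg
  have : (0 : ℝ) < n + 1 := by positivity
  simp only [mollBump]
  field_simp
  exact le_rfl

theorem locallyIntegrable_of_memLp_two {g : Sp d → ℝ} (hg : MemLp g 2 volume) :
    LocallyIntegrable g volume :=
  hg.locallyIntegrable (by norm_num)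

/-- The mollifier is a probability density, so Jensen's inequality (monotonicity of `eLpNorm'` in
the exponent for a probability measure) applies at each point. Tonelli and translation invariance
then finish. -/
theorem lintegral_moll_rpow_le (n : ℕ) {g : Sp d → ℝ} (hg : AEStronglyMeasurable g volume)
    {p : ℝ} (hp : 1 ≤ p) :
    ∫⁻ x, ‖moll n g x‖ₑ ^ p ≤ ∫⁻ x, ‖g x‖ₑ ^ p := by
  set ρ := (mollBump d n).normed volume with hρ
  have hρm : Measurable fun t => ENNReal.ofReal (ρ t) :=
    (mollBump d n).continuous_normed.measurable.ennreal_ofReal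
  have hρ1 : ∫⁻ t, ENNReal.ofReal (ρ t) = 1 := by
    rw [← ofReal_integral_eq_lintegral_ofReal (mollBump d n).integrable_normed
      (Eventually.of_forall (mollBump d n).nonneg_normed), (mollBump d n).integral_normed]
    simp
  set ν : Measure (Sp d) := volume.withDensity fun t => ENNReal.ofReal (ρ t) with hν
  have : IsProbabilityMeasure ν := ⟨by rw [hν, withDensity_apply _ MeasurableSet.univ]; simpa using hρ1⟩
  have hac : ν ≪ volume := withDensity_absolutelyContinuous _ _
  have hp0 : 0 < p := by linarith
  have key : ∀ x, ‖moll n g x‖ₑ ^ p ≤ ∫⁻ t, ENNReal.ofReal (ρ t) * ‖g (x - t)‖ₑ ^ p := by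
    intro x
    have hgx : AEStronglyMeasurable (fun t => g (x - t)) volume :=
      hg.comp_quasiMeasurePreserving (quasiMeasurePreserving_sub_left volume x)
    have h1 : ‖moll n g x‖ₑ ≤ ∫⁻ t, ‖g (x - t)‖ₑ ∂ν := by
      rw [moll_apply, lintegral_withDensity_eq_lintegral_mul₀ hρm.aemeasurable hgx.enorm]
      refine (enorm_integral_le_lintegral_enorm _).trans (le_of_eq ?_)
      refine lintegral_congr fun t => ?_
      simp only [enorm_mul, Pi.mul_apply]
      rw [Real.enorm_of_nonneg ((mollBump d n).nonneg_normed t)]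
    have h2 := eLpNorm'_le_eLpNorm'_of_exponent_le (μ := ν) one_pos hp (hgx.mono_ac hac)
    simp only [eLpNorm', ENNReal.rpow_one, div_one] at h2
    have h3 := ENNReal.rpow_le_rpow (h1.trans h2) hp0.le
    rw [← ENNReal.rpow_mul, one_div_mul_cancel hp0.ne', ENNReal.rpow_one,
      lintegral_withDensity_eq_lintegral_mul₀ hρm.aemeasurable (hgx.enorm.pow_const p)] at h3
    exact h3
  have hm : AEMeasurable (fun z : Sp d × Sp d => ENNReal.ofReal (ρ z.2) * ‖g (z.1 - z.2)‖ₑ ^ p)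
      (volume.prod volume) := by
    refine (hρm.comp measurable_snd).aemeasurable.mul (AEMeasurable.pow_const ?_ p)
    exact (hg.comp_quasiMeasurePreserving
      (quasiMeasurePreserving_sub_of_right_invariant volume volume)).enorm
  calc ∫⁻ x, ‖moll n g x‖ₑ ^ p
      ≤ ∫⁻ x, ∫⁻ t, ENNReal.ofReal (ρ t) * ‖g (x - t)‖ₑ ^ p := lintegral_mono key
    _ = ∫⁻ t, ∫⁻ x, ENNReal.ofReal (ρ t) * ‖g (x - t)‖ₑ ^ p := lintegral_lintegral_swap hm
    _ = ∫⁻ t, ENNReal.ofReal (ρ t) * ∫⁻ x, ‖g x‖ₑ ^ p := by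
        refine lintegral_congr fun t => ?_
        rw [lintegral_const_mul' _ _ ENNReal.ofReal_ne_top,
          lintegral_sub_right_eq_self (fun x => ‖g x‖ₑ ^ p) t]
    _ = ∫⁻ x, ‖g x‖ₑ ^ p := by
        rw [lintegral_mul_const _ hρm, hρ1, one_mul]

theorem eLpNorm_moll_le (n : ℕ) {g : Sp d → ℝ} (hg : AEStronglyMeasurable g volume)
    {p : ℝ≥0} (hp : 1 ≤ p) :
    eLpNorm (moll n g) p volume ≤ eLpNorm g p volume := by
  have hp' : (1 : ℝ) ≤ p := by exact_mod_cast hp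
  have hp0 : p ≠ 0 := by positivity
  rw [eLpNorm_nnreal_eq_lintegral hp0, eLpNorm_nnreal_eq_lintegral hp0]
  exact ENNReal.rpow_le_rpow (lintegral_moll_rpow_le n hg hp') (by positivity)

theorem moll_aestronglyMeasurable (n : ℕ) {g : Sp d → ℝ} (hg : LocallyIntegrable g volume) :
    AEStronglyMeasurable (moll n g) volume :=
  (moll_contDiff n hg).continuous.aestronglyMeasurable

theorem eLpNorm_two_eq {α : Type*} [MeasurableSpace α] {μ : Measure α} {E : Type*}
    [NormedAddCommGroup E] (f : α → E) :
    eLpNorm f 2 μ = (∫⁻ x, ‖f x‖ₑ ^ 2 ∂μ) ^ (1 / 2 : ℝ) := by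
  have := eLpNorm_nnreal_eq_lintegral (p := 2) (f := f) (μ := μ) (by norm_num)
  simpa using this

/-- Almost everywhere convergence with norms not exceeding that of the limit implies convergence
in `L²`. -/
theorem tendsto_eLpNorm_two_of_ae_tendsto {α : Type*} [MeasurableSpace α] {μ : Measure α}
    {f : ℕ → α → ℝ} {g : α → ℝ} (hf : ∀ n, AEStronglyMeasurable (f n) μ) (hg : MemLp g 2 μ)
    (hlim : ∀ᵐ x ∂μ, Tendsto (fun n => f n x) atTop (𝓝 (g x)))
    (hle : ∀ n, eLpNorm (f n) 2 μ ≤ eLpNorm g 2 μ) :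
    Tendsto (fun n => eLpNorm (fun x => f n x - g x) 2 μ) atTop (𝓝 0) := by
  have sq : ∀ h : α → ℝ, eLpNorm h 2 μ ^ 2 = ∫⁻ x, ENNReal.ofReal (h x ^ 2) ∂μ := by
    intro h
    rw [eLpNorm_two_eq, ← ENNReal.rpow_natCast, ← ENNReal.rpow_mul]
    norm_num
    refine lintegral_congr fun x => ?_
    rw [← ofReal_norm, ← ENNReal.ofReal_pow (norm_nonneg _), Real.norm_eq_abs, sq_abs]
  set c := ∫⁻ x, ENNReal.ofReal (g x ^ 2) ∂μ with hc
  have hctop : c ≠ ⊤ := by rw [hc, ← sq]; exact ENNReal.pow_ne_top hg.eLpNorm_ne_top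
  -- Parallelogram identity: the two squares add up to 2f² + 2g², and the norm of `f n` does not
  -- exceed that of `g`.
  have hadd : ∀ n, ∫⁻ x, ENNReal.ofReal ((f n x - g x) ^ 2) ∂μ
      + ∫⁻ x, ENNReal.ofReal ((f n x + g x) ^ 2) ∂μ ≤ 4 * c := by
    intro n
    have hfm := (hf n).aemeasurable
    have hgm := hg.1.aemeasurable
    rw [← lintegral_add_left' (by fun_prop)]
    calc _ = ∫⁻ x, (2 * ENNReal.ofReal (f n x ^ 2) + 2 * ENNReal.ofReal (g x ^ 2)) ∂μ := by
          refine lintegral_congr fun x => ?_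
          rw [← ENNReal.ofReal_add (by positivity) (by positivity),
            show (2 : ENNReal) = ENNReal.ofReal 2 by simp,
            ← ENNReal.ofReal_mul (by norm_num), ← ENNReal.ofReal_mul (by norm_num),
            ← ENNReal.ofReal_add (by positivity) (by positivity)]
          congr 1; ring
      _ = 2 * eLpNorm (f n) 2 μ ^ 2 + 2 * c := by
          rw [lintegral_add_left' (by fun_prop), lintegral_const_mul' _ _ (by simp),
            lintegral_const_mul' _ _ (by simp), sq]
      _ ≤ 2 * c + 2 * c := by
          gcongr
          rw [hc, ← sq]
          gcongr
          exact hle n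
      _ = 4 * c := by ring
  -- Fatou for (f + g)², which tends to 4g². With `hadd` this leaves nothing for the integral of (f
  -- - g)² in the limit.
  have hfatou : 4 * c ≤ liminf (fun n => ∫⁻ x, ENNReal.ofReal ((f n x + g x) ^ 2) ∂μ) atTop := by
    refine le_trans (le_of_eq ?_) (lintegral_liminf_le' fun n => ?_)
    · rw [hc, ← lintegral_const_mul' _ _ (by simp)]
      refine lintegral_congr_ae ?_
      filter_upwards [hlim] with x hx
      have : Tendsto (fun n => ENNReal.ofReal ((f n x + g x) ^ 2)) atTop
          (𝓝 (ENNReal.ofReal ((g x + g x) ^ 2))) :=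
        (ENNReal.continuous_ofReal.tendsto _).comp ((hx.add_const _).pow 2)
      rw [this.liminf_eq, show (4 : ENNReal) = ENNReal.ofReal 4 by simp,
        ← ENNReal.ofReal_mul (by norm_num)]
      congr 1; ring
    · have hfm := (hf n).aemeasurable
      have hgm := hg.1.aemeasurable
      fun_prop
  have hlim2 : Tendsto (fun n => ∫⁻ x, ENNReal.ofReal ((f n x - g x) ^ 2) ∂μ) atTop (𝓝 0) := by
    rw [ENNReal.tendsto_nhds_zero]
    intro ε hε
    have h4 : 4 * c ≠ ⊤ := ENNReal.mul_ne_top (by simp) hctop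
    -- Truncated subtraction lowers `4 * c` strictly only when `c ≠ 0`.
    rcases eq_or_ne c 0 with h0 | h0
    · refine Eventually.of_forall fun n => ?_
      have := hadd n
      rw [h0, mul_zero, nonpos_iff_eq_zero, add_eq_zero] at this
      rw [this.1]; exact zero_le
    have hlt : 4 * c - ε < liminf (fun n => ∫⁻ x, ENNReal.ofReal ((f n x + g x) ^ 2) ∂μ) atTop :=
      lt_of_lt_of_le (ENNReal.sub_lt_self h4 (mul_ne_zero (by simp) h0) hε.ne') hfatou
    filter_upwards [eventually_lt_of_lt_liminf hlt] with n hn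
    have hb : ∫⁻ x, ENNReal.ofReal ((f n x + g x) ^ 2) ∂μ ≠ ⊤ :=
      ne_top_of_le_ne_top h4 (le_add_self.trans (hadd n))
    refine (ENNReal.le_sub_of_add_le_right hb (hadd n)).trans ?_
    rw [tsub_le_iff_left]
    have := tsub_le_iff_right.1 hn.le
    exact this
  have := (ENNReal.continuous_rpow_const (y := (1 / 2 : ℝ))).tendsto 0 |>.comp hlim2
  rw [ENNReal.zero_rpow_of_pos (by norm_num)] at this
  refine this.congr fun n => ?_
  simp only [Function.comp]
  rw [← sq, ← ENNReal.rpow_natCast, ← ENNReal.rpow_mul]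
  norm_num

theorem moll_tendsto_eLpNorm {g : Sp d → ℝ} (hg : MemLp g 2 volume) :
    Tendsto (fun n => eLpNorm (fun x => moll n g x - g x) 2 volume) atTop (𝓝 0) :=
  tendsto_eLpNorm_two_of_ae_tendsto
    (fun n => moll_aestronglyMeasurable n (locallyIntegrable_of_memLp_two hg)) hg
    (moll_ae_tendsto (locallyIntegrable_of_memLp_two hg))
    fun n => by simpa using eLpNorm_moll_le n hg.1 (p := 2) (by norm_num)

/-- `b` is a weak `i`-th partial derivative of the scalar function `a` on `E`. -/
def IsWeakPartialScalar (E : Set (Sp d)) (i : Fin d) (a b : Sp d → ℝ) : Prop :=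
  ∀ φ : Sp d → ℝ, ContDiff ℝ ∞ φ → HasCompactSupport φ → tsupport φ ⊆ E →
    ∫ x in E, fderiv ℝ φ x (basisVec i) * a x = - ∫ x in E, φ x * b x

-- The derivative of the convolution falls on the kernel, and y ↦ ρ(x - y) is an admissible test
-- function on `E` as soon as its closed support ball around `x` lies in `E`. The weak derivative is
-- needed near `x` only.
open scoped Convolution in
theorem fderiv_moll_eq (n : ℕ) {E : Set (Sp d)} (i : Fin d) {g h : Sp d → ℝ}
    (hg : LocallyIntegrable g volume) (hw : IsWeakPartialScalar E i g h) {x : Sp d}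
    (hx : Metric.closedBall x (mollBump d n).rOut ⊆ E) :
    fderiv ℝ (moll n g) x (basisVec i) = moll n h x := by
  set ρ := (mollBump d n).normed volume with hρ
  have hρs : ContDiff ℝ ∞ ρ := (mollBump d n).contDiff_normed
  have hρc : HasCompactSupport ρ := (mollBump d n).hasCompactSupport_normed
  have h1 := (hρc.hasFDerivAt_convolution_left (μ := volume) (ContinuousLinearMap.lsmul ℝ ℝ)
    (hρs.of_le (by norm_num)) hg x).fderiv
  have h1' : fderiv ℝ (moll n g) x = ∫ t, (ContinuousLinearMap.precompL (Sp d)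
      (ContinuousLinearMap.lsmul ℝ ℝ)) (fderiv ℝ ρ t) (g (x - t)) := h1
  have hint : Integrable fun t => (ContinuousLinearMap.precompL (Sp d)
      (ContinuousLinearMap.lsmul ℝ ℝ)) (fderiv ℝ ρ t) (g (x - t)) :=
    ((hρc.fderiv ℝ).convolutionExists_left _ (hρs.continuous_fderiv (by simp)) hg x)
  set φ : Sp d → ℝ := fun y => ρ (x - y) with hφ
  have hφs : ContDiff ℝ ∞ φ := hρs.comp (contDiff_const.sub contDiff_id)
  have hsupp : tsupport φ ⊆ Metric.closedBall x (mollBump d n).rOut := by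
    refine closure_minimal ?_ Metric.isClosed_closedBall
    intro y hy
    have : x - y ∈ Function.support ρ := hy
    rw [(mollBump d n).support_normed_eq] at this
    rw [Metric.mem_closedBall, dist_comm, dist_eq_norm]
    simpa using (mem_ball_zero_iff.1 this).le
  have hφc : HasCompactSupport φ :=
    HasCompactSupport.of_support_subset_isCompact (isCompact_closedBall x _)
      ((subset_tsupport _).trans hsupp)
  have hd : ∀ y, fderiv ℝ φ y (basisVec i) = - fderiv ℝ ρ (x - y) (basisVec i) := by
    intro y
    have hh : HasFDerivAt φ ((fderiv ℝ ρ (x - y)).comp (-ContinuousLinearMap.id ℝ (Sp d))) y :=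
      HasFDerivAt.comp y (hρs.differentiable (by simp) (x - y)).hasFDerivAt
        ((hasFDerivAt_id y).const_sub x)
    rw [hh.fderiv]; simp
  have hw' := hw φ hφs hφc (hsupp.trans hx)
  have e1 : ∀ F : Sp d → ℝ, (∀ y, y ∉ Metric.closedBall x (mollBump d n).rOut → F y = 0) →
      ∫ y in E, F y = ∫ y, F y := by
    intro F hF
    exact setIntegral_eq_integral_of_forall_compl_eq_zero fun y hy => hF y fun hy' => hy (hx hy')
  have z1 : ∀ y, y ∉ Metric.closedBall x (mollBump d n).rOut → φ y = 0 := fun y hy =>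
    image_eq_zero_of_notMem_tsupport fun hy' => hy (hsupp hy')
  have z2 : ∀ y, y ∉ Metric.closedBall x (mollBump d n).rOut →
      fderiv ℝ φ y (basisVec i) = 0 := fun y hy => by
    have : y ∉ tsupport (fderiv ℝ φ) := fun hy' => hy (hsupp (tsupport_fderiv_subset ℝ hy'))
    rw [image_eq_zero_of_notMem_tsupport this]; rfl
  rw [e1 _ (fun y hy => by rw [z2 y hy, zero_mul]), e1 _ (fun y hy => by rw [z1 y hy, zero_mul])]
    at hw'
  have s1 : fderiv ℝ (moll n g) x (basisVec i) = ∫ t, fderiv ℝ ρ t (basisVec i) * g (x - t) := by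
    rw [h1', ContinuousLinearMap.integral_apply hint]
    rfl
  rw [s1, moll_apply, ← integral_sub_left_eq_self (fun t => ρ t * h (x - t)) volume x,
    ← integral_sub_left_eq_self (fun t => fderiv ℝ ρ t (basisVec i) * g (x - t)) volume x]
  simp only [sub_sub_cancel]
  have : ∫ y, fderiv ℝ ρ (x - y) (basisVec i) * g y
      = - ∫ y, fderiv ℝ φ y (basisVec i) * g y := by
    rw [← integral_neg]; congr 1; ext y; rw [hd]; ring
  rw [this, hw', neg_neg]

end
end Peridynamics

namespace Peridynamics
noncomputable section

variable {d : ℕ}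

/-! ### The chain rule for weak derivatives -/

theorem integrable_mul_of_memLp_two {α : Type*} [MeasurableSpace α] {μ : Measure α} {f g : α → ℝ}
    (hf : MemLp f 2 μ) (hg : MemLp g 2 μ) : Integrable (fun x => f x * g x) μ :=
  MemLp.integrable_mul (p := 2) (q := 2) hf hg

theorem abs_integral_mul_le_eLpNorm {α : Type*} [MeasurableSpace α] {μ : Measure α} {f g : α → ℝ}
    (hf : MemLp f 2 μ) (hg : MemLp g 2 μ) :
    ∫ x, |f x * g x| ∂μ ≤ (eLpNorm f 2 μ).toReal * (eLpNorm g 2 μ).toReal := by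
  have h := eLpNorm_smul_le_mul_eLpNorm (p := 2) (q := 2) (r := 1) hg.1 hf.1
  rw [eLpNorm_one_eq_lintegral_enorm] at h
  rw [← ENNReal.toReal_mul]
  have e : ∫ x, |f x * g x| ∂μ = (∫⁻ x, ‖(f • g) x‖ₑ ∂μ).toReal := by
    rw [← integral_norm_eq_lintegral_enorm (hf.1.smul hg.1)]
    rfl
  rw [e]
  exact ENNReal.toReal_mono (ENNReal.mul_ne_top hf.eLpNorm_ne_top hg.eLpNorm_ne_top) h

/-- The limit passage used for products of mollified functions. For the fixed integrable product `f₀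
k₀` the bounded factor is handled by dominated convergence; the error f k - f₀ k₀ tends to zero in
L¹ by Cauchy–Schwarz. -/
theorem tendsto_integral_mul_mul {α : Type*} [MeasurableSpace α] {μ : Measure α}
    {h f k : ℕ → α → ℝ} {h₀ f₀ k₀ : α → ℝ} {C : ℝ}
    (hh : ∀ n, AEStronglyMeasurable (h n) μ) (hC : ∀ n x, |h n x| ≤ C)
    (hlim : ∀ᵐ x ∂μ, Tendsto (fun n => h n x) atTop (𝓝 (h₀ x)))
    (hf : ∀ n, MemLp (f n) 2 μ) (hf₀ : MemLp f₀ 2 μ)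
    (hfl : Tendsto (fun n => eLpNorm (fun x => f n x - f₀ x) 2 μ) atTop (𝓝 0))
    (hk : ∀ n, MemLp (k n) 2 μ) (hk₀ : MemLp k₀ 2 μ)
    (hkl : Tendsto (fun n => eLpNorm (fun x => k n x - k₀ x) 2 μ) atTop (𝓝 0)) :
    Tendsto (fun n => ∫ x, h n x * (f n x * k n x) ∂μ) atTop (𝓝 (∫ x, h₀ x * (f₀ x * k₀ x) ∂μ)) := by
  have hi₀ : Integrable (fun x => f₀ x * k₀ x) μ := integrable_mul_of_memLp_two hf₀ hk₀
  have hi : ∀ n, Integrable (fun x => f n x * k n x) μ := fun n =>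
    integrable_mul_of_memLp_two (hf n) (hk n)
  have hbd : ∀ n {g : α → ℝ}, Integrable g μ → Integrable (fun x => h n x * g x) μ := fun n g hg =>
    hg.bdd_mul (hh n) (c := C) (Eventually.of_forall fun x => hC n x)
  have h1 : Tendsto (fun n => ∫ x, h n x * (f₀ x * k₀ x) ∂μ) atTop
      (𝓝 (∫ x, h₀ x * (f₀ x * k₀ x) ∂μ)) := by
    refine tendsto_integral_of_dominated_convergence (fun x => C * |f₀ x * k₀ x|)
      (fun n => (hh n).mul hi₀.1) (hi₀.abs.const_mul C) (fun n => Eventually.of_forall fun x => ?_) ?_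
    · rw [Real.norm_eq_abs, abs_mul]
      exact mul_le_mul_of_nonneg_right (hC n x) (abs_nonneg _)
    · filter_upwards [hlim] with x hx using hx.mul_const _
  have h2 : Tendsto (fun n => ∫ x, h n x * (f n x * k n x - f₀ x * k₀ x) ∂μ) atTop (𝓝 0) := by
    set F := fun n => (eLpNorm (fun x => f n x - f₀ x) 2 μ).toReal
    set K := fun n => (eLpNorm (fun x => k n x - k₀ x) 2 μ).toReal
    have hF : Tendsto F atTop (𝓝 0) := (ENNReal.tendsto_toReal ENNReal.zero_ne_top).comp hfl
    have hK : Tendsto K atTop (𝓝 0) := (ENNReal.tendsto_toReal ENNReal.zero_ne_top).comp hkl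
    -- The three summands come from f k - f₀ k₀ = (f - f₀)(k - k₀) + (f - f₀) k₀ + f₀ (k - k₀).
    have hlimB : Tendsto (fun n => |C| * (F n * K n + F n * (eLpNorm k₀ 2 μ).toReal
        + (eLpNorm f₀ 2 μ).toReal * K n)) atTop (𝓝 0) := by
      have := (((hF.mul hK).add (hF.mul_const (eLpNorm k₀ 2 μ).toReal)).add
        (hK.const_mul (eLpNorm f₀ 2 μ).toReal)).const_mul |C|
      simpa using this
    refine squeeze_zero_norm (fun n => ?_) hlimB
    have m1 := (hf n).sub hf₀
    have m2 := (hk n).sub hk₀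
    have i1 := (integrable_mul_of_memLp_two m1 m2).abs
    have i2 := (integrable_mul_of_memLp_two m1 hk₀).abs
    have i3 := (integrable_mul_of_memLp_two hf₀ m2).abs
    have b1 := abs_integral_mul_le_eLpNorm m1 m2
    have b2 := abs_integral_mul_le_eLpNorm m1 hk₀
    have b3 := abs_integral_mul_le_eLpNorm hf₀ m2
    calc ‖∫ x, h n x * (f n x * k n x - f₀ x * k₀ x) ∂μ‖
        ≤ ∫ x, |C| * (|(f n - f₀) x * (k n - k₀) x| + |(f n - f₀) x * k₀ x|
            + |f₀ x * (k n - k₀) x|) ∂μ := by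
          refine norm_integral_le_of_norm_le (((i1.add i2).add i3).const_mul |C|)
            (Eventually.of_forall fun x => ?_)
          rw [Real.norm_eq_abs, abs_mul]
          refine mul_le_mul ((hC n x).trans (le_abs_self C)) ?_ (abs_nonneg _) (abs_nonneg _)
          refine le_trans (le_of_eq ?_) (abs_add_three _ _ _)
          simp only [Pi.sub_apply]
          congr 1; ring
      _ ≤ _ := by
          rw [integral_const_mul, integral_add (i1.fun_add i2) i3, integral_add i1 i2]
          refine mul_le_mul_of_nonneg_left ?_ (abs_nonneg _)
          exact add_le_add (add_le_add b1 b2) b3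
  have := h2.add h1
  rw [zero_add] at this
  refine this.congr fun n => ?_
  have hsub : Integrable (fun x => f n x * k n x - f₀ x * k₀ x) μ := (hi n).sub hi₀
  rw [← integral_add (hbd n hsub) (hbd n hi₀)]
  congr 1; ext x; ring

theorem memLp_indicator_of_restrict {α : Type*} [MeasurableSpace α] {μ : Measure α} {E : Set α}
    (hE : MeasurableSet E) {g : α → ℝ} {p : ENNReal} (hg : MemLp g p (μ.restrict E)) :
    MemLp (E.indicator g) p μ := (memLp_indicator_iff_restrict hE).2 hg

theorem setIntegral_mul_indicator {E : Set (Sp d)} (hE : MeasurableSet E) (f g : Sp d → ℝ) :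
    ∫ x in E, f x * E.indicator g x = ∫ x in E, f x * g x :=
  setIntegral_congr_fun hE fun x hx => by simp only [indicator_of_mem hx]

theorem IsWeakPartialScalar.indicator {E : Set (Sp d)} (hE : MeasurableSet E) {i : Fin d}
    {a b : Sp d → ℝ} (h : IsWeakPartialScalar E i a b) :
    IsWeakPartialScalar E i (E.indicator a) (E.indicator b) := by
  intro φ h1 h2 h3
  rw [setIntegral_mul_indicator hE, setIntegral_mul_indicator hE]
  exact h φ h1 h2 h3

theorem integral_chain_rule_of_contDiff {G : ℝ → ℝ} (hG : ContDiff ℝ 1 G) {a b ψ : Sp d → ℝ}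
    (ha : ContDiff ℝ 1 a) (hb : ContDiff ℝ 1 b) (hψ : ContDiff ℝ 1 ψ) (hc : HasCompactSupport ψ)
    (v : Sp d) :
    ∫ x, fderiv ℝ ψ x v * (G (a x) * b x)
      = -∫ x, ψ x * (deriv G (a x) * fderiv ℝ a x v * b x + G (a x) * fderiv ℝ b x v) := by
  set g : Sp d → ℝ := fun x => G (a x) * b x with hg
  have hgs : ContDiff ℝ 1 g := (hG.comp ha).mul hb
  have hgd : ∀ x, fderiv ℝ g x v
      = deriv G (a x) * fderiv ℝ a x v * b x + G (a x) * fderiv ℝ b x v := by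
    intro x
    have h1 : HasFDerivAt (fun x => G (a x)) (deriv G (a x) • fderiv ℝ a x) x :=
      ((hG.differentiable (by simp) (a x)).hasDerivAt).comp_hasFDerivAt x
        (ha.differentiable (by simp) x).hasFDerivAt
    have h2 := h1.mul (hb.differentiable (by simp) x).hasFDerivAt
    have : fderiv ℝ g x = _ := h2.fderiv
    rw [this]
    simp only [add_apply, smul_apply, smul_eq_mul]
    ring
  have hψ' : Continuous fun x => fderiv ℝ ψ x v := (hψ.continuous_fderiv (by simp)).clm_apply
    continuous_const
  have hg' : Continuous fun x => fderiv ℝ g x v := (hgs.continuous_fderiv (by simp)).clm_apply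
    continuous_const
  have hψc : HasCompactSupport fun x => fderiv ℝ ψ x v := hc.fderiv_apply (𝕜 := ℝ) v
  have := integral_mul_fderiv_eq_neg_fderiv_mul_of_integrable (μ := volume) (f := ψ) (g := g)
    (v := v) ((hψ'.mul hgs.continuous).integrable_of_hasCompactSupport hψc.mul_right)
    ((hψ.continuous.mul hg').integrable_of_hasCompactSupport hc.mul_right)
    ((hψ.continuous.mul hgs.continuous).integrable_of_hasCompactSupport hc.mul_right)
    (fun x _ => hψ.differentiable (by simp) x) (fun x _ => hgs.differentiable (by simp) x)
  rw [eq_neg_iff_add_eq_zero] at this ⊢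
  rw [add_comm, ← this]
  simp_rw [hgd]
  rfl

/-- All functions are cut off to `E` and mollified. On the compact support of `ψ`, once the scale is
below the distance to the complement of `E`, derivatives of mollifications are mollifications of the
weak derivatives, so the classical identity holds; then the scale tends to zero. Only almost
everywhere convergence of G(A) and G'(A) is available, which suffices because both are bounded. `ψ`
is only `C¹` so that it may contain a weight of limited smoothness. -/
theorem integral_weak_chain_rule {E : Set (Sp d)} (hE : IsOpen E) {j : Fin d}
    {A A' B B' : Sp d → ℝ} (hA : MemLp A 2 (volume.restrict E))
    (hA' : MemLp A' 2 (volume.restrict E)) (hB : MemLp B 2 (volume.restrict E))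
    (hB' : MemLp B' 2 (volume.restrict E)) (wA : IsWeakPartialScalar E j A A')
    (wB : IsWeakPartialScalar E j B B') {G : ℝ → ℝ} (hG : ContDiff ℝ 1 G) {C : ℝ}
    (hC : ∀ t, |G t| ≤ C) (hC' : ∀ t, |deriv G t| ≤ C) {ψ : Sp d → ℝ} (hψ : ContDiff ℝ 1 ψ)
    (hc : HasCompactSupport ψ) (hs : tsupport ψ ⊆ E) :
    ∫ x in E, fderiv ℝ ψ x (basisVec j) * (G (A x) * B x)
      = -∫ x in E, ψ x * (deriv G (A x) * A' x * B x + G (A x) * B' x) := by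
  have hEm := hE.measurableSet
  set a := E.indicator A with ha
  set a' := E.indicator A' with ha'
  set b := E.indicator B with hb
  set b' := E.indicator B' with hb'
  have la : MemLp a 2 volume := memLp_indicator_of_restrict hEm hA
  have la' : MemLp a' 2 volume := memLp_indicator_of_restrict hEm hA'
  have lb : MemLp b 2 volume := memLp_indicator_of_restrict hEm hB
  have lb' : MemLp b' 2 volume := memLp_indicator_of_restrict hEm hB'
  have loc := fun {g : Sp d → ℝ} (hg : MemLp g 2 volume) => locallyIntegrable_of_memLp_two hg
  have wa := wA.indicator hEm
  have wb := wB.indicator hEm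
  obtain ⟨δ, hδ, hδE⟩ := hc.isCompact.exists_cthickening_subset_open hE hs
  have hev : ∀ᶠ n in atTop, (mollBump d n).rOut ≤ δ :=
    (mollBump_rOut_tendsto.eventually_lt_const hδ).mono fun n hn => hn.le
  have hball : ∀ n, (mollBump d n).rOut ≤ δ → ∀ x ∈ tsupport ψ,
      Metric.closedBall x (mollBump d n).rOut ⊆ E := fun n hn x hx =>
    ((Metric.closedBall_subset_closedBall hn).trans
      (Metric.closedBall_subset_cthickening hx δ)).trans hδE
  set D1 : Sp d → ℝ := fun x => fderiv ℝ ψ x (basisVec j) with hD1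
  have hD1c : Continuous D1 := (hψ.continuous_fderiv (by simp)).clm_apply continuous_const
  have hD1s : HasCompactSupport D1 := hc.fderiv_apply (𝕜 := ℝ) (basisVec j)
  have lD1 : MemLp D1 2 volume := hD1c.memLp_of_hasCompactSupport hD1s
  have lψ : MemLp ψ 2 volume := hψ.continuous.memLp_of_hasCompactSupport hc
  obtain ⟨M, hM⟩ := hψ.continuous.bounded_above_of_compact_support hc
  have hz : ∀ {x}, x ∉ tsupport ψ → ψ x = 0 := fun hx => image_eq_zero_of_notMem_tsupport hx
  have hz' : ∀ {x}, x ∉ tsupport ψ → D1 x = 0 := fun {x} hx => by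
    have : x ∉ tsupport (fderiv ℝ ψ) := fun h => hx (tsupport_fderiv_subset ℝ h)
    simp only [hD1, image_eq_zero_of_notMem_tsupport this]; rfl
  have lm : ∀ n {g : Sp d → ℝ}, MemLp g 2 volume → MemLp (moll n g) 2 volume := fun n g hg =>
    ⟨moll_aestronglyMeasurable n (loc hg), lt_of_le_of_lt
      (by simpa using eLpNorm_moll_le n hg.1 (p := 2) (by norm_num)) hg.2⟩
  have hz0 : Tendsto (fun _ : ℕ => eLpNorm (fun x => D1 x - D1 x) 2 volume) atTop (𝓝 0) := by simp
  have hz1 : Tendsto (fun _ : ℕ => eLpNorm (fun x => ψ x - ψ x) 2 volume) atTop (𝓝 0) := by simp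
  have hGm : ∀ n, AEStronglyMeasurable (fun x => G (moll n a x)) volume := fun n =>
    (hG.continuous.comp (moll_contDiff n (loc la)).continuous).aestronglyMeasurable
  have hGl : ∀ᵐ x, Tendsto (fun n => G (moll n a x)) atTop (𝓝 (G (a x))) := by
    filter_upwards [moll_ae_tendsto (loc la)] with x hx
    exact (hG.continuous.tendsto _).comp hx
  have hG'c : Continuous (deriv G) := hG.continuous_deriv (by simp)
  have t1 := tendsto_integral_mul_mul hGm (fun n x => hC _) hGl (fun n => lm n lb) lb
    (moll_tendsto_eLpNorm lb) (fun _ => lD1) lD1 hz0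
  have t2 := tendsto_integral_mul_mul hGm (fun n x => hC _) hGl (fun n => lm n lb') lb'
    (moll_tendsto_eLpNorm lb') (fun _ => lψ) lψ hz1
  have t3 := tendsto_integral_mul_mul (h := fun n x => ψ x * deriv G (moll n a x))
    (h₀ := fun x => ψ x * deriv G (a x)) (C := M * C)
    (fun n => (hψ.continuous.mul
      (hG'c.comp (moll_contDiff n (loc la)).continuous)).aestronglyMeasurable)
    (fun n x => by
      rw [abs_mul]
      exact mul_le_mul (hM x) (hC' _) (abs_nonneg _) ((norm_nonneg _).trans (hM x)))
    (by
      filter_upwards [moll_ae_tendsto (loc la)] with x hx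
      exact ((hG'c.tendsto _).comp hx).const_mul _)
    (fun n => lm n la') la' (moll_tendsto_eLpNorm la') (fun n => lm n lb) lb
    (moll_tendsto_eLpNorm lb)
  have hbdd : ∀ {h f : Sp d → ℝ} {c : ℝ}, AEStronglyMeasurable h volume → (∀ x, |h x| ≤ c) →
      Integrable f volume → Integrable (fun x => h x * f x) volume := fun hh hcb hf =>
    hf.bdd_mul hh (Eventually.of_forall fun x => hcb x)
  have heq : ∀ᶠ n in atTop, ∫ x, G (moll n a x) * (moll n b x * D1 x)
      = -((∫ x, ψ x * deriv G (moll n a x) * (moll n a' x * moll n b x))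
        + ∫ x, G (moll n a x) * (moll n b' x * ψ x)) := by
    filter_upwards [hev] with n hn
    have h1 := integral_chain_rule_of_contDiff hG
      ((moll_contDiff n (loc la)).of_le (by norm_num))
      ((moll_contDiff n (loc lb)).of_le (by norm_num)) hψ hc (basisVec j)
    rw [← integral_add]
    · rw [show (fun x => G (moll n a x) * (moll n b x * D1 x))
          = fun x => fderiv ℝ ψ x (basisVec j) * (G (moll n a x) * moll n b x) by
          ext x; simp only [hD1]; ring, h1]
      congr 2; ext x
      by_cases hx : x ∈ tsupport ψ
      · rw [fderiv_moll_eq n j (loc la) wa (hball n hn x hx),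
          fderiv_moll_eq n j (loc lb) wb (hball n hn x hx)]
        ring
      · rw [hz hx]; ring
    · refine hbdd (c := M * C) ?_ ?_ (integrable_mul_of_memLp_two (lm n la') (lm n lb))
      · exact (hψ.continuous.mul
          (hG'c.comp (moll_contDiff n (loc la)).continuous)).aestronglyMeasurable
      · intro x
        rw [abs_mul]
        exact mul_le_mul (hM x) (hC' _) (abs_nonneg _) ((norm_nonneg _).trans (hM x))
    · exact hbdd (hGm n) (fun x => hC _) (integrable_mul_of_memLp_two (lm n lb') lψ)
  have hfin := tendsto_nhds_unique (t1.congr' heq) ((t3.add t2).neg)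
  have hGa : AEStronglyMeasurable (fun x => G (a x)) volume :=
    hG.continuous.comp_aestronglyMeasurable la.1
  rw [← integral_add] at hfin
  · have e1 : ∫ x in E, fderiv ℝ ψ x (basisVec j) * (G (A x) * B x)
        = ∫ x, G (a x) * (b x * D1 x) := by
      refine Eq.trans ?_ (setIntegral_eq_integral_of_forall_compl_eq_zero (s := E) ?_)
      · refine setIntegral_congr_fun hEm fun x hx => ?_
        simp only [ha, hb, indicator_of_mem hx, hD1]; ring
      · intro x hx
        rw [hz' fun h => hx (hs h)]; ring
    have e2 : ∫ x in E, ψ x * (deriv G (A x) * A' x * B x + G (A x) * B' x)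
        = ∫ x, (ψ x * deriv G (a x) * (a' x * b x) + G (a x) * (b' x * ψ x)) := by
      refine Eq.trans ?_ (setIntegral_eq_integral_of_forall_compl_eq_zero (s := E) ?_)
      · refine setIntegral_congr_fun hEm fun x hx => ?_
        simp only [ha, hb, ha', hb', indicator_of_mem hx]; ring
      · intro x hx
        rw [hz fun h => hx (hs h)]; ring
    rw [e1, e2, hfin]
  · refine hbdd (c := M * C) ?_ ?_ (integrable_mul_of_memLp_two la' lb)
    · exact hψ.continuous.aestronglyMeasurable.mul (hG'c.comp_aestronglyMeasurable la.1)
    · intro x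
      rw [abs_mul]
      exact mul_le_mul (hM x) (hC' _) (abs_nonneg _) ((norm_nonneg _).trans (hM x))
  · exact hbdd hGa (fun x => hC _) (integrable_mul_of_memLp_two lb' lψ)

end
end Peridynamics

namespace Peridynamics
noncomputable section

variable {d : ℕ}

/-! ### Weights vanishing outside a smaller set -/

/-- A ramp with values in `[0, 1]`, vanishing on `(-∞, 1 / (n + 1)]`. -/
def ramp (n : ℕ) (t : ℝ) : ℝ := min 1 (max 0 ((n + 1) * t - 1))

/-- The primitive of `ramp n`, a `C¹` approximation of the identity of `[0, ∞)`. -/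
def softCut (n : ℕ) (t : ℝ) : ℝ := ∫ s in (0 : ℝ)..t, ramp n s

theorem ramp_continuous (n : ℕ) : Continuous (ramp n) := by unfold ramp; fun_prop

theorem ramp_nonneg (n : ℕ) (t : ℝ) : 0 ≤ ramp n t := le_min zero_le_one (le_max_left _ _)

theorem ramp_le_one (n : ℕ) (t : ℝ) : ramp n t ≤ 1 := min_le_left _ _

theorem ramp_tendsto {t : ℝ} (ht : 0 < t) : Tendsto (fun n => ramp n t) atTop (𝓝 1) := by
  have h : Tendsto (fun n : ℕ => ((n : ℝ) + 1) * t - 1) atTop atTop :=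
    tendsto_atTop_add_const_right _ _
      ((tendsto_atTop_add_const_right _ _ tendsto_natCast_atTop_atTop).atTop_mul_const ht)
  refine tendsto_const_nhds.congr' ?_
  filter_upwards [h.eventually_ge_atTop 1] with n hn
  rw [ramp, min_eq_left (hn.trans (le_max_right _ _))]

theorem softCut_hasDerivAt (n : ℕ) (t : ℝ) : HasDerivAt (softCut n) (ramp n t) t :=
  intervalIntegral.integral_hasDerivAt_right ((ramp_continuous n).intervalIntegrable _ _)
    (ramp_continuous n).stronglyMeasurable.stronglyMeasurableAtFilter
    (ramp_continuous n).continuousAt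

theorem softCut_contDiff (n : ℕ) : ContDiff ℝ 1 (softCut n) := by
  rw [contDiff_one_iff_deriv]
  refine ⟨fun t => (softCut_hasDerivAt n t).differentiableAt, ?_⟩
  rw [funext fun t => (softCut_hasDerivAt n t).deriv]
  exact ramp_continuous n

theorem softCut_eq_zero {n : ℕ} {t : ℝ} (ht : t < 1 / (n + 1)) : softCut n t = 0 := by
  have hn : (0 : ℝ) < n + 1 := by positivity
  rw [softCut]
  refine intervalIntegral.integral_zero_ae (Eventually.of_forall fun s hs => ?_)
  have : s ≤ 1 / (n + 1) := by
    rcases (mem_uIoc.1 hs) with h | h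
    · exact h.2.trans ht.le
    · exact h.2.trans (by positivity)
  rw [le_div_iff₀ hn] at this
  rw [ramp, max_eq_left (by linarith), min_eq_right zero_le_one]

theorem abs_softCut_le (n : ℕ) (t : ℝ) : |softCut n t| ≤ |t| := by
  have := intervalIntegral.norm_integral_le_of_norm_le_const (a := 0) (b := t) (f := ramp n)
    (C := 1) fun s _ => by rw [Real.norm_of_nonneg (ramp_nonneg n s)]; exact ramp_le_one n s
  simpa [softCut] using this

theorem softCut_tendsto {t : ℝ} (ht : 0 ≤ t) : Tendsto (fun n => softCut n t) atTop (𝓝 t) := by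
  have h := intervalIntegral.tendsto_integral_filter_of_dominated_convergence
    (μ := volume) (a := 0) (b := t) (l := atTop) (F := ramp) (f := fun _ => 1) (fun _ => 1)
    (Eventually.of_forall fun n => (ramp_continuous n).aestronglyMeasurable)
    (Eventually.of_forall fun n => Eventually.of_forall fun s _ => by
      rw [Real.norm_of_nonneg (ramp_nonneg n s)]; exact ramp_le_one n s)
    intervalIntegrable_const
    (Eventually.of_forall fun s hs => ramp_tendsto (by rw [uIoc_of_le ht] at hs; exact hs.1))
  simpa [softCut] using h

theorem contDiff_mul_of_tsupport_subset {D : Set (Sp d)} (hD : IsOpen D) {k : WithTop ℕ∞}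
    {φ η : Sp d → ℝ} (hφ : ContDiff ℝ k φ) (hη : ContDiffOn ℝ k η D) (hs : tsupport φ ⊆ D) :
    ContDiff ℝ k fun x => φ x * η x := by
  rw [contDiff_iff_contDiffAt]
  intro x
  by_cases hx : x ∈ D
  · exact hφ.contDiffAt.mul (hη.contDiffAt (hD.mem_nhds hx))
  · have h0 : (fun x => φ x * η x) =ᶠ[𝓝 x] fun _ => 0 := by
      filter_upwards [(isClosed_tsupport φ).isOpen_compl.mem_nhds fun h => hx (hs h)] with y hy
      rw [image_eq_zero_of_notMem_tsupport hy, zero_mul]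
    exact contDiffAt_const.congr_of_eventuallyEq h0

theorem fderiv_apply_eq_zero_of_notMem_tsupport {φ : Sp d → ℝ} {x : Sp d} (hx : x ∉ tsupport φ)
    (v : Sp d) : fderiv ℝ φ x v = 0 := by
  have : x ∉ tsupport (fderiv ℝ φ) := fun h => hx (tsupport_fderiv_subset ℝ h)
  rw [image_eq_zero_of_notMem_tsupport this]; rfl

theorem fderiv_mul_of_tsupport_subset {D : Set (Sp d)} (hD : IsOpen D)
    {φ η : Sp d → ℝ} (hφ : ContDiff ℝ 1 φ) (hη : ContDiffOn ℝ 1 η D) (hs : tsupport φ ⊆ D)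
    (v x : Sp d) :
    fderiv ℝ (fun x => φ x * η x) x v = fderiv ℝ φ x v * η x + φ x * fderiv ℝ η x v := by
  by_cases hx : x ∈ D
  · have h := (hφ.differentiable (by simp) x).hasFDerivAt.mul
      ((hη.contDiffAt (hD.mem_nhds hx)).differentiableAt (by simp)).hasFDerivAt
    have h' : fderiv ℝ (fun x => φ x * η x) x = _ := h.fderiv
    rw [h']
    simp only [add_apply, smul_apply, smul_eq_mul]
    ring
  · have hx' : x ∉ tsupport φ := fun h => hx (hs h)
    have hx2 : x ∉ tsupport fun x => φ x * η x := fun h => hx' (tsupport_mul_subset_left h)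
    rw [fderiv_apply_eq_zero_of_notMem_tsupport hx', fderiv_apply_eq_zero_of_notMem_tsupport hx2,
      image_eq_zero_of_notMem_tsupport hx']
    ring

theorem memLp_mul_of_bounded {α : Type*} [MeasurableSpace α] {μ : Measure α} {p : ENNReal}
    {h f : α → ℝ} {C : ℝ} (hh : AEStronglyMeasurable h μ) (hC : ∀ x, |h x| ≤ C)
    (hf : MemLp f p μ) : MemLp (fun x => h x * f x) p μ := by
  refine MemLp.of_le_mul (c := C) hf (hh.mul hf.1) (Eventually.of_forall fun x => ?_)
  rw [Real.norm_eq_abs, abs_mul]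
  exact mul_le_mul_of_nonneg_right (hC x) (abs_nonneg _)

theorem integrable_mul_of_bounded {α : Type*} [MeasurableSpace α] {μ : Measure α}
    {h f : α → ℝ} {C : ℝ} (hh : AEStronglyMeasurable h μ) (hC : ∀ x, |h x| ≤ C)
    (hf : Integrable f μ) : Integrable (fun x => h x * f x) μ :=
  hf.bdd_mul hh (Eventually.of_forall fun x => hC x)

/-- The weak chain rule on `D`, where the weight `η` vanishes at the points of `D` outside `E` and
the weak derivatives exist on `E` only. -/
theorem integral_weak_chain_rule_of_weight {D E : Set (Sp d)} (hD : IsOpen D) (hE : IsOpen E)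
    (hED : E ⊆ D) {j : Fin d}
    {A A' B B' : Sp d → ℝ} (hA : MemLp A 2 (volume.restrict E))
    (hA' : MemLp A' 2 (volume.restrict E)) (hB : MemLp B 2 (volume.restrict E))
    (hB' : MemLp B' 2 (volume.restrict E)) (wA : IsWeakPartialScalar E j A A')
    (wB : IsWeakPartialScalar E j B B') {G : ℝ → ℝ} (hG : ContDiff ℝ 1 G) {C : ℝ}
    (hC : ∀ t, |G t| ≤ C) (hC' : ∀ t, |deriv G t| ≤ C) {φ : Sp d → ℝ} (hφ : ContDiff ℝ ∞ φ)
    (hc : HasCompactSupport φ) (hs : tsupport φ ⊆ D) {η : Sp d → ℝ} (hη : ContDiffOn ℝ 1 η D)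
    (hη0 : ∀ x ∈ D, 0 ≤ η x) (hηE : ∀ x ∈ D, x ∉ E → η x = 0) :
    ∫ x in D, fderiv ℝ φ x (basisVec j) * (η x * (G (A x) * B x))
      = -∫ x in D, φ x * (fderiv ℝ η x (basisVec j) * (G (A x) * B x)
          + η x * (deriv G (A x) * A' x * B x + G (A x) * B' x)) := by
  have hφ1 : ContDiff ℝ 1 φ := hφ.of_le (by simp)
  set v := basisVec j with hv
  -- A zero of a nonnegative function is an interior minimum. Hence the term containing the gradient
  -- of the weight also disappears outside `E`.
  have hmin : ∀ x ∈ D, η x = 0 → fderiv ℝ η x v = 0 := by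
    intro x hx h0
    have : IsLocalMin η x := by
      filter_upwards [hD.mem_nhds hx] with y hy
      rw [h0]; exact hη0 y hy
    rw [this.fderiv_eq_zero]; rfl
  set F : Sp d → ℝ := fun x => G (A x) * B x with hF
  set H : Sp d → ℝ := fun x => deriv G (A x) * A' x * B x + G (A x) * B' x with hH
  have hGA : AEStronglyMeasurable (fun x => G (A x)) (volume.restrict E) :=
    hG.continuous.comp_aestronglyMeasurable hA.1
  have hGA' : AEStronglyMeasurable (fun x => deriv G (A x)) (volume.restrict E) :=
    (hG.continuous_deriv (by simp)).comp_aestronglyMeasurable hA.1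
  have lF : MemLp F 2 (volume.restrict E) := memLp_mul_of_bounded hGA (fun x => hC _) hB
  set P0 : Sp d → ℝ := fun x => φ x * η x with hP0
  set P1 : Sp d → ℝ := fun x => fderiv ℝ φ x v * η x with hP1
  set P2 : Sp d → ℝ := fun x => φ x * fderiv ℝ η x v with hP2
  have hdφ : ContDiff ℝ 1 fun x => fderiv ℝ φ x v :=
    ((hφ.of_le (m := 2) (by norm_cast)).fderiv_right (m := 1) (by norm_num)).clm_apply
      contDiff_const
  have hsd : tsupport (fun x => fderiv ℝ φ x v) ⊆ D :=
    (tsupport_fderiv_apply_subset ℝ v).trans hs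
  have cP0 : ContDiff ℝ 1 P0 := contDiff_mul_of_tsupport_subset hD hφ1 hη hs
  have cP1 : Continuous P1 := (contDiff_mul_of_tsupport_subset hD hdφ hη hsd).continuous
  have hfd : ∀ x, fderiv ℝ P0 x v = P1 x + P2 x := fun x =>
    fderiv_mul_of_tsupport_subset hD hφ1 hη hs v x
  -- Differentiability of `η` is known on `D` only, so continuity on the whole space is read off
  -- from the product rule for `P0`.
  have cP2 : Continuous P2 := by
    have : P2 = fun x => fderiv ℝ P0 x v - P1 x := by ext x; rw [hfd]; ring
    rw [this]
    exact ((cP0.continuous_fderiv (by simp)).clm_apply continuous_const).sub cP1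
  have sP0 : HasCompactSupport P0 := hc.mul_right
  have sP1 : HasCompactSupport P1 := (hc.fderiv_apply (𝕜 := ℝ) v).mul_right
  have sP2 : HasCompactSupport P2 := hc.mul_right
  have lP1 : MemLp P1 2 (volume.restrict E) := (cP1.memLp_of_hasCompactSupport sP1).restrict E
  have lP2 : MemLp P2 2 (volume.restrict E) := (cP2.memLp_of_hasCompactSupport sP2).restrict E
  have lP0 : MemLp P0 2 (volume.restrict E) :=
    (cP0.continuous.memLp_of_hasCompactSupport sP0).restrict E
  obtain ⟨M, hM⟩ := cP0.continuous.bounded_above_of_compact_support sP0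
  have iH : Integrable (fun x => P0 x * H x) (volume.restrict E) := by
    have h1 : Integrable (fun x => P0 x * (deriv G (A x) * (A' x * B x))) (volume.restrict E) :=
      integrable_mul_of_bounded cP0.continuous.aestronglyMeasurable hM
        (integrable_mul_of_bounded hGA' (fun x => hC' _) (integrable_mul_of_memLp_two hA' hB))
    have h2 : Integrable (fun x => P0 x * (G (A x) * B' x)) (volume.restrict E) :=
      integrable_mul_of_memLp_two lP0 (memLp_mul_of_bounded hGA (fun x => hC _) hB')
    refine (h1.add h2).congr (Eventually.of_forall fun x => ?_)
    simp only [Pi.add_apply, hH]; ring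
  have iH' : AEStronglyMeasurable H (volume.restrict E) :=
    ((hGA'.mul hA'.1).mul hB.1).add (hGA.mul hB'.1)
  have iF1 : Integrable (fun x => P1 x * F x) (volume.restrict E) :=
    integrable_mul_of_memLp_two lP1 lF
  have iF2 : Integrable (fun x => P2 x * F x) (volume.restrict E) :=
    integrable_mul_of_memLp_two lP2 lF
  -- the truncated weights
  have hηn : ∀ n, ContDiffOn ℝ 1 (fun x => softCut n (η x)) D := fun n =>
    (softCut_contDiff n).comp_contDiffOn hη
  have hdn : ∀ n, ∀ x ∈ D, fderiv ℝ (fun x => softCut n (η x)) x v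
      = ramp n (η x) * fderiv ℝ η x v := by
    intro n x hx
    have h1 := (softCut_hasDerivAt n (η x)).comp_hasFDerivAt x
      ((hη.contDiffAt (hD.mem_nhds hx)).differentiableAt (by simp)).hasFDerivAt
    have : fderiv ℝ (fun x => softCut n (η x)) x = _ := h1.fderiv
    rw [this]; simp
  -- The truncated weight vanishes below the level `1 / (n + 1)`. The closed set where `η` reaches
  -- this level inside the support of `φ` avoids the zeros of `η`, hence lies in `E`, and the
  -- truncated product may be tested on `E`.
  have hψs : ∀ n, tsupport (fun x => φ x * softCut n (η x)) ⊆ E := by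
    intro n
    set K : Set (Sp d) := tsupport φ ∩ η ⁻¹' (Ici (1 / (n + 1) : ℝ)) with hK
    have hKc : IsClosed K := (hη.continuousOn.mono hs).preimage_isClosed_of_isClosed
      (isClosed_tsupport φ) isClosed_Ici
    refine (closure_minimal ?_ hKc).trans ?_
    · intro x hx
      refine ⟨subset_tsupport _ (left_ne_zero_of_mul hx), ?_⟩
      by_contra h
      exact right_ne_zero_of_mul hx (softCut_eq_zero (not_le.1 h))
    · rintro x ⟨hx, hx'⟩
      by_contra h
      have h0 := hηE x (hs hx) h
      rw [mem_preimage, h0, mem_Ici] at hx'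
      have : (0 : ℝ) < 1 / (n + 1) := by positivity
      linarith
  have heq : ∀ n, ∫ x in E, (fderiv ℝ φ x v * softCut n (η x)
        + φ x * (ramp n (η x) * fderiv ℝ η x v)) * F x
      = -∫ x in E, (φ x * softCut n (η x)) * H x := by
    intro n
    rw [← integral_weak_chain_rule hE hA hA' hB hB' wA wB hG hC hC'
      (contDiff_mul_of_tsupport_subset hD hφ1 (hηn n) hs) hc.mul_right (hψs n)]
    refine setIntegral_congr_fun hE.measurableSet fun x hx => ?_
    rw [fderiv_mul_of_tsupport_subset hD hφ1 (hηn n) hs, hdn n x (hED hx)]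
  have hmE : ∀ᵐ x ∂(volume.restrict E), x ∈ E := ae_restrict_mem hE.measurableSet
  have ηm : AEStronglyMeasurable η (volume.restrict E) :=
    (hη.continuousOn.mono hED).aestronglyMeasurable hE.measurableSet
  have hη'm : AEStronglyMeasurable (fun x => fderiv ℝ η x v) (volume.restrict E) :=
    (((hη.continuousOn_fderiv_of_isOpen hD (by simp)).clm_apply
      continuousOn_const).mono hED).aestronglyMeasurable hE.measurableSet
  have hφm : AEStronglyMeasurable φ (volume.restrict E) := hφ.continuous.aestronglyMeasurable
  have hSm : ∀ n, AEStronglyMeasurable (fun x => softCut n (η x)) (volume.restrict E) := fun n =>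
    (softCut_contDiff n).continuous.comp_aestronglyMeasurable ηm
  have hRm : ∀ n, AEStronglyMeasurable (fun x => ramp n (η x)) (volume.restrict E) := fun n =>
    (ramp_continuous n).comp_aestronglyMeasurable ηm
  have hramp : ∀ n t, |ramp n t| ≤ 1 := fun n t => by
    rw [abs_of_nonneg (ramp_nonneg n t)]; exact ramp_le_one n t
  have lim1 : Tendsto (fun n => ∫ x in E, (fderiv ℝ φ x v * softCut n (η x)
        + φ x * (ramp n (η x) * fderiv ℝ η x v)) * F x) atTop
      (𝓝 (∫ x in E, (P1 x + P2 x) * F x)) := by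
    refine tendsto_integral_of_dominated_convergence (fun x => |P1 x * F x| + |P2 x * F x|)
      (fun n => ?_) (iF1.abs.add iF2.abs) (fun n => Eventually.of_forall fun x => ?_) ?_
    · exact ((hdφ.continuous.aestronglyMeasurable.mul (hSm n)).add
        (hφm.mul ((hRm n).mul hη'm))).mul lF.1
    · rw [Real.norm_eq_abs, add_mul]
      refine (abs_add_le _ _).trans (add_le_add ?_ ?_)
      · simp only [hP1, abs_mul]
        exact mul_le_mul_of_nonneg_right (mul_le_mul_of_nonneg_left (abs_softCut_le n _)
          (abs_nonneg _)) (abs_nonneg _)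
      · simp only [hP2, abs_mul]
        gcongr
        exact mul_le_of_le_one_left (abs_nonneg _) (hramp n _)
    · filter_upwards [hmE] with x hx
      have hxD := hED hx
      refine Tendsto.mul_const _ (Tendsto.add ?_ ?_)
      · exact (softCut_tendsto (hη0 x hxD)).const_mul _
      -- Where the weight is zero the ramp does not tend to one, but there the gradient of the
      -- weight is zero as well.
      · rcases (hη0 x hxD).eq_or_lt with h | h
        · simp [hP2, hmin x hxD h.symm]
        · have := (((ramp_tendsto h).mul_const (fderiv ℝ η x v)).const_mul (φ x))
          simpa [hP2] using this
  have lim2 : Tendsto (fun n => ∫ x in E, (φ x * softCut n (η x)) * H x) atTop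
      (𝓝 (∫ x in E, P0 x * H x)) := by
    refine tendsto_integral_of_dominated_convergence (fun x => |P0 x * H x|)
      (fun n => ?_) iH.abs (fun n => Eventually.of_forall fun x => ?_) ?_
    · exact (hφm.mul (hSm n)).mul iH'
    · rw [Real.norm_eq_abs]
      simp only [hP0, abs_mul]
      exact mul_le_mul_of_nonneg_right (mul_le_mul_of_nonneg_left (abs_softCut_le n _)
        (abs_nonneg _)) (abs_nonneg _)
    · filter_upwards [hmE] with x hx
      exact ((softCut_tendsto (hη0 x (hED hx))).const_mul _).mul_const _
  have hfin := tendsto_nhds_unique (lim1.congr heq) lim2.neg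
  have hfin' : ∫ x in E, P1 x * F x = -∫ x in E, (P2 x * F x + P0 x * H x) := by
    rw [integral_add iF2 iH]
    have : ∫ x in E, (P1 x + P2 x) * F x = (∫ x in E, P1 x * F x) + ∫ x in E, P2 x * F x := by
      rw [← integral_add iF1 iF2]; congr 1; ext x; ring
    linarith
  have e1 : ∫ x in D, fderiv ℝ φ x v * (η x * (G (A x) * B x)) = ∫ x in E, P1 x * F x := by
    rw [setIntegral_eq_of_subset_of_forall_sdiff_eq_zero hD.measurableSet hED]
    · refine setIntegral_congr_fun hE.measurableSet fun x hx => ?_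
      simp only [hP1, hF]; ring
    · rintro x ⟨hx, hxE⟩
      rw [hηE x hx hxE]; ring
  have e2 : ∫ x in D, φ x * (fderiv ℝ η x v * (G (A x) * B x)
      + η x * (deriv G (A x) * A' x * B x + G (A x) * B' x))
      = ∫ x in E, (P2 x * F x + P0 x * H x) := by
    rw [setIntegral_eq_of_subset_of_forall_sdiff_eq_zero hD.measurableSet hED]
    · refine setIntegral_congr_fun hE.measurableSet fun x hx => ?_
      simp only [hP2, hF, hP0, hH]; ring
    · rintro x ⟨hx, hxE⟩
      rw [hηE x hx hxE, hmin x hx (hηE x hx hxE)]; ring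
  rw [e1, e2, hfin']

end
end Peridynamics

namespace Peridynamics
noncomputable section

variable {d : ℕ} {D : Set (Sp d)}

/-! ### Calculus of weak derivatives of vector fields -/

theorem MemL2.integrable_smul {u : Sp d → Sp d} (hu : MemL2 D u) {φ : Sp d → ℝ}
    (hφ : Continuous φ) (hc : HasCompactSupport φ) :
    Integrable (fun x => φ x • u x) (volume.restrict D) := by
  have h : MemLp φ 2 (volume.restrict D) := (hφ.memLp_of_hasCompactSupport hc).restrict D
  exact memLp_one_iff_integrable.1 (MemLp.smul (p := 2) (q := 2) (r := 1) hu h)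

theorem continuous_fderiv_apply {φ : Sp d → ℝ} (hφ : ContDiff ℝ ∞ φ) (v : Sp d) :
    Continuous fun x => fderiv ℝ φ x v :=
  (hφ.continuous_fderiv (by simp)).clm_apply continuous_const

theorem MemL2.integrable_fderiv_smul {u : Sp d → Sp d} (hu : MemL2 D u) {φ : Sp d → ℝ}
    (hφ : ContDiff ℝ ∞ φ) (hc : HasCompactSupport φ) (v : Sp d) :
    Integrable (fun x => fderiv ℝ φ x v • u x) (volume.restrict D) :=
  hu.integrable_smul (continuous_fderiv_apply hφ v) (hc.fderiv_apply (𝕜 := ℝ) v)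

theorem IsWeakPartial.congr {i : Fin d} {u u' g g' : Sp d → Sp d} (h : IsWeakPartial D i u g)
    (hu : u =ᵐ[volume.restrict D] u') (hg : g =ᵐ[volume.restrict D] g') :
    IsWeakPartial D i u' g' := by
  intro φ h1 h2 h3
  have e1 : ∫ x in D, fderiv ℝ φ x (basisVec i) • u' x
      = ∫ x in D, fderiv ℝ φ x (basisVec i) • u x :=
    integral_congr_ae (by filter_upwards [hu] with x hx; rw [hx])
  have e2 : ∫ x in D, φ x • g' x = ∫ x in D, φ x • g x :=
    integral_congr_ae (by filter_upwards [hg] with x hx; rw [hx])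
  rw [e1, e2, h φ h1 h2 h3]

theorem IsWeakPartial.sub {i : Fin d} {u u' g g' : Sp d → Sp d} (hu : MemL2 D u)
    (hu' : MemL2 D u') (hg : MemL2 D g) (hg' : MemL2 D g') (h : IsWeakPartial D i u g)
    (h' : IsWeakPartial D i u' g') : IsWeakPartial D i (u - u') (g - g') := by
  intro φ h1 h2 h3
  simp only [Pi.sub_apply, smul_sub]
  rw [integral_sub (hu.integrable_fderiv_smul h1 h2 _) (hu'.integrable_fderiv_smul h1 h2 _),
    integral_sub (hg.integrable_smul h1.continuous h2) (hg'.integrable_smul h1.continuous h2),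
    h φ h1 h2 h3, h' φ h1 h2 h3]
  abel

theorem IsWeakPartial.const_smul {i : Fin d} {u g : Sp d → Sp d} (h : IsWeakPartial D i u g)
    (c : ℝ) : IsWeakPartial D i (c • u) (c • g) := by
  intro φ h1 h2 h3
  simp only [Pi.smul_apply, smul_comm _ c]
  rw [integral_smul, integral_smul, h φ h1 h2 h3, smul_neg]

/-- The fundamental lemma of the calculus of variations. It makes the choice behind `weakPartial`
harmless: any explicit weak derivative in L² may replace it almost everywhere. -/
theorem IsWeakPartial.ae_eq (hD : IsOpen D) {i : Fin d} {u g g' : Sp d → Sp d} (hg : MemL2 D g)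
    (hg' : MemL2 D g') (h : IsWeakPartial D i u g) (h' : IsWeakPartial D i u g') :
    g =ᵐ[volume.restrict D] g' := by
  have hsub : MemL2 D (g - g') := MemLp.sub hg hg'
  have hloc : LocallyIntegrableOn (g - g') D volume :=
    (locallyIntegrableOn_of_locallyIntegrable_restrict
      (MemLp.locallyIntegrable hsub (by norm_num)))
  have := hD.ae_eq_zero_of_integral_contDiff_smul_eq_zero hloc fun φ h1 h2 h3 => by
    rw [← setIntegral_eq_integral_of_forall_compl_eq_zero (s := D)]
    · simp only [Pi.sub_apply, smul_sub]
      rw [integral_sub (hg.integrable_smul h1.continuous h2) (hg'.integrable_smul h1.continuous h2),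
        sub_eq_zero]
      have e1 := h φ h1 h2 h3
      have e2 := h' φ h1 h2 h3
      rw [e1] at e2
      exact neg_injective e2
    · intro x hx
      rw [image_eq_zero_of_notMem_tsupport fun h => hx (h3 h), zero_smul]
  rw [EventuallyEq, ae_restrict_iff' hD.measurableSet]
  filter_upwards [this] with x hx hxD
  exact sub_eq_zero.1 (hx hxD)

theorem MemH1.weakPartial_spec {u : Sp d → Sp d} (hu : MemH1 D u) (i : Fin d) :
    MemL2 D (weakPartial D i u) ∧ IsWeakPartial D i u (weakPartial D i u) := by
  have h := hu.2 i
  rw [weakPartial, dif_pos h]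
  exact h.choose_spec

theorem weakPartial_ae_eq (hD : IsOpen D) {i : Fin d} {u g : Sp d → Sp d} (hg : MemL2 D g)
    (h : IsWeakPartial D i u g) : weakPartial D i u =ᵐ[volume.restrict D] g := by
  have hex : ∃ g : Sp d → Sp d, MemL2 D g ∧ IsWeakPartial D i u g := ⟨g, hg, h⟩
  rw [weakPartial, dif_pos hex]
  exact IsWeakPartial.ae_eq hD hex.choose_spec.1 hg hex.choose_spec.2 h

theorem MemH1.congr {u u' : Sp d → Sp d} (hu : MemH1 D u) (h : u =ᵐ[volume.restrict D] u') :
    MemH1 D u' :=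
  ⟨(memLp_congr_ae h).1 hu.1, fun i => by
    obtain ⟨g, hg, hw⟩ := hu.2 i
    exact ⟨g, hg, hw.congr h EventuallyEq.rfl⟩⟩

theorem weakPartial_congr (hD : IsOpen D) {i : Fin d} {u u' : Sp d → Sp d} (hu : MemH1 D u)
    (h : u =ᵐ[volume.restrict D] u') :
    weakPartial D i u =ᵐ[volume.restrict D] weakPartial D i u' :=
  (weakPartial_ae_eq hD (hu.weakPartial_spec i).1
    ((hu.weakPartial_spec i).2.congr h EventuallyEq.rfl)).symm

theorem MemH1.sub {u v : Sp d → Sp d} (hu : MemH1 D u) (hv : MemH1 D v) : MemH1 D (u - v) :=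
  ⟨MemLp.sub hu.1 hv.1, fun i => by
    obtain ⟨g, hg, hw⟩ := hu.2 i
    obtain ⟨g', hg', hw'⟩ := hv.2 i
    exact ⟨g - g', MemLp.sub hg hg', hw.sub hu.1 hv.1 hg hg' hw'⟩⟩

theorem MemH1.const_smul {u : Sp d → Sp d} (hu : MemH1 D u) (c : ℝ) : MemH1 D (c • u) :=
  ⟨MemLp.const_smul hu.1 c, fun i => by
    obtain ⟨g, hg, hw⟩ := hu.2 i
    exact ⟨c • g, MemLp.const_smul hg c, hw.const_smul c⟩⟩

theorem weakPartial_sub (hD : IsOpen D) {u v : Sp d → Sp d} (hu : MemH1 D u) (hv : MemH1 D v)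
    (i : Fin d) :
    weakPartial D i (u - v) =ᵐ[volume.restrict D] weakPartial D i u - weakPartial D i v := by
  have h1 := hu.weakPartial_spec i
  have h2 := hv.weakPartial_spec i
  exact weakPartial_ae_eq hD (MemLp.sub h1.1 h2.1) (h1.2.sub hu.1 hv.1 h1.1 h2.1 h2.2)

theorem weakPartial_const_smul (hD : IsOpen D) {u : Sp d → Sp d} (hu : MemH1 D u) (c : ℝ)
    (i : Fin d) :
    weakPartial D i (c • u) =ᵐ[volume.restrict D] c • weakPartial D i u := by
  have h1 := hu.weakPartial_spec i
  exact weakPartial_ae_eq hD (MemLp.const_smul h1.1 c) (h1.2.const_smul c)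

theorem MemH2.sub (hD : IsOpen D) {u v : Sp d → Sp d} (hu : MemH2 D u) (hv : MemH2 D v) :
    MemH2 D (u - v) :=
  ⟨hu.1.sub hv.1, fun i =>
    ((hu.2 i).sub (hv.2 i)).congr (weakPartial_sub hD hu.1 hv.1 i).symm⟩

theorem MemH2.const_smul (hD : IsOpen D) {u : Sp d → Sp d} (hu : MemH2 D u) (c : ℝ) :
    MemH2 D (c • u) :=
  ⟨hu.1.const_smul c, fun i =>
    ((hu.2 i).const_smul c).congr (weakPartial_const_smul hD hu.1 c i).symm⟩

theorem weakPartial_weakPartial_sub (hD : IsOpen D) {u v : Sp d → Sp d} (hu : MemH2 D u)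
    (hv : MemH2 D v) (i j : Fin d) :
    weakPartial D j (weakPartial D i (u - v)) =ᵐ[volume.restrict D]
      weakPartial D j (weakPartial D i u) - weakPartial D j (weakPartial D i v) :=
  (weakPartial_congr hD ((hu.sub hD hv).2 i) (weakPartial_sub hD hu.1 hv.1 i)).trans
    (weakPartial_sub hD (hu.2 i) (hv.2 i) j)

theorem weakPartial_weakPartial_const_smul (hD : IsOpen D) {u : Sp d → Sp d} (hu : MemH2 D u)
    (c : ℝ) (i j : Fin d) :
    weakPartial D j (weakPartial D i (c • u)) =ᵐ[volume.restrict D]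
      c • weakPartial D j (weakPartial D i u) :=
  (weakPartial_congr hD ((hu.const_smul hD c).2 i) (weakPartial_const_smul hD hu.1 c i)).trans
    (weakPartial_const_smul hD (hu.2 i) c j)

theorem normL2_nonneg (D : Set (Sp d)) (u : Sp d → Sp d) : 0 ≤ normL2 D u := ENNReal.toReal_nonneg

theorem normL2_congr {u u' : Sp d → Sp d} (h : u =ᵐ[volume.restrict D] u') :
    normL2 D u = normL2 D u' := by
  rw [normL2, normL2, eLpNorm_congr_ae h]

theorem normL2_const_smul (u : Sp d → Sp d) (c : ℝ) : normL2 D (c • u) = |c| * normL2 D u := by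
  rw [normL2, eLpNorm_const_smul, ENNReal.toReal_mul]; simp [normL2]

theorem normL2_sub_le {u v : Sp d → Sp d} (hu : MemL2 D u) (hv : MemL2 D v) :
    normL2 D (u - v) ≤ normL2 D u + normL2 D v := by
  rw [normL2, normL2, normL2, ← ENNReal.toReal_add hu.eLpNorm_ne_top hv.eLpNorm_ne_top]
  exact ENNReal.toReal_mono (ENNReal.add_ne_top.2 ⟨hu.eLpNorm_ne_top, hv.eLpNorm_ne_top⟩)
    (eLpNorm_sub_le hu.1 hv.1 (by norm_num))

theorem normH2_const_smul (hD : IsOpen D) {u : Sp d → Sp d} (hu : MemH2 D u) (c : ℝ) :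
    normH2 D (c • u) = |c| * normH2 D u := by
  have e1 : ∀ i, normL2 D (weakPartial D i (c • u)) = |c| * normL2 D (weakPartial D i u) :=
    fun i => by rw [normL2_congr (weakPartial_const_smul hD hu.1 c i), normL2_const_smul]
  have e2 : ∀ i j, normL2 D (weakPartial D j (weakPartial D i (c • u)))
      = |c| * normL2 D (weakPartial D j (weakPartial D i u)) := fun i j => by
    rw [normL2_congr (weakPartial_weakPartial_const_smul hD hu c i j), normL2_const_smul]
  simp only [normH2, e1, e2, normL2_const_smul, mul_pow, ← Finset.mul_sum, ← mul_add]
  rw [Real.sqrt_mul (by positivity), Real.sqrt_sq (abs_nonneg c)]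

theorem normL2_le_normH1 (D : Set (Sp d)) (u : Sp d → Sp d) : normL2 D u ≤ normH1 D u := by
  refine Real.le_sqrt_of_sq_le ?_
  have : 0 ≤ ∑ i, normL2 D (weakPartial D i u) ^ 2 := Finset.sum_nonneg fun i _ => sq_nonneg _
  linarith

theorem normL2_weakPartial_le_normH1 (D : Set (Sp d)) (u : Sp d → Sp d) (i : Fin d) :
    normL2 D (weakPartial D i u) ≤ normH1 D u := by
  refine Real.le_sqrt_of_sq_le ?_
  have := Finset.single_le_sum (f := fun i => normL2 D (weakPartial D i u) ^ 2)
    (fun i _ => sq_nonneg _) (Finset.mem_univ i)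
  have h2 := sq_nonneg (normL2 D u)
  linarith

/-- A crude substitute for the norm axioms of `normH1`. The lost factor is irrelevant because
approximations in H¹₀ are arbitrarily good. -/
theorem normH1_le_sum (D : Set (Sp d)) (u : Sp d → Sp d) {b : ℝ} (hb : 0 ≤ b)
    (h0 : normL2 D u ≤ b) (h1 : ∀ i, normL2 D (weakPartial D i u) ≤ b) :
    normH1 D u ≤ (d + 1) * b := by
  refine Real.sqrt_le_iff.2 ⟨by positivity, ?_⟩
  have h : ∑ i, normL2 D (weakPartial D i u) ^ 2 ≤ ∑ _i : Fin d, b ^ 2 :=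
    Finset.sum_le_sum fun i _ => pow_le_pow_left₀ (normL2_nonneg _ _) (h1 i) 2
  have h' := pow_le_pow_left₀ (normL2_nonneg _ _) h0 2
  rw [Finset.sum_const, Finset.card_univ, Fintype.card_fin, nsmul_eq_mul] at h
  have : (0 : ℝ) ≤ d * b ^ 2 := by positivity
  nlinarith [mul_nonneg (Nat.cast_nonneg (α := ℝ) d) this]

theorem normH2_nonneg (D : Set (Sp d)) (u : Sp d → Sp d) : 0 ≤ normH2 D u := Real.sqrt_nonneg _

theorem isWeakPartial_of_contDiff {w : Sp d → Sp d} (hw : ContDiff ℝ ∞ w)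
    (i : Fin d) : IsWeakPartial D i w (fun x => fderiv ℝ w x (basisVec i)) := by
  intro φ h1 h2 h3
  have hz : ∀ x, x ∉ D → φ x = 0 := fun x hx =>
    image_eq_zero_of_notMem_tsupport fun h => hx (h3 h)
  have hz' : ∀ x, x ∉ D → fderiv ℝ φ x (basisVec i) = 0 := fun x hx =>
    fderiv_apply_eq_zero_of_notMem_tsupport (fun h => hx (h3 h)) _
  rw [setIntegral_eq_integral_of_forall_compl_eq_zero fun x hx => by rw [hz' x hx, zero_smul],
    setIntegral_eq_integral_of_forall_compl_eq_zero fun x hx => by rw [hz x hx, zero_smul]]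
  have c1 := continuous_fderiv_apply h1 (basisVec i)
  have c2 : Continuous fun x => fderiv ℝ w x (basisVec i) :=
    (hw.continuous_fderiv (by simp)).clm_apply continuous_const
  have s1 := h2.fderiv_apply (𝕜 := ℝ) (basisVec i)
  rw [integral_smul_fderiv_eq_neg_fderiv_smul_of_integrable (μ := volume)
    ((c1.smul hw.continuous).integrable_of_hasCompactSupport s1.smul_right)
    ((h1.continuous.smul c2).integrable_of_hasCompactSupport h2.smul_right)
    ((h1.continuous.smul hw.continuous).integrable_of_hasCompactSupport h2.smul_right)
    (fun x _ => h1.differentiable (by simp) x) (fun x _ => hw.differentiable (by simp) x), neg_neg]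

theorem memH1_of_contDiff {w : Sp d → Sp d} (hw : ContDiff ℝ ∞ w)
    (hc : HasCompactSupport w) : MemH1 D w :=
  ⟨(hw.continuous.memLp_of_hasCompactSupport hc).restrict D, fun i => ⟨_,
    (((hw.continuous_fderiv (by simp)).clm_apply continuous_const).memLp_of_hasCompactSupport
      (hc.fderiv_apply (𝕜 := ℝ) (basisVec i))).restrict D, isWeakPartial_of_contDiff hw i⟩⟩

theorem MemH1Zero.sub (hD : IsOpen D) {u v : Sp d → Sp d} (hu : MemH1Zero D u)
    (hv : MemH1Zero D v) : MemH1Zero D (u - v) := by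
  refine ⟨hu.1.sub hv.1, fun δ hδ => ?_⟩
  -- The factor `d + 1` pays for `normH1_le_sum` and the factor `2` for the two approximations.
  set δ' := δ / (2 * (d + 1)) with hδ'
  have hd : (0 : ℝ) < 2 * (d + 1) := by positivity
  obtain ⟨φ, a1, a2, a3, a4⟩ := hu.2 δ' (by positivity)
  obtain ⟨ψ, b1, b2, b3, b4⟩ := hv.2 δ' (by positivity)
  have mu := hu.1.sub (memH1_of_contDiff a1 a2)
  have mv := hv.1.sub (memH1_of_contDiff b1 b2)
  refine ⟨φ - ψ, a1.sub b1, a2.sub b2, (tsupport_sub φ ψ).trans (union_subset a3 b3), ?_⟩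
  have e : u - v - (φ - ψ) = (u - φ) - (v - ψ) := by abel
  have hs : 0 ≤ normH1 D (u - φ) + normH1 D (v - ψ) :=
    add_nonneg (Real.sqrt_nonneg _) (Real.sqrt_nonneg _)
  rw [e]
  refine lt_of_le_of_lt (normH1_le_sum D _ hs ?_ fun i => ?_) ?_
  · exact (normL2_sub_le mu.1 mv.1).trans
      (add_le_add (normL2_le_normH1 _ _) (normL2_le_normH1 _ _))
  · rw [normL2_congr (weakPartial_sub hD mu mv i)]
    exact (normL2_sub_le (mu.weakPartial_spec i).1 (mv.weakPartial_spec i).1).trans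
      (add_le_add (normL2_weakPartial_le_normH1 _ _ _) (normL2_weakPartial_le_normH1 _ _ _))
  · have : δ = (d + 1) * (δ' + δ') := by rw [hδ']; field_simp; ring
    rw [this]
    have hd' : (0 : ℝ) < d + 1 := by positivity
    exact mul_lt_mul_of_pos_left (add_lt_add a4 b4) hd'

theorem MemH1Zero.const_smul (hD : IsOpen D) {u : Sp d → Sp d} (hu : MemH1Zero D u) (c : ℝ) :
    MemH1Zero D (c • u) := by
  refine ⟨hu.1.const_smul c, fun δ hδ => ?_⟩
  set δ' := δ / ((d + 1) * (|c| + 1)) with hδ'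
  have hd : (0 : ℝ) < (d + 1) * (|c| + 1) := by positivity
  obtain ⟨φ, a1, a2, a3, a4⟩ := hu.2 δ' (by positivity)
  have mu := hu.1.sub (memH1_of_contDiff a1 a2)
  refine ⟨c • φ, a1.const_smul c, a2.smul_left, (tsupport_smul_subset_right (fun _ => c) φ).trans a3, ?_⟩
  have hs : 0 ≤ |c| * normH1 D (u - φ) := mul_nonneg (abs_nonneg _) (Real.sqrt_nonneg _)
  rw [← smul_sub]
  refine lt_of_le_of_lt (normH1_le_sum D _ hs ?_ fun i => ?_) ?_
  · rw [normL2_const_smul]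
    exact mul_le_mul_of_nonneg_left (normL2_le_normH1 _ _) (abs_nonneg _)
  · rw [normL2_congr (weakPartial_const_smul hD mu c i), normL2_const_smul]
    exact mul_le_mul_of_nonneg_left (normL2_weakPartial_le_normH1 _ _ _) (abs_nonneg _)
  · have : δ = (d + 1) * ((|c| + 1) * δ') := by rw [hδ']; field_simp
    rw [this]
    have hd' : (0 : ℝ) < d + 1 := by positivity
    refine mul_lt_mul_of_pos_left ?_ hd'
    have h0 : 0 ≤ normH1 D (u - φ) := Real.sqrt_nonneg _
    nlinarith [abs_nonneg c]

theorem MemW.sub (hD : IsOpen D) {u v : Sp d → Sp d} (hu : MemW D u) (hv : MemW D v) :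
    MemW D (u - v) := ⟨hu.1.sub hD hv.1, hu.2.sub hD hv.2⟩

theorem MemW.const_smul (hD : IsOpen D) {u : Sp d → Sp d} (hu : MemW D u) (c : ℝ) :
    MemW D (c • u) := ⟨hu.1.const_smul hD c, hu.2.const_smul hD c⟩

/-! ### Scalar components -/

theorem abs_inner_le_norm_of_le_one {e : Sp d} (he : ‖e‖ ≤ 1) (x : Sp d) :
    |inner ℝ e x| ≤ ‖x‖ :=
  (abs_real_inner_le_norm e x).trans (mul_le_of_le_one_left (norm_nonneg x) he)

theorem MemL2.inner_const {u : Sp d → Sp d} (hu : MemL2 D u) (e : Sp d) :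
    MemLp (fun x => inner ℝ e (u x)) 2 (volume.restrict D) :=
  MemLp.const_inner e hu

theorem IsWeakPartial.inner_const {i : Fin d} {u g : Sp d → Sp d} (hu : MemL2 D u)
    (hg : MemL2 D g) (h : IsWeakPartial D i u g) (e : Sp d) :
    IsWeakPartialScalar D i (fun x => inner ℝ e (u x)) (fun x => inner ℝ e (g x)) := by
  intro φ h1 h2 h3
  have := congrArg (inner ℝ e) (h φ h1 h2 h3)
  rw [inner_neg_right, ← integral_inner (hu.integrable_fderiv_smul h1 h2 _),
    ← integral_inner (hg.integrable_smul h1.continuous h2)] at this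
  simpa only [inner_smul_right] using this

theorem eLpNorm_inner_const_le {u : Sp d → Sp d} {e : Sp d} (he : ‖e‖ ≤ 1) (p : ENNReal)
    (μ : Measure (Sp d)) : eLpNorm (fun x => inner ℝ e (u x)) p μ ≤ eLpNorm u p μ :=
  eLpNorm_mono fun x => by
    rw [Real.norm_eq_abs]; exact abs_inner_le_norm_of_le_one he _

/-- The defining property of `H¹₀`: integration by parts against arbitrary `H¹` functions has no
boundary term. -/
theorem MemH1Zero.integral_inner_weakPartial_mul (hD : IsOpen D) {u : Sp d → Sp d}
    (hu : MemH1Zero D u) (i : Fin d) {e : Sp d} (he : ‖e‖ ≤ 1) {X Y : Sp d → ℝ}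
    (hX : MemLp X 2 (volume.restrict D)) (hY : MemLp Y 2 (volume.restrict D))
    (hXY : IsWeakPartialScalar D i X Y) :
    ∫ x in D, inner ℝ e (weakPartial D i u x) * X x = -∫ x in D, inner ℝ e (u x) * Y x := by
  set NX := (eLpNorm X 2 (volume.restrict D)).toReal with hNX
  set NY := (eLpNorm Y 2 (volume.restrict D)).toReal with hNY
  have hNX0 : 0 ≤ NX := ENNReal.toReal_nonneg
  have hNY0 : 0 ≤ NY := ENNReal.toReal_nonneg
  have us := hu.1.weakPartial_spec i
  -- For a smooth approximation `φ` with compact support in `D` the identity is the definition of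
  -- the weak derivative `Y`, tested with the component of `φ` along `e`. Replacing `u` by `φ` costs
  -- at most `δ` times the two norms, by Cauchy–Schwarz.
  have key : ∀ δ : ℝ, 0 < δ → |(∫ x in D, inner ℝ e (weakPartial D i u x) * X x)
      + ∫ x in D, inner ℝ e (u x) * Y x| ≤ δ * (NX + NY) := by
    intro δ hδ
    obtain ⟨φ, a1, a2, a3, a4⟩ := hu.2 δ hδ
    have mφ : MemH1 D φ := memH1_of_contDiff a1 a2
    have mφ' := mφ.weakPartial_spec i
    set g : Sp d → Sp d := fun x => fderiv ℝ φ x (basisVec i) with hg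
    have lg : MemL2 D g :=
      (((a1.continuous_fderiv (by simp)).clm_apply continuous_const).memLp_of_hasCompactSupport
        (a2.fderiv_apply (𝕜 := ℝ) (basisVec i))).restrict D
    have wg : IsWeakPartial D i φ g := isWeakPartial_of_contDiff a1 i
    have hψ : ContDiff ℝ ∞ fun x => inner ℝ e (φ x) := contDiff_const.inner ℝ a1
    have hψc : HasCompactSupport fun x => inner ℝ e (φ x) :=
      a2.comp_left (g := fun y => inner ℝ e y) (inner_zero_right e)
    have hψs : tsupport (fun x => inner ℝ e (φ x)) ⊆ D :=
      (tsupport_comp_subset (g := fun y => inner ℝ e y) (inner_zero_right e) φ).trans a3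
    have hw := hXY _ hψ hψc hψs
    have hfd : ∀ x, fderiv ℝ (fun x => inner ℝ e (φ x)) x (basisVec i) = inner ℝ e (g x) := by
      intro x
      have := ((innerSL ℝ e).hasFDerivAt.comp x (a1.differentiable (by simp) x).hasFDerivAt).fderiv
      have h' : fderiv ℝ (fun x => inner ℝ e (φ x)) x = _ := this
      rw [h']; simp [hg]
    simp only [hfd] at hw
    have m1 : MemL2 D (weakPartial D i u - g) := MemLp.sub us.1 lg
    have m2 : MemL2 D (u - φ) := MemLp.sub hu.1.1 mφ.1
    have b1 := abs_integral_mul_le_eLpNorm (m1.inner_const e) hX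
    have b2 := abs_integral_mul_le_eLpNorm (m2.inner_const e) hY
    have n1 : (eLpNorm (fun x => inner ℝ e ((weakPartial D i u - g) x)) 2
        (volume.restrict D)).toReal ≤ δ := by
      refine (ENNReal.toReal_mono m1.eLpNorm_ne_top (eLpNorm_inner_const_le he 2 _)).trans ?_
      have : normL2 D (weakPartial D i u - g) = normL2 D (weakPartial D i (u - φ)) :=
        normL2_congr (weakPartial_ae_eq hD m1 (us.2.sub hu.1.1 mφ.1 us.1 lg wg)).symm
      exact this.le.trans ((normL2_weakPartial_le_normH1 D _ i).trans a4.le)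
    have n2 : (eLpNorm (fun x => inner ℝ e ((u - φ) x)) 2 (volume.restrict D)).toReal ≤ δ := by
      refine (ENNReal.toReal_mono m2.eLpNorm_ne_top (eLpNorm_inner_const_le he 2 _)).trans ?_
      exact (normL2_le_normH1 D _).trans a4.le
    have i1 := integrable_mul_of_memLp_two (us.1.inner_const e) hX
    have i2 := integrable_mul_of_memLp_two (lg.inner_const e) hX
    have i3 := integrable_mul_of_memLp_two (hu.1.1.inner_const e) hY
    have i4 := integrable_mul_of_memLp_two (mφ.1.inner_const e) hY
    have s1 : ∫ x in D, inner ℝ e ((weakPartial D i u - g) x) * X x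
        = (∫ x in D, inner ℝ e (weakPartial D i u x) * X x) - ∫ x in D, inner ℝ e (g x) * X x := by
      rw [← integral_sub i1 i2]; congr 1; ext x; rw [Pi.sub_apply, inner_sub_right]; ring
    have s2 : ∫ x in D, inner ℝ e ((u - φ) x) * Y x
        = (∫ x in D, inner ℝ e (u x) * Y x) - ∫ x in D, inner ℝ e (φ x) * Y x := by
      rw [← integral_sub i3 i4]; congr 1; ext x; rw [Pi.sub_apply, inner_sub_right]; ring
    have : (∫ x in D, inner ℝ e (weakPartial D i u x) * X x) + ∫ x in D, inner ℝ e (u x) * Y x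
        = (∫ x in D, inner ℝ e ((weakPartial D i u - g) x) * X x)
          + ∫ x in D, inner ℝ e ((u - φ) x) * Y x := by rw [s1, s2, hw]; ring
    rw [this]
    calc _ ≤ |∫ x in D, inner ℝ e ((weakPartial D i u - g) x) * X x|
          + |∫ x in D, inner ℝ e ((u - φ) x) * Y x| := abs_add_le _ _
      _ ≤ δ * NX + δ * NY := by
          refine add_le_add ?_ ?_
          · exact (abs_integral_le_integral_abs.trans b1).trans
              (mul_le_mul_of_nonneg_right n1 hNX0)
          · exact (abs_integral_le_integral_abs.trans b2).trans
              (mul_le_mul_of_nonneg_right n2 hNY0)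
      _ = δ * (NX + NY) := by ring
  rw [eq_neg_iff_add_eq_zero, ← abs_eq_zero]
  refine le_antisymm (le_of_forall_pos_le_add fun δ hδ => ?_) (abs_nonneg _)
  refine (key (δ / (NX + NY + 1)) (by positivity)).trans ?_
  rw [zero_add, div_mul_eq_mul_div, div_le_iff₀ (by positivity)]
  nlinarith

end
end Peridynamics

namespace Peridynamics
noncomputable section

variable {d : ℕ} {D : Set (Sp d)}

/-! ### A Gagliardo–Nirenberg estimate without boundary regularity -/

/-- A bounded truncation of `p ↦ p ^ 2`. -/
def truncSq (n : ℕ) (p : ℝ) : ℝ := p ^ 2 / (1 + p ^ 2 / (n + 1))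

/-- A bounded truncation of `p ↦ (1 + p ^ 2) ^ κ`. -/
def truncPow (κ : ℝ) (n : ℕ) (p : ℝ) : ℝ := (1 + truncSq n p) ^ κ

theorem truncSq_nonneg (n : ℕ) (p : ℝ) : 0 ≤ truncSq n p := by unfold truncSq; positivity

theorem truncSq_le (n : ℕ) (p : ℝ) : truncSq n p ≤ p ^ 2 := by
  unfold truncSq
  refine div_le_self (sq_nonneg p) ?_
  have : 0 ≤ p ^ 2 / ((n : ℝ) + 1) := by positivity
  linarith

theorem truncSq_le_const (n : ℕ) (p : ℝ) : truncSq n p ≤ n + 1 := by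
  unfold truncSq
  have hn : (0 : ℝ) < n + 1 := by positivity
  rw [div_le_iff₀ (by positivity)]
  have : ((n : ℝ) + 1) * (1 + p ^ 2 / (n + 1)) = n + 1 + p ^ 2 := by field_simp
  rw [this]; linarith

theorem truncSq_tendsto (p : ℝ) : Tendsto (fun n => truncSq n p) atTop (𝓝 (p ^ 2)) := by
  have h : Tendsto (fun n : ℕ => p ^ 2 / ((n : ℝ) + 1)) atTop (𝓝 0) :=
    tendsto_const_nhds.div_atTop
      (tendsto_atTop_add_const_right _ _ tendsto_natCast_atTop_atTop)
  have := (tendsto_const_nhds (x := p ^ 2)).div (h.const_add 1) (by norm_num)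
  rw [add_zero, div_one] at this
  exact this

theorem truncSq_hasDerivAt (n : ℕ) (p : ℝ) :
    HasDerivAt (truncSq n) (2 * p / (1 + p ^ 2 / (n + 1)) ^ 2) p := by
  have hn : (0 : ℝ) < n + 1 := by positivity
  have hne : 1 + p ^ 2 / ((n : ℝ) + 1) ≠ 0 := by positivity
  have h1 : HasDerivAt (fun p : ℝ => p ^ 2) (2 * p) p := by simpa using hasDerivAt_pow 2 p
  have h2 := h1.div ((h1.div_const ((n : ℝ) + 1)).const_add 1) hne
  refine h2.congr_deriv ?_
  field_simp
  ring

theorem truncSq_contDiff (n : ℕ) : ContDiff ℝ 1 (truncSq n) := by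
  unfold truncSq
  refine (contDiff_id.pow 2).div (contDiff_const.add ((contDiff_id.pow 2).div_const _)) fun p => ?_
  have hn : (0 : ℝ) < n + 1 := by positivity
  have : 0 ≤ id p ^ 2 / ((n : ℝ) + 1) := by positivity
  positivity

theorem truncPow_contDiff (κ : ℝ) (n : ℕ) : ContDiff ℝ 1 (truncPow κ n) :=
  (contDiff_const.add (truncSq_contDiff n)).rpow_const_of_ne fun p => by
    have := truncSq_nonneg n p; positivity

theorem truncPow_deriv (κ : ℝ) (n : ℕ) (p : ℝ) :
    deriv (truncPow κ n) p
      = 2 * p / (1 + p ^ 2 / (n + 1)) ^ 2 * κ * (1 + truncSq n p) ^ (κ - 1) := by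
  have := truncSq_nonneg n p
  exact (((truncSq_hasDerivAt n p).const_add 1).rpow_const (p := κ)
    (Or.inl (by positivity))).deriv

theorem truncPow_nonneg (κ : ℝ) (n : ℕ) (p : ℝ) : 0 ≤ truncPow κ n p := by
  have := truncSq_nonneg n p
  unfold truncPow; positivity

theorem truncPow_le {κ : ℝ} (hκ1 : κ ≤ 1) (n : ℕ) (p : ℝ) :
    truncPow κ n p ≤ 1 + truncSq n p := by
  have := truncSq_nonneg n p
  unfold truncPow
  calc (1 + truncSq n p) ^ κ ≤ (1 + truncSq n p) ^ (1 : ℝ) :=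
        Real.rpow_le_rpow_of_exponent_le (by linarith) hκ1
    _ = 1 + truncSq n p := Real.rpow_one _

theorem abs_truncPow_le {κ : ℝ} (hκ1 : κ ≤ 1) (n : ℕ) (p : ℝ) :
    |truncPow κ n p| ≤ n + 2 := by
  rw [abs_of_nonneg (truncPow_nonneg κ n p)]
  have := truncPow_le hκ1 n p
  have := truncSq_le_const n p
  linarith

theorem abs_deriv_truncPow_le {κ : ℝ} (hκ : 0 ≤ κ) (hκ1 : κ ≤ 1) (n : ℕ) (p : ℝ) :
    |deriv (truncPow κ n) p| ≤ (n : ℝ) + 2 := by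
  have h0 := truncSq_nonneg n p
  have hn : (1 : ℝ) ≤ n + 1 := by linarith [Nat.cast_nonneg (α := ℝ) n]
  rw [truncPow_deriv, abs_mul, abs_mul, abs_of_nonneg hκ,
    abs_of_nonneg (Real.rpow_nonneg (by linarith) _)]
  have h1 : (1 + truncSq n p) ^ (κ - 1) ≤ 1 :=
    Real.rpow_le_one_of_one_le_of_nonpos (by linarith) (by linarith)
  have h2 : |2 * p / (1 + p ^ 2 / (n + 1)) ^ 2| ≤ (n : ℝ) + 1 := by
    have hpos : (1 : ℝ) ≤ 1 + p ^ 2 / (n + 1) := by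
      have : 0 ≤ p ^ 2 / ((n : ℝ) + 1) := by positivity
      linarith
    have hsq : 0 < (1 + p ^ 2 / ((n : ℝ) + 1)) ^ 2 := by positivity
    rw [abs_div, abs_of_pos hsq, div_le_iff₀ hsq, abs_mul, abs_two]
    have h3 : 1 + p ^ 2 / ((n : ℝ) + 1) ≤ (1 + p ^ 2 / (n + 1)) ^ 2 := by nlinarith
    have h4 : ((n : ℝ) + 1) * (1 + p ^ 2 / (n + 1)) = n + 1 + p ^ 2 := by field_simp
    have h5 : 2 * |p| ≤ n + 1 + p ^ 2 := by nlinarith [sq_nonneg (|p| - 1), sq_abs p]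
    calc 2 * |p| ≤ ((n : ℝ) + 1) * (1 + p ^ 2 / (n + 1)) := by rw [h4]; exact h5
      _ ≤ _ := mul_le_mul_of_nonneg_left h3 (by linarith)
  calc _ ≤ ((n : ℝ) + 1) * 1 * 1 := by gcongr
    _ ≤ n + 2 := by linarith

/-- The truncation keeps the growth of a power of degree at most two: p g'(p) is at most 2 g(p),
with no dependence on `n`. Consequently the derivative of p g(p) is at most 3 g(p), which is where
the factor 3 below comes from. -/
theorem abs_deriv_truncPow_mul_le {κ : ℝ} (hκ : 0 ≤ κ) (hκ1 : κ ≤ 1) (n : ℕ) (p : ℝ) :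
    |deriv (truncPow κ n) p * p| ≤ 2 * truncPow κ n p := by
  have h0 := truncSq_nonneg n p
  have hn : (0 : ℝ) < n + 1 := by positivity
  have hpos : (1 : ℝ) ≤ 1 + p ^ 2 / (n + 1) := by
    have : 0 ≤ p ^ 2 / ((n : ℝ) + 1) := by positivity
    linarith
  have e : deriv (truncPow κ n) p * p = 2 * κ * (p ^ 2 / (1 + p ^ 2 / (n + 1)) ^ 2)
      * (1 + truncSq n p) ^ (κ - 1) := by rw [truncPow_deriv]; ring
  have h1 : p ^ 2 / (1 + p ^ 2 / (n + 1)) ^ 2 ≤ 1 + truncSq n p := by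
    have : p ^ 2 / (1 + p ^ 2 / ((n : ℝ) + 1)) ^ 2 ≤ truncSq n p := by
      unfold truncSq
      refine div_le_div_of_nonneg_left (sq_nonneg p) (by linarith) ?_
      nlinarith
    linarith
  have h2 : 0 ≤ p ^ 2 / (1 + p ^ 2 / ((n : ℝ) + 1)) ^ 2 := by positivity
  have h3 : 0 ≤ (1 + truncSq n p) ^ (κ - 1) := Real.rpow_nonneg (by linarith) _
  rw [e, abs_of_nonneg (by positivity)]
  calc _ ≤ 2 * 1 * (1 + truncSq n p) * (1 + truncSq n p) ^ (κ - 1) := by gcongr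
    _ = 2 * ((1 + truncSq n p) ^ (1 : ℝ) * (1 + truncSq n p) ^ (κ - 1)) := by
        rw [Real.rpow_one]; ring
    _ = 2 * truncPow κ n p := by
        rw [← Real.rpow_add (by linarith)]
        congr 2; ring

/-- Young's inequality with exponents (κ + 1)/κ and κ + 1. The first power turns g into g (1 +
truncSq), and its coefficient κ/(κ + 1) is at most 1/2 since κ ≤ 1, so this term can be absorbed.
The 9 bounds 3^(κ + 1). -/
theorem truncPow_mul_le {κ : ℝ} (hκ : 0 < κ) (hκ1 : κ ≤ 1) (n : ℕ) (p : ℝ) {t : ℝ} (ht : 0 ≤ t) :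
    3 * t * truncPow κ n p ≤ 1 / 2 * (truncPow κ n p * (1 + p ^ 2)) + 9 * t ^ (κ + 1) := by
  have h0 := truncSq_nonneg n p
  have hg := truncPow_nonneg κ n p
  have hconj : ((κ + 1) / κ).HolderConjugate (κ + 1) := by
    rw [Real.holderConjugate_iff]
    refine ⟨by rw [lt_div_iff₀ hκ]; linarith, ?_⟩
    have : κ + 1 ≠ 0 := by positivity
    field_simp
  have hy := Real.young_inequality_of_nonneg hg (by positivity : 0 ≤ 3 * t) hconj
  have e1 : truncPow κ n p ^ ((κ + 1) / κ) = truncPow κ n p * (1 + truncSq n p) := by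
    unfold truncPow
    rw [← Real.rpow_mul (by linarith), mul_div_cancel₀ _ hκ.ne',
      Real.rpow_add (by linarith), Real.rpow_one]
  have e2 : truncPow κ n p ^ ((κ + 1) / κ) / ((κ + 1) / κ)
      ≤ 1 / 2 * (truncPow κ n p * (1 + p ^ 2)) := by
    rw [e1, div_le_iff₀ (by positivity)]
    have : (2 : ℝ) ≤ (κ + 1) / κ := by rw [le_div_iff₀ hκ]; linarith
    have h3 : truncPow κ n p * (1 + truncSq n p) ≤ truncPow κ n p * (1 + p ^ 2) :=
      mul_le_mul_of_nonneg_left (by linarith [truncSq_le n p]) hg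
    have h4 : 0 ≤ truncPow κ n p * (1 + p ^ 2) := by positivity
    nlinarith
  have e3 : (3 * t) ^ (κ + 1) / (κ + 1) ≤ 9 * t ^ (κ + 1) := by
    rw [Real.mul_rpow (by norm_num) ht]
    have h3 : (3 : ℝ) ^ (κ + 1) ≤ 3 ^ (2 : ℝ) :=
      Real.rpow_le_rpow_of_exponent_le (by norm_num) (by linarith)
    have h4 : (3 : ℝ) ^ (2 : ℝ) = 9 := by norm_num
    have h5 : 0 ≤ t ^ (κ + 1) := Real.rpow_nonneg ht _
    refine (div_le_self (by positivity) (by linarith)).trans ?_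
    exact mul_le_mul_of_nonneg_right (h3.trans h4.le) h5
  linarith

/-- If `a` is a weak derivative of a function `v` vanishing at the boundary and `b` is the weak
derivative of `a` in the same direction, then a bound on `∫ (|v| |b|) ^ (κ + 1)` gives a bound on
`∫ |a| ^ (2 (κ + 1))`. -/
theorem lintegral_one_add_sq_rpow_le (hD : IsOpen D) (hfin : volume D ≠ ⊤) {κ : ℝ} (hκ : 0 < κ)
    (hκ1 : κ ≤ 1) {i : Fin d} {v a b : Sp d → ℝ} (hv : MemLp v 2 (volume.restrict D))
    (ha : MemLp a 2 (volume.restrict D)) (hb : MemLp b 2 (volume.restrict D))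
    (hab : IsWeakPartialScalar D i a b)
    (hva : ∀ X Y : Sp d → ℝ, MemLp X 2 (volume.restrict D) → MemLp Y 2 (volume.restrict D) →
      IsWeakPartialScalar D i X Y → ∫ x in D, a x * X x = -∫ x in D, v x * Y x)
    {M : Sp d → ℝ} (hM : IntegrableOn M D)
    (hMle : ∀ᵐ x ∂(volume.restrict D), (|v x| * |b x|) ^ (κ + 1) ≤ M x) :
    ∫⁻ x in D, ENNReal.ofReal ((1 + a x ^ 2) ^ (κ + 1))
      ≤ ENNReal.ofReal (2 * (∫ x in D, (1 + a x ^ 2)) + 18 * ∫ x in D, M x) := by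
  have : IsFiniteMeasure (volume.restrict D) := ⟨by simpa using hfin.lt_top⟩
  set μ := volume.restrict D with hμ
  have ia : Integrable (fun x => 1 + a x ^ 2) μ := (integrable_const 1).add ha.integrable_sq
  -- The estimate for the truncated power, uniform in `n`. For fixed `n` all functions are bounded
  -- multiples of L² functions, so every integral is finite and absorption is legitimate.
  have hbound : ∀ n, ∫ x, (1 + truncSq n (a x)) ^ (κ + 1) ∂μ
      ≤ 2 * (∫ x, (1 + a x ^ 2) ∂μ) + 18 * ∫ x, M x ∂μ ∧
      Integrable (fun x => (1 + truncSq n (a x)) ^ (κ + 1)) μ := by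
    intro n
    set g := truncPow κ n with hg
    have hgc : ContDiff ℝ 1 g := truncPow_contDiff κ n
    have hgm : AEStronglyMeasurable (fun x => g (a x)) μ :=
      hgc.continuous.comp_aestronglyMeasurable ha.1
    have hgm' : AEStronglyMeasurable (fun x => deriv g (a x)) μ :=
      (hgc.continuous_deriv (by simp)).comp_aestronglyMeasurable ha.1
    have lX : MemLp (fun x => g (a x) * a x) 2 μ :=
      memLp_mul_of_bounded hgm (fun x => abs_truncPow_le hκ1 n _) ha
    have lY : MemLp (fun x => (deriv g (a x) * a x + g (a x)) * b x) 2 μ := by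
      refine memLp_mul_of_bounded (C := 3 * (n + 2)) ((hgm'.mul ha.1).add hgm) (fun x => ?_) hb
      refine (abs_add_le _ _).trans ?_
      have h1 := abs_deriv_truncPow_mul_le hκ.le hκ1 n (a x)
      have h2 := abs_truncPow_le hκ1 n (a x)
      have h3 := le_abs_self (truncPow κ n (a x))
      linarith
    have wXY : IsWeakPartialScalar D i (fun x => g (a x) * a x)
        (fun x => (deriv g (a x) * a x + g (a x)) * b x) := by
      intro φ h1 h2 h3
      rw [integral_weak_chain_rule hD ha hb ha hb hab hab hgc (abs_truncPow_le hκ1 n)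
        (abs_deriv_truncPow_le hκ.le hκ1 n) (h1.of_le (by norm_cast)) h2 h3]
      congr 2; ext x; ring
    -- Testing with g(a) a gives ∫ a² g(a) = -∫ v (g(a) a)' b. After ∫ g(a) is added, half of ∫
    -- g(a)(1 + a²) reappears on the right and is absorbed; doubling the rest produces the constants
    -- 2 and 18.
    have hint := hva _ _ lX lY wXY
    have i1 : Integrable (fun x => g (a x) * (1 + a x ^ 2)) μ :=
      integrable_mul_of_bounded hgm (fun x => abs_truncPow_le hκ1 n _) ia
    have i2 : Integrable (fun x => v x * ((deriv g (a x) * a x + g (a x)) * b x)) μ :=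
      integrable_mul_of_memLp_two hv lY
    have i3 : Integrable (fun x => g (a x)) μ := by
      simpa using integrable_mul_of_bounded hgm (fun x => abs_truncPow_le hκ1 n _)
        (integrable_const (1 : ℝ))
    have i4 : Integrable (fun x => a x * (g (a x) * a x)) μ := integrable_mul_of_memLp_two ha lX
    have iQ : Integrable (fun x => (1 + truncSq n (a x)) ^ (κ + 1)) μ := by
      refine Integrable.mono' i1 ?_ (Eventually.of_forall fun x => ?_)
      · have hc : Continuous fun p => (1 + truncSq n p) ^ (κ + 1) :=
          (continuous_const.add (truncSq_contDiff n).continuous).rpow_const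
            fun p => Or.inr (by positivity)
        exact hc.comp_aestronglyMeasurable ha.1
      · have h0 := truncSq_nonneg n (a x)
        rw [Real.norm_of_nonneg (Real.rpow_nonneg (by linarith) _), Real.rpow_add (by linarith),
          Real.rpow_one]
        exact mul_le_mul_of_nonneg_left (by linarith [truncSq_le n (a x)])
          (truncPow_nonneg κ n (a x))
    refine ⟨?_, iQ⟩
    have s1 : ∫ x, g (a x) * (1 + a x ^ 2) ∂μ
        = (∫ x, g (a x) ∂μ) + ∫ x, a x * (g (a x) * a x) ∂μ := by
      rw [← integral_add i3 i4]; congr 1; ext x; ring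
    have s2 : -∫ x, v x * ((deriv g (a x) * a x + g (a x)) * b x) ∂μ
        ≤ 1 / 2 * (∫ x, g (a x) * (1 + a x ^ 2) ∂μ) + 9 * ∫ x, M x ∂μ := by
      rw [← integral_neg, ← integral_const_mul, ← integral_const_mul,
        ← integral_add (i1.const_mul _) (hM.const_mul _)]
      refine integral_mono_ae i2.neg ((i1.const_mul _).add (hM.const_mul _)) ?_
      filter_upwards [hMle] with x hx
      have hgx := truncPow_nonneg κ n (a x)
      have h1 : |deriv g (a x) * a x + g (a x)| ≤ 3 * g (a x) := by
        refine (abs_add_le _ _).trans ?_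
        rw [abs_of_nonneg hgx]
        linarith [abs_deriv_truncPow_mul_le hκ.le hκ1 n (a x)]
      have h2 := truncPow_mul_le hκ hκ1 n (a x) (t := |v x| * |b x|) (by positivity)
      calc -(v x * ((deriv g (a x) * a x + g (a x)) * b x))
          ≤ |v x * ((deriv g (a x) * a x + g (a x)) * b x)| := neg_le_abs _
        _ = |deriv g (a x) * a x + g (a x)| * (|v x| * |b x|) := by rw [abs_mul, abs_mul]; ring
        _ ≤ 3 * g (a x) * (|v x| * |b x|) := mul_le_mul_of_nonneg_right h1 (by positivity)
        _ ≤ _ := by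
          have : 3 * g (a x) * (|v x| * |b x|) = 3 * (|v x| * |b x|) * truncPow κ n (a x) := by
            rw [hg]; ring
          rw [this]
          refine h2.trans ?_
          gcongr
    have s3 : ∫ x, g (a x) ∂μ ≤ ∫ x, (1 + a x ^ 2) ∂μ :=
      integral_mono i3 ia fun x =>
        (truncPow_le hκ1 n (a x)).trans (by linarith [truncSq_le n (a x)])
    have s4 : ∫ x, (1 + truncSq n (a x)) ^ (κ + 1) ∂μ ≤ ∫ x, g (a x) * (1 + a x ^ 2) ∂μ := by
      refine integral_mono iQ i1 fun x => ?_
      have h0 := truncSq_nonneg n (a x)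
      simp only
      rw [Real.rpow_add (by linarith), Real.rpow_one]
      exact mul_le_mul_of_nonneg_left (by linarith [truncSq_le n (a x)])
        (truncPow_nonneg κ n (a x))
    linarith
  have hlim : ∀ x, Tendsto (fun n => ENNReal.ofReal ((1 + truncSq n (a x)) ^ (κ + 1))) atTop
      (𝓝 (ENNReal.ofReal ((1 + a x ^ 2) ^ (κ + 1)))) := fun x =>
    (ENNReal.continuous_ofReal.tendsto _).comp
      (((truncSq_tendsto (a x)).const_add 1).rpow_const (Or.inr (by positivity)))
  -- The truncation is removed by Fatou's lemma.
  calc ∫⁻ x, ENNReal.ofReal ((1 + a x ^ 2) ^ (κ + 1)) ∂μ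
      = ∫⁻ x, liminf (fun n => ENNReal.ofReal ((1 + truncSq n (a x)) ^ (κ + 1))) atTop ∂μ :=
        lintegral_congr fun x => ((hlim x).liminf_eq).symm
    _ ≤ liminf (fun n => ∫⁻ x, ENNReal.ofReal ((1 + truncSq n (a x)) ^ (κ + 1)) ∂μ) atTop :=
        lintegral_liminf_le' fun n => (hbound n).2.1.aemeasurable.ennreal_ofReal
    _ ≤ _ := by
        refine liminf_le_of_le (by isBoundedDefault) fun c hc => ?_
        obtain ⟨n, hn⟩ := hc.exists
        refine hn.trans ?_
        rw [← ofReal_integral_eq_lintegral_ofReal (hbound n).2 (Eventually.of_forall fun x =>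
          Real.rpow_nonneg (by have := truncSq_nonneg n (a x); linarith) _)]
        exact ENNReal.ofReal_le_ofReal (hbound n).1

end
end Peridynamics

namespace Peridynamics
noncomputable section

variable {d : ℕ} {D : Set (Sp d)}

/-! ### Morrey's inequality -/

theorem enorm_sub_le_lintegral_segment {f : Sp d → ℝ} (hf : ContDiff ℝ 1 f) (x w : Sp d) :
    ‖f (x + w) - f x‖ₑ ≤ ‖w‖ₑ * ∫⁻ t in Ioc (0 : ℝ) 1, ‖fderiv ℝ f (x + t • w)‖ₑ := by
  have hc : Continuous fun t : ℝ => fderiv ℝ f (x + t • w) w :=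
    ((hf.continuous_fderiv (by simp)).comp (by fun_prop)).clm_apply continuous_const
  have hd : ∀ t ∈ uIcc (0 : ℝ) 1, HasDerivAt (fun t : ℝ => f (x + t • w))
      (fderiv ℝ f (x + t • w) w) t := fun t _ => by
    have h1 : HasDerivAt (fun t : ℝ => x + t • w) w t := by
      simpa using ((hasDerivAt_id t).smul_const w).const_add x
    exact (hf.differentiable (by simp) _).hasFDerivAt.comp_hasDerivAt t h1
  have h := intervalIntegral.integral_eq_sub_of_hasDerivAt hd (hc.intervalIntegrable _ _)
  simp only [one_smul, zero_smul, add_zero] at h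
  rw [← h, intervalIntegral.integral_of_le zero_le_one]
  refine (enorm_integral_le_lintegral_enorm _).trans ?_
  rw [← lintegral_const_mul' _ _ enorm_ne_top]
  refine lintegral_mono fun t => ?_
  rw [mul_comm]
  exact ContinuousLinearMap.le_opENorm _ _

theorem lintegral_le_rpow_mul_measure {α : Type*} [MeasurableSpace α] {μ : Measure α} {p : ℝ}
    (hp : 1 < p) {h : α → ENNReal} (hh : AEMeasurable h μ) :
    ∫⁻ z, h z ∂μ ≤ (∫⁻ z, h z ^ p ∂μ) ^ (1 / p) * μ univ ^ (1 - 1 / p) := by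
  have hpq := Real.HolderConjugate.conjExponent hp
  have := ENNReal.lintegral_mul_le_Lp_mul_Lq μ hpq hh (aemeasurable_const (b := (1 : ENNReal)))
  simp only [Pi.mul_apply, mul_one, ENNReal.one_rpow, lintegral_const, one_mul] at this
  have e : 1 / p.conjExponent = 1 - 1 / p := by
    have := hpq.inv_add_inv_eq_one
    rw [one_div, one_div]; linarith
  rwa [e] at this

theorem lintegral_comp_smul_add {h : Sp d → ENNReal} (hh : Measurable h) (x : Sp d) {t : ℝ}
    (ht : 0 < t) :
    ∫⁻ z, h (x + t • z) = ENNReal.ofReal (t⁻¹ ^ d) * ∫⁻ z, h z := by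
  have h1 : ∫⁻ z, h (x + t • z) = ∫⁻ z, h (x + z) ∂(Measure.map (fun z : Sp d => t • z) volume) := by
    rw [lintegral_map (by fun_prop) (measurable_const_smul t)]
  rw [h1, Measure.map_addHaar_smul _ ht.ne', lintegral_smul_measure,
    lintegral_add_left_eq_self h x]
  congr 2
  rw [abs_of_nonneg (by positivity), inv_pow]
  simp

/-- The factor `∫₀¹ t ^ (-d / p) dt`. -/
def morreyFactor (d : ℕ) (p : ℝ) : ENNReal :=
  ∫⁻ t in Ioc (0 : ℝ) 1, ENNReal.ofReal (t⁻¹ ^ d) ^ (1 / p)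

/-- The exponent -d/p exceeds -1. This is how the condition p > d makes the Morrey constant finite.
-/
theorem morreyFactor_ne_top {p : ℝ} (hp : (d : ℝ) < p) (hp1 : 1 < p) : morreyFactor d p ≠ ⊤ := by
  have hlt : -1 < -(d : ℝ) / p := by
    rw [lt_div_iff₀ (by linarith)]; linarith
  have hint : IntegrableOn (fun t : ℝ => t ^ (-(d : ℝ) / p)) (Ioc 0 1) :=
    (intervalIntegrable_iff_integrableOn_Ioc_of_le zero_le_one).1
      (intervalIntegral.intervalIntegrable_rpow' hlt)
  have : morreyFactor d p = ∫⁻ t in Ioc (0 : ℝ) 1, ‖t ^ (-(d : ℝ) / p)‖ₑ := by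
    refine setLIntegral_congr_fun measurableSet_Ioc fun t ht => ?_
    have ht0 : 0 < t := ht.1
    rw [Real.enorm_of_nonneg (by positivity), ENNReal.ofReal_rpow_of_nonneg (by positivity)
      (by positivity)]
    congr 1
    rw [inv_pow, ← Real.rpow_natCast, ← Real.rpow_neg ht0.le, ← Real.rpow_mul ht0.le]
    congr 1; ring
  rw [this]
  exact hint.2.ne

/-- The increment along each ray is integrated over the ball and the integrals are exchanged. For
fixed `t`, Hölder and the substitution z ↦ x + t z cost the factor t^(-d/p), whose integral is
`morreyFactor`. -/
theorem lintegral_ball_enorm_sub_center_le {f : Sp d → ℝ} (hf : ContDiff ℝ 1 f) {p : ℝ}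
    (hp1 : 1 < p) (x : Sp d) (r : ℝ) :
    ∫⁻ z in Metric.ball (0 : Sp d) r, ‖f (x + z) - f x‖ₑ
      ≤ ENNReal.ofReal r * (morreyFactor d p * ((∫⁻ z, ‖fderiv ℝ f z‖ₑ ^ p) ^ (1 / p)
        * volume (Metric.ball (0 : Sp d) r) ^ (1 - 1 / p))) := by
  have hm : Measurable fun z => ‖fderiv ℝ f z‖ₑ := (hf.continuous_fderiv (by simp)).enorm.measurable
  set N := ∫⁻ z, ‖fderiv ℝ f z‖ₑ ^ p with hN
  set V := volume (Metric.ball (0 : Sp d) r) with hV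
  calc ∫⁻ z in Metric.ball (0 : Sp d) r, ‖f (x + z) - f x‖ₑ
      ≤ ∫⁻ z in Metric.ball (0 : Sp d) r,
          ENNReal.ofReal r * ∫⁻ t in Ioc (0 : ℝ) 1, ‖fderiv ℝ f (x + t • z)‖ₑ := by
        refine setLIntegral_mono' measurableSet_ball fun z hz => ?_
        refine (enorm_sub_le_lintegral_segment hf x z).trans ?_
        gcongr
        rw [← ofReal_norm]
        exact ENNReal.ofReal_le_ofReal (mem_ball_zero_iff.1 hz).le
    _ = ENNReal.ofReal r * ∫⁻ t in Ioc (0 : ℝ) 1, ∫⁻ z in Metric.ball (0 : Sp d) r,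
          ‖fderiv ℝ f (x + t • z)‖ₑ := by
        rw [lintegral_const_mul' _ _ ENNReal.ofReal_ne_top, lintegral_lintegral_swap]
        exact (hm.comp (by fun_prop :
          Measurable fun q : Sp d × ℝ => x + q.2 • q.1)).aemeasurable
    _ ≤ ENNReal.ofReal r * ∫⁻ t in Ioc (0 : ℝ) 1, ENNReal.ofReal (t⁻¹ ^ d) ^ (1 / p)
          * (N ^ (1 / p) * V ^ (1 - 1 / p)) := by
        gcongr ENNReal.ofReal r * ?_
        refine setLIntegral_mono' measurableSet_Ioc fun t ht => ?_
        refine (lintegral_le_rpow_mul_measure hp1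
          (hm.comp (by fun_prop : Measurable fun z : Sp d => x + t • z)).aemeasurable).trans ?_
        rw [Measure.restrict_apply_univ, ← mul_assoc,
          ← ENNReal.mul_rpow_of_nonneg _ _ (by positivity : (0 : ℝ) ≤ 1 / p)]
        gcongr
        refine (setLIntegral_le_lintegral _ _).trans ?_
        rw [← lintegral_comp_smul_add (hm.pow_const p) x ht.1]
        rfl
    _ = _ := by
        rw [lintegral_mul_const _ (by fun_prop), morreyFactor]

/-- Here the segments are parallel translates of one another, so no rescaling and no singular factor
occurs. -/
theorem lintegral_ball_enorm_sub_translate_le {f : Sp d → ℝ} (hf : ContDiff ℝ 1 f) {p : ℝ}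
    (hp1 : 1 < p) (x y : Sp d) (r : ℝ) :
    ∫⁻ z in Metric.ball (0 : Sp d) r, ‖f (x + z) - f (y + z)‖ₑ
      ≤ ‖x - y‖ₑ * ((∫⁻ z, ‖fderiv ℝ f z‖ₑ ^ p) ^ (1 / p)
        * volume (Metric.ball (0 : Sp d) r) ^ (1 - 1 / p)) := by
  have hm : Measurable fun z => ‖fderiv ℝ f z‖ₑ := (hf.continuous_fderiv (by simp)).enorm.measurable
  set N := ∫⁻ z, ‖fderiv ℝ f z‖ₑ ^ p with hN
  set V := volume (Metric.ball (0 : Sp d) r) with hV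
  calc ∫⁻ z in Metric.ball (0 : Sp d) r, ‖f (x + z) - f (y + z)‖ₑ
      ≤ ∫⁻ z in Metric.ball (0 : Sp d) r,
          ‖x - y‖ₑ * ∫⁻ t in Ioc (0 : ℝ) 1, ‖fderiv ℝ f (y + z + t • (x - y))‖ₑ := by
        refine lintegral_mono fun z => ?_
        have := enorm_sub_le_lintegral_segment hf (y + z) (x - y)
        rwa [show y + z + (x - y) = x + z by abel] at this
    _ = ‖x - y‖ₑ * ∫⁻ t in Ioc (0 : ℝ) 1, ∫⁻ z in Metric.ball (0 : Sp d) r,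
          ‖fderiv ℝ f (y + z + t • (x - y))‖ₑ := by
        rw [lintegral_const_mul' _ _ enorm_ne_top, lintegral_lintegral_swap]
        exact (hm.comp (by fun_prop :
          Measurable fun q : Sp d × ℝ => y + q.1 + q.2 • (x - y))).aemeasurable
    _ ≤ ‖x - y‖ₑ * ∫⁻ _t in Ioc (0 : ℝ) 1, N ^ (1 / p) * V ^ (1 - 1 / p) := by
        gcongr ‖x - y‖ₑ * ?_
        refine lintegral_mono fun t => ?_
        refine (lintegral_le_rpow_mul_measure hp1
          (hm.comp (by fun_prop : Measurable fun z : Sp d => y + z + t • (x - y))).aemeasurable).trans ?_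
        rw [Measure.restrict_apply_univ]
        gcongr
        refine (setLIntegral_le_lintegral _ _).trans (le_of_eq ?_)
        rw [hN, ← lintegral_add_left_eq_self (fun z => ‖fderiv ℝ f z‖ₑ ^ p) (y + t • (x - y))]
        refine lintegral_congr fun z => ?_
        simp only [Function.comp_apply]
        rw [show y + z + t • (x - y) = y + t • (x - y) + z by abel]
    _ = _ := by
        rw [lintegral_const, Measure.restrict_apply_univ, Real.volume_Ioc]
        simp

/-- The constant in Morrey's inequality. -/
def morreyConst (d : ℕ) (p : ℝ) : ENNReal :=
  (2 * morreyFactor d p + 1) * (volume (Metric.ball (0 : Sp d) 1)) ^ (-(1 / p))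

theorem morreyConst_ne_top {p : ℝ} (hp : (d : ℝ) < p) (hp1 : 1 < p) : morreyConst d p ≠ ⊤ := by
  refine ENNReal.mul_ne_top (ENNReal.add_ne_top.2
    ⟨ENNReal.mul_ne_top (by simp) (morreyFactor_ne_top hp hp1), by simp⟩) ?_
  exact ENNReal.rpow_ne_top_of_ne_zero (Metric.measure_ball_pos volume _ one_pos).ne'
    measure_ball_lt_top.ne

/-- With r = |x - y|, the difference is averaged over z in a ball of radius r through the points x +
z and y + z. The two outer differences are centred, the middle one is a translation. Division by the
volume leaves r · r^(-d/p). -/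
theorem morrey_inequality {f : Sp d → ℝ} (hf : ContDiff ℝ 1 f) {p : ℝ} (hp1 : 1 < p)
    (x y : Sp d) :
    ‖f x - f y‖ₑ ≤ morreyConst d p * ENNReal.ofReal (‖x - y‖ ^ (1 - d / p))
      * (∫⁻ z, ‖fderiv ℝ f z‖ₑ ^ p) ^ (1 / p) := by
  rcases eq_or_ne x y with rfl | hxy
  · simp
  set r := ‖x - y‖ with hr
  have hr0 : 0 < r := norm_pos_iff.2 (sub_ne_zero.2 hxy)
  set N := ∫⁻ z, ‖fderiv ℝ f z‖ₑ ^ p with hN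
  set V := volume (Metric.ball (0 : Sp d) r) with hV
  have hV0 : V ≠ 0 := (Metric.measure_ball_pos volume _ hr0).ne'
  have hVt : V ≠ ⊤ := measure_ball_lt_top.ne
  have hcf : Continuous f := hf.continuous
  have hsum : ‖f x - f y‖ₑ * V ≤ ENNReal.ofReal r * (2 * morreyFactor d p + 1)
      * (N ^ (1 / p) * V ^ (1 - 1 / p)) := by
    have m1 : Measurable fun z => ‖f (x + z) - f x‖ₑ := by
      exact (by fun_prop : Continuous fun z => f (x + z) - f x).enorm.measurable
    have m2 : Measurable fun z => ‖f (x + z) - f (y + z)‖ₑ := by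
      exact (by fun_prop : Continuous fun z => f (x + z) - f (y + z)).enorm.measurable
    calc ‖f x - f y‖ₑ * V = ∫⁻ _z in Metric.ball (0 : Sp d) r, ‖f x - f y‖ₑ := by
          rw [lintegral_const, Measure.restrict_apply_univ]
      _ ≤ ∫⁻ z in Metric.ball (0 : Sp d) r, (‖f (x + z) - f x‖ₑ + ‖f (x + z) - f (y + z)‖ₑ
            + ‖f (y + z) - f y‖ₑ) := by
          refine lintegral_mono fun z => ?_
          have : f x - f y = -(f (x + z) - f x) + (f (x + z) - f (y + z)) + (f (y + z) - f y) := by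
            ring
          simp only
          rw [this]
          refine (enorm_add_le _ _).trans (add_le_add ((enorm_add_le _ _).trans ?_) le_rfl)
          rw [enorm_neg]
      _ = (∫⁻ z in Metric.ball (0 : Sp d) r, ‖f (x + z) - f x‖ₑ)
          + (∫⁻ z in Metric.ball (0 : Sp d) r, ‖f (x + z) - f (y + z)‖ₑ)
          + ∫⁻ z in Metric.ball (0 : Sp d) r, ‖f (y + z) - f y‖ₑ := by
          rw [lintegral_add_left (m1.fun_add m2), lintegral_add_left m1]
      _ ≤ _ := add_le_add (add_le_add (lintegral_ball_enorm_sub_center_le hf hp1 x r)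
          (lintegral_ball_enorm_sub_translate_le hf hp1 x y r))
          (lintegral_ball_enorm_sub_center_le hf hp1 y r)
      _ = _ := by
          rw [← ofReal_norm, ← hr]; ring
  have hVr : V = ENNReal.ofReal (r ^ d) * volume (Metric.ball (0 : Sp d) 1) := by
    rw [hV, Measure.addHaar_ball_of_pos _ _ hr0]; simp
  have h1 : ‖f x - f y‖ₑ ≤ ENNReal.ofReal r * (2 * morreyFactor d p + 1)
      * (N ^ (1 / p) * V ^ (1 - 1 / p)) / V := by
    rw [ENNReal.le_div_iff_mul_le (Or.inl hV0) (Or.inl hVt)]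
    exact hsum
  refine h1.trans (le_of_eq ?_)
  have h2 : V ^ (1 - 1 / p) / V = V ^ (-(1 / p)) := by
    rw [show (1 - 1 / p) = -(1 / p) + 1 by ring, ENNReal.rpow_add _ _ hV0 hVt, ENNReal.rpow_one,
      ENNReal.mul_div_cancel_right hV0 hVt]
  have h3 : ENNReal.ofReal r * ENNReal.ofReal (r ^ d) ^ (-(1 / p))
      = ENNReal.ofReal (r ^ (1 - d / p)) := by
    rw [ENNReal.ofReal_rpow_of_pos (by positivity), ← ENNReal.ofReal_mul hr0.le]
    congr 1
    rw [← Real.rpow_natCast, ← Real.rpow_mul hr0.le]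
    nth_rewrite 1 [← Real.rpow_one r]
    rw [← Real.rpow_add hr0]
    congr 1; ring
  calc _ = ENNReal.ofReal r * (2 * morreyFactor d p + 1) * N ^ (1 / p)
        * (V ^ (1 - 1 / p) / V) := by
        simp only [div_eq_mul_inv, mul_assoc]
    _ = _ := by
        rw [h2, hVr, ENNReal.mul_rpow_of_ne_top ENNReal.ofReal_ne_top measure_ball_lt_top.ne,
          morreyConst, ← h3]
        ring

end
end Peridynamics

namespace Peridynamics
noncomputable section

variable {d : ℕ} {D : Set (Sp d)}

/-! ### Embeddings of `H² ∩ H¹₀` -/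

/-- `v` is a scalar component of an element of `W`, extended by zero, with gradient `a` and pure
second derivatives `b`, all of `L²` norm at most one. -/
structure IsNormalizedComponent (D : Set (Sp d)) (v : Sp d → ℝ) (a b : Fin d → Sp d → ℝ) :
    Prop where
  v_zero : ∀ x, x ∉ D → v x = 0
  a_zero : ∀ i x, x ∉ D → a i x = 0
  v_mem : MemLp v 2 volume
  a_mem : ∀ i, MemLp (a i) 2 volume
  b_mem : ∀ i, MemLp (b i) 2 (volume.restrict D)
  a_le : ∀ i, eLpNorm (a i) 2 volume ≤ 1
  b_le : ∀ i, eLpNorm (b i) 2 (volume.restrict D) ≤ 1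
  weak : ∀ i, IsWeakPartialScalar D i (a i) (b i)
  ibp : ∀ i, ∀ X Y : Sp d → ℝ, MemLp X 2 (volume.restrict D) → MemLp Y 2 (volume.restrict D) →
    IsWeakPartialScalar D i X Y → ∫ x in D, a i x * X x = -∫ x in D, v x * Y x

theorem isWeakPartialScalar_of_contDiff {w : Sp d → ℝ} (hw : ContDiff ℝ ∞ w) (i : Fin d) :
    IsWeakPartialScalar D i w (fun x => fderiv ℝ w x (basisVec i)) := by
  intro φ h1 h2 h3
  rw [setIntegral_eq_integral_of_forall_compl_eq_zero fun x hx => by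
      rw [fderiv_apply_eq_zero_of_notMem_tsupport (fun h => hx (h3 h)), zero_mul],
    setIntegral_eq_integral_of_forall_compl_eq_zero fun x hx => by
      rw [image_eq_zero_of_notMem_tsupport fun h => hx (h3 h), zero_mul]]
  have c1 := continuous_fderiv_apply h1 (basisVec i)
  have c2 := continuous_fderiv_apply hw (basisVec i)
  have s1 := h2.fderiv_apply (𝕜 := ℝ) (basisVec i)
  rw [integral_mul_fderiv_eq_neg_fderiv_mul_of_integrable (μ := volume)
    ((c1.mul hw.continuous).integrable_of_hasCompactSupport s1.mul_right)
    ((h1.continuous.mul c2).integrable_of_hasCompactSupport h2.mul_right)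
    ((h1.continuous.mul hw.continuous).integrable_of_hasCompactSupport h2.mul_right)
    (fun x _ => h1.differentiable (by simp) x) (fun x _ => hw.differentiable (by simp) x), neg_neg]

/-- Integration by parts is available against every H¹ function on `D`, in particular against a test
function that does not vanish on the boundary. This is why the extension by zero has no jump. -/
theorem IsNormalizedComponent.weak_univ {v : Sp d → ℝ} {a b : Fin d → Sp d → ℝ}
    (h : IsNormalizedComponent D v a b) (i : Fin d) : IsWeakPartialScalar univ i v (a i) := by
  intro φ h1 h2 _
  have lφ : MemLp φ 2 (volume.restrict D) := (h1.continuous.memLp_of_hasCompactSupport h2).restrict D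
  have lφ' : MemLp (fun x => fderiv ℝ φ x (basisVec i)) 2 (volume.restrict D) :=
    ((continuous_fderiv_apply h1 _).memLp_of_hasCompactSupport (h2.fderiv_apply (𝕜 := ℝ) _)).restrict D
  have := h.ibp i φ _ lφ lφ' (isWeakPartialScalar_of_contDiff h1 i)
  rw [setIntegral_eq_integral_of_forall_compl_eq_zero fun x hx => by rw [h.a_zero i x hx, zero_mul],
    setIntegral_eq_integral_of_forall_compl_eq_zero fun x hx => by rw [h.v_zero x hx, zero_mul]]
    at this
  rw [Measure.restrict_univ]
  simp only [mul_comm (φ _)]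
  rw [this, neg_neg]
  congr 1; ext x; ring

theorem norm_le_sum_basisVec (L : Sp d →L[ℝ] ℝ) : ‖L‖ ≤ ∑ i, |L (basisVec i)| := by
  refine L.opNorm_le_bound (Finset.sum_nonneg fun i _ => abs_nonneg _) fun x => ?_
  have hx : x = ∑ i, x i • basisVec i := by
    have := (EuclideanSpace.basisFun (Fin d) ℝ).sum_repr x
    simpa [basisVec] using this.symm
  calc ‖L x‖ = ‖∑ i, x i * L (basisVec i)‖ := by
        conv_lhs => rw [hx]
        simp [map_sum]
    _ ≤ ∑ i, ‖x i * L (basisVec i)‖ := norm_sum_le _ _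
    _ ≤ ∑ i, |L (basisVec i)| * ‖x‖ := by
        refine Finset.sum_le_sum fun i _ => ?_
        rw [norm_mul, mul_comm]
        exact mul_le_mul_of_nonneg_left (PiLp.norm_apply_le x i) (norm_nonneg _)
    _ = _ := by rw [Finset.sum_mul]

theorem eLpNorm_fderiv_moll_le {v : Sp d → ℝ} {a : Fin d → Sp d → ℝ} (hv : MemLp v 2 volume)
    (ha : ∀ i, MemLp (a i) 2 volume) (hva : ∀ i, IsWeakPartialScalar univ i v (a i)) {p : ℝ≥0}
    (hp : 1 ≤ p) (n : ℕ) :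
    eLpNorm (fderiv ℝ (moll n v)) p volume ≤ ∑ i, eLpNorm (a i) p volume := by
  have lv := locallyIntegrable_of_memLp_two hv
  have hm : ∀ i, AEStronglyMeasurable (moll n (a i)) volume := fun i =>
    moll_aestronglyMeasurable n (locallyIntegrable_of_memLp_two (ha i))
  calc eLpNorm (fderiv ℝ (moll n v)) p volume
      ≤ eLpNorm (∑ i, fun x => |moll n (a i) x|) p volume := by
        refine eLpNorm_mono_real fun x => ?_
        refine (norm_le_sum_basisVec _).trans (le_of_eq ?_)
        rw [Finset.sum_apply]
        refine Finset.sum_congr rfl fun i _ => ?_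
        rw [fderiv_moll_eq n i lv (hva i) (subset_univ _)]
    _ ≤ ∑ i, eLpNorm (fun x => |moll n (a i) x|) p volume :=
        eLpNorm_sum_le (fun i _ => (hm i).norm) (by exact_mod_cast hp)
    _ ≤ _ := by
        refine Finset.sum_le_sum fun i _ => ?_
        refine le_trans (le_of_eq ?_) (eLpNorm_moll_le n (ha i).1 hp)
        exact eLpNorm_norm (moll n (a i))

theorem moll_eq_zero_of_notMem {v : Sp d → ℝ} (hv : ∀ x, x ∉ D → v x = 0) (n : ℕ) {x : Sp d}
    (hx : x ∉ Metric.cthickening 1 D) : moll n v x = 0 := by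
  rw [moll_apply]
  refine integral_eq_zero_of_ae (Eventually.of_forall fun t => ?_)
  by_cases ht : t ∈ Metric.ball (0 : Sp d) (mollBump d n).rOut
  · have : x - t ∉ D := by
      intro h
      refine hx (Metric.mem_cthickening_of_dist_le x (x - t) 1 D h ?_)
      rw [dist_eq_norm, sub_sub_cancel]
      refine (mem_ball_zero_iff.1 ht).le.trans ?_
      change 1 / ((n : ℝ) + 1) ≤ 1
      rw [div_le_one (by positivity)]
      linarith [Nat.cast_nonneg (α := ℝ) n]
    simp [hv _ this]
  · rw [← (mollBump d n).support_normed_eq (μ := volume), Function.notMem_support] at ht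
    simp [ht]

/-- A uniform bound on the `L^q` norms of the normalized components. -/
def HasValueBound (D : Set (Sp d)) (q : ENNReal) : Prop :=
  ∃ C : ℝ≥0, ∀ v a b, IsNormalizedComponent D v a b → eLpNorm v q volume ≤ C

/-- A uniform bound on the `L^p` norms of the gradients of the normalized components. -/
def HasGradientBound (D : Set (Sp d)) (p : ENNReal) : Prop :=
  ∃ C : ℝ≥0, ∀ v a b, IsNormalizedComponent D v a b → ∀ i, eLpNorm (a i) p volume ≤ C

theorem hasGradientBound_two : HasGradientBound D 2 := ⟨1, fun _ _ _ h i => by simpa using h.a_le i⟩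

theorem HasGradientBound.mono (hfin : volume D ≠ ⊤) {p p' : ℝ≥0}
    (hp : 0 < p) (hpp : p ≤ p') (h : HasGradientBound D p') : HasGradientBound D p := by
  obtain ⟨C, hC⟩ := h
  have he : (0 : ℝ) ≤ 1 / (p : ENNReal).toReal - 1 / (p' : ENNReal).toReal := by
    simp only [ENNReal.coe_toReal, sub_nonneg]
    exact one_div_le_one_div_of_le (by exact_mod_cast hp) (by exact_mod_cast hpp)
  have hK : volume D ^ (1 / (p : ENNReal).toReal - 1 / (p' : ENNReal).toReal) ≠ ⊤ :=
    ENNReal.rpow_ne_top_of_nonneg he hfin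
  refine ⟨C * (volume D ^ (1 / (p : ENNReal).toReal - 1 / (p' : ENNReal).toReal)).toNNReal,
    fun v a b hab i => ?_⟩
  have hs : Function.support (a i) ⊆ D := fun x hx => by
    by_contra h; exact hx (hab.a_zero i x h)
  rw [ENNReal.coe_mul, ENNReal.coe_toNNReal hK]
  have := eLpNorm_le_eLpNorm_mul_rpow_measure_univ (μ := volume.restrict D) (f := a i)
    (p := p) (q := p') (by exact_mod_cast hpp) (hab.a_mem i).1.restrict
  rw [Measure.restrict_apply_univ, eLpNorm_restrict_eq_of_support_subset hs,
    eLpNorm_restrict_eq_of_support_subset hs] at this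
  exact this.trans (mul_le_mul_left (hC v a b hab i) _)

theorem sum_eLpNorm_le {a : Fin d → Sp d → ℝ} {p : ENNReal} {C : ℝ≥0}
    (h : ∀ i, eLpNorm (a i) p volume ≤ C) : ∑ i, eLpNorm (a i) p volume ≤ d * C := by
  refine (Finset.sum_le_sum fun i _ => h i).trans ?_
  simp

/-- The Sobolev inequality for the mollifications, which are all supported in the same bounded
neighbourhood of `D`. Fatou transfers the bound to the limit. -/
theorem HasGradientBound.hasValueBound (hDb : Bornology.IsBounded D) {p q : ℝ≥0} (hp : 1 ≤ p)
    (hpd : p < d) (hpq : (p : ℝ)⁻¹ - (d : ℝ)⁻¹ ≤ (q : ℝ)⁻¹) (h : HasGradientBound D p) :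
    HasValueBound D q := by
  obtain ⟨C, hC⟩ := h
  set s := Metric.cthickening 1 D with hs
  have hsb : Bornology.IsBounded s := hDb.cthickening
  set K : ℝ≥0 := eLpNormLESNormFDerivOfLeConst ℝ (volume : Measure (Sp d)) s p q with hK
  refine ⟨K * (d * C), fun v a b hab => ?_⟩
  have lv := locallyIntegrable_of_memLp_two hab.v_mem
  have hn : ∀ n, eLpNorm (moll n v) q volume ≤ K * (d * C) := by
    intro n
    have := eLpNorm_le_eLpNorm_fderiv_of_le (μ := (volume : Measure (Sp d))) (u := moll n v)
      (s := s) (p := p) (q := q) ((moll_contDiff n lv).of_le (by norm_cast))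
      (fun x hx => by
        by_contra hx'
        exact hx (moll_eq_zero_of_notMem hab.v_zero n hx')) hp (by simpa using hpd)
      (by simpa using hpq) hsb
    refine this.trans ?_
    gcongr
    exact (eLpNorm_fderiv_moll_le hab.v_mem hab.a_mem hab.weak_univ hp n).trans
      (sum_eLpNorm_le (hC v a b hab))
  refine (Lp.eLpNorm_lim_le_liminf_eLpNorm (fun n => moll_aestronglyMeasurable n lv) v
    (moll_ae_tendsto lv)).trans ?_
  refine liminf_le_of_le (by isBoundedDefault) fun c hc => ?_
  obtain ⟨n, hn'⟩ := hc.exists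
  exact hn'.trans (by exact_mod_cast hn n)

theorem enorm_moll_sub_le {v : Sp d → ℝ} {a : Fin d → Sp d → ℝ} (hv : MemLp v 2 volume)
    (ha : ∀ i, MemLp (a i) 2 volume) (hva : ∀ i, IsWeakPartialScalar univ i v (a i)) {p : ℝ≥0}
    (hp : 1 < p) (n : ℕ) (x y : Sp d) :
    ‖moll n v x - moll n v y‖ₑ ≤ morreyConst d p * ENNReal.ofReal (‖x - y‖ ^ (1 - d / (p : ℝ)))
      * ∑ i, eLpNorm (a i) p volume := by
  have lv := locallyIntegrable_of_memLp_two hv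
  refine (morrey_inequality ((moll_contDiff n lv).of_le (by norm_cast)) (p := p)
    (by exact_mod_cast hp) x y).trans ?_
  gcongr
  refine le_trans (le_of_eq ?_) (eLpNorm_fderiv_moll_le hv ha hva hp.le n)
  rw [eLpNorm_nnreal_eq_lintegral (by positivity)]

/-- Morrey's inequality compares a point of `D` with a fixed point `y` at which every mollification
vanishes. The norm of `y` is chosen to exceed that of every point of the neighbourhood, which
requires d > 0. -/
theorem HasGradientBound.hasValueBound_top (hd : 0 < d) (hDb : Bornology.IsBounded D) {p : ℝ≥0}
    (hp : 1 < p) (hpd : d < p) (h : HasGradientBound D p) : HasValueBound D ⊤ := by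
  obtain ⟨C, hC⟩ := h
  obtain ⟨R, hR0, hR⟩ := (hDb.cthickening (δ := 1)).exists_pos_norm_lt
  have hp1 : (1 : ℝ) < p := by exact_mod_cast hp
  have hpd' : (d : ℝ) < p := by exact_mod_cast hpd
  set y : Sp d := R • basisVec ⟨0, hd⟩ with hy
  have hyn : ‖y‖ = R := by
    rw [hy, norm_smul, Real.norm_of_nonneg hR0.le]; simp [basisVec]
  have hyD : y ∉ Metric.cthickening 1 D := fun h => by
    have := hR y h; rw [hyn] at this; exact lt_irrefl _ this
  set K : ENNReal := morreyConst d p * ENNReal.ofReal ((2 * R) ^ (1 - d / (p : ℝ))) * (d * C) with hK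
  have hKt : K ≠ ⊤ := ENNReal.mul_ne_top (ENNReal.mul_ne_top (morreyConst_ne_top hpd' hp1)
    ENNReal.ofReal_ne_top) (ENNReal.mul_ne_top (by simp) (by simp))
  refine ⟨K.toNNReal, fun v a b hab => ?_⟩
  rw [ENNReal.coe_toNNReal hKt]
  have lv := locallyIntegrable_of_memLp_two hab.v_mem
  rw [eLpNorm_exponent_top]
  refine essSup_le_of_ae_le _ ?_
  filter_upwards [moll_ae_tendsto lv] with x hx
  by_cases hxD : x ∈ D
  · refine le_of_tendsto ((continuous_enorm.tendsto _).comp hx) (Eventually.of_forall fun n => ?_)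
    have h1 := enorm_moll_sub_le hab.v_mem hab.a_mem hab.weak_univ hp n x y
    rw [moll_eq_zero_of_notMem hab.v_zero n hyD, sub_zero] at h1
    refine h1.trans ?_
    have hxy : ‖x - y‖ ≤ 2 * R := by
      have := hR x (Metric.self_subset_cthickening D hxD)
      linarith [norm_sub_le x y]
    have he : (0 : ℝ) ≤ 1 - d / p := by
      rw [sub_nonneg, div_le_one (by linarith)]; exact hpd'.le
    rw [hK]
    gcongr
    exact sum_eLpNorm_le (hC v a b hab)
  · rw [hab.v_zero x hxD]; simp

/-- Young's inequality with exponents 2/(1 - κ) and 2/(κ + 1), chosen so that the second factor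
enters exactly squared. -/
theorem mul_rpow_le_rpow_add_sq {κ : ℝ} (hκ : 0 < κ) (hκ1 : κ < 1) {s t : ℝ} (hs : 0 ≤ s)
    (ht : 0 ≤ t) : (s * t) ^ (κ + 1) ≤ s ^ (2 * (κ + 1) / (1 - κ)) + t ^ 2 := by
  have h1κ : 0 < 1 - κ := by linarith
  have hconj : (2 / (1 - κ)).HolderConjugate (2 / (κ + 1)) := by
    rw [Real.holderConjugate_iff]
    refine ⟨by rw [lt_div_iff₀ h1κ]; linarith, ?_⟩
    rw [inv_div, inv_div]; ring
  have hy := Real.young_inequality_of_nonneg (Real.rpow_nonneg hs (κ + 1))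
    (Real.rpow_nonneg ht (κ + 1)) hconj
  rw [← Real.mul_rpow hs ht, ← Real.rpow_mul hs, ← Real.rpow_mul ht,
    mul_div_cancel₀ _ (by positivity : κ + 1 ≠ 0), Real.rpow_two] at hy
  refine hy.trans (add_le_add ?_ ?_)
  · rw [show (κ + 1) * (2 / (1 - κ)) = 2 * (κ + 1) / (1 - κ) by ring]
    refine div_le_self (Real.rpow_nonneg hs _) ?_
    rw [le_div_iff₀ h1κ]; linarith
  · refine div_le_self (sq_nonneg t) ?_
    rw [le_div_iff₀ (by positivity)]; linarith

theorem integral_sq_le_one {α : Type*} [MeasurableSpace α] {μ : Measure α} {f : α → ℝ}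
    (hf : MemLp f 2 μ) (h : eLpNorm f 2 μ ≤ 1) : ∫ x, f x ^ 2 ∂μ ≤ 1 := by
  have h1 := abs_integral_mul_le_eLpNorm hf hf
  have h2 : (eLpNorm f 2 μ).toReal ≤ 1 := by
    have := ENNReal.toReal_mono ENNReal.one_ne_top h; simpa using this
  have h3 : ∫ x, f x ^ 2 ∂μ = ∫ x, |f x * f x| ∂μ := by
    congr 1; ext x; rw [abs_mul_self, sq]
  rw [h3]
  refine h1.trans ?_
  exact mul_le_one₀ h2 ENNReal.toReal_nonneg h2

theorem hasGradientBound_of_majorant (hD : IsOpen D) (hfin : volume D ≠ ⊤) {κ : ℝ} (hκ : 0 < κ)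
    (hκ1 : κ ≤ 1) {K : ℝ}
    (h : ∀ v a b, IsNormalizedComponent D v a b → ∀ i, ∃ M : Sp d → ℝ, IntegrableOn M D ∧
      (∀ᵐ x ∂(volume.restrict D), (|v x| * |b i x|) ^ (κ + 1) ≤ M x) ∧ ∫ x in D, M x ≤ K)
    {p : ℝ≥0} (hp : (p : ℝ) = 2 * (κ + 1)) : HasGradientBound D p := by
  have : IsFiniteMeasure (volume.restrict D) := ⟨by simpa using hfin.lt_top⟩
  have hp0 : p ≠ 0 := by rintro rfl; simp at hp; linarith
  set B : ENNReal := ENNReal.ofReal (2 * ((volume D).toReal + 1) + 18 * K) with hB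
  have hBt : B ^ (1 / (p : ℝ)) ≠ ⊤ := ENNReal.rpow_ne_top_of_nonneg (by positivity) ENNReal.ofReal_ne_top
  refine ⟨(B ^ (1 / (p : ℝ))).toNNReal, fun v a b hab i => ?_⟩
  obtain ⟨M, hM, hMle, hMK⟩ := h v a b hab i
  rw [ENNReal.coe_toNNReal hBt, eLpNorm_nnreal_eq_lintegral hp0]
  refine ENNReal.rpow_le_rpow ?_ (by positivity)
  have hla := (hab.a_mem i).restrict D
  have key := lintegral_one_add_sq_rpow_le hD hfin hκ hκ1 (hab.v_mem.restrict D) hla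
    (hab.b_mem i) (hab.weak i) (hab.ibp i) hM hMle
  have hsq : ∫ x in D, (1 + a i x ^ 2) ≤ (volume D).toReal + 1 := by
    rw [integral_add (integrable_const 1) hla.integrable_sq]
    refine add_le_add (by simp [Measure.real]) (integral_sq_le_one hla ?_)
    exact (eLpNorm_mono_measure _ Measure.restrict_le_self).trans (hab.a_le i)
  calc ∫⁻ x, ‖a i x‖ₑ ^ (p : ℝ) = ∫⁻ x in D, ‖a i x‖ₑ ^ (p : ℝ) := by
        rw [← lintegral_indicator hD.measurableSet]
        refine lintegral_congr fun x => ?_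
        by_cases hx : x ∈ D
        · rw [indicator_of_mem hx]
        · rw [indicator_of_notMem hx, hab.a_zero i x hx, enorm_zero,
            ENNReal.zero_rpow_of_pos (by positivity)]
    _ ≤ ∫⁻ x in D, ENNReal.ofReal ((1 + a i x ^ 2) ^ (κ + 1)) := by
        refine lintegral_mono fun x => ?_
        simp only
        rw [← ofReal_norm, ENNReal.ofReal_rpow_of_nonneg (norm_nonneg _) (by positivity)]
        refine ENNReal.ofReal_le_ofReal ?_
        rw [hp, Real.rpow_mul (norm_nonneg _), Real.rpow_two, Real.norm_eq_abs, sq_abs]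
        gcongr
        linarith
    _ ≤ _ := key
    _ ≤ B := ENNReal.ofReal_le_ofReal (by linarith)

/-- The second derivative is merely square integrable. The exponent 2(κ + 1)/(1 - κ) for `v` is the
one for which (|v| |b|)^(κ + 1) is then integrable. -/
theorem HasValueBound.hasGradientBound (hD : IsOpen D) (hfin : volume D ≠ ⊤) {κ : ℝ}
    (hκ : 0 < κ) (hκ1 : κ < 1) {p q : ℝ≥0} (hp : (p : ℝ) = 2 * (κ + 1))
    (hq : (q : ℝ) = 2 * (κ + 1) / (1 - κ)) (h : HasValueBound D q) : HasGradientBound D p := by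
  obtain ⟨C, hC⟩ := h
  have hq0 : q ≠ 0 := by
    rintro rfl
    have : 0 < 2 * (κ + 1) / (1 - κ) := div_pos (by linarith) (by linarith)
    rw [← hq] at this; simp at this
  refine hasGradientBound_of_majorant hD hfin hκ hκ1.le (K := (C : ℝ) ^ (q : ℝ) + 1)
    (fun v a b hab i => ?_) hp
  have hvq : MemLp v q volume := ⟨hab.v_mem.1, (hC v a b hab).trans_lt ENNReal.coe_lt_top⟩
  have i1 : Integrable (fun x => |v x| ^ (q : ℝ)) volume := by
    have := hvq.integrable_norm_rpow (by simpa using hq0) (by simp)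
    simpa using this
  have i2 := (hab.b_mem i).integrable_sq
  refine ⟨fun x => |v x| ^ (q : ℝ) + b i x ^ 2, i1.integrableOn.add i2,
    Eventually.of_forall fun x => ?_, ?_⟩
  · have := mul_rpow_le_rpow_add_sq hκ hκ1 (abs_nonneg (v x)) (abs_nonneg (b i x))
    rwa [sq_abs, ← hq] at this
  · rw [integral_add i1.integrableOn i2]
    refine add_le_add ?_ (integral_sq_le_one (hab.b_mem i) (hab.b_le i))
    refine (setIntegral_le_integral i1 (Eventually.of_forall fun x => by positivity)).trans ?_
    have h1 := hC v a b hab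
    have h2 : ENNReal.ofReal (∫ x, |v x| ^ (q : ℝ)) ≤ (C : ENNReal) ^ (q : ℝ) := by
      rw [ofReal_integral_eq_lintegral_ofReal i1 (Eventually.of_forall fun x => by positivity)]
      rw [eLpNorm_nnreal_eq_lintegral hq0] at h1
      have h3 := ENNReal.rpow_le_rpow h1 (by positivity : (0 : ℝ) ≤ q)
      rw [← ENNReal.rpow_mul, one_div_mul_cancel (by exact_mod_cast hq0), ENNReal.rpow_one] at h3
      refine le_trans (le_of_eq (lintegral_congr fun x => ?_)) h3
      rw [← ofReal_norm, ENNReal.ofReal_rpow_of_nonneg (norm_nonneg _) (by positivity),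
        Real.norm_eq_abs]
    rw [← ENNReal.coe_rpow_of_nonneg _ (by positivity)] at h2
    have := ENNReal.toReal_mono ENNReal.coe_ne_top h2
    rw [ENNReal.toReal_ofReal (integral_nonneg fun x => by positivity)] at this
    simpa using this

/-- The endpoint κ = 1 of the same estimate: with `v` bounded, |v b|² is dominated by a multiple of
b². -/
theorem HasValueBound.hasGradientBound_four (hD : IsOpen D) (hfin : volume D ≠ ⊤)
    (h : HasValueBound D ⊤) : HasGradientBound D 4 := by
  obtain ⟨C, hC⟩ := h
  have := hasGradientBound_of_majorant hD hfin one_pos le_rfl (K := (C : ℝ) ^ 2)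
    (fun v a b hab i => ?_) (p := 4) (by norm_num)
  · simpa using this
  have hv : ∀ᵐ x ∂(volume.restrict D), |v x| ≤ C := by
    have h1 := hC v a b hab
    rw [eLpNorm_exponent_top] at h1
    have h2 : ∀ᵐ x, ‖v x‖ₑ ≤ C := (ae_le_eLpNormEssSup (f := v)).mono fun x hx => hx.trans h1
    filter_upwards [ae_restrict_of_ae h2] with x hx
    have := ENNReal.toReal_mono ENNReal.coe_ne_top hx
    simpa using this
  have i2 := (hab.b_mem i).integrable_sq
  refine ⟨fun x => (C : ℝ) ^ 2 * b i x ^ 2, i2.const_mul _, ?_, ?_⟩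
  · filter_upwards [hv] with x hx
    rw [one_add_one_eq_two, Real.rpow_two, mul_pow, sq_abs (b i x)]
    gcongr
  · rw [integral_const_mul]
    exact mul_le_of_le_one_right (by positivity)
      (integral_sq_le_one (hab.b_mem i) (hab.b_le i))

/-- Sobolev steps, which raise the exponent of `v`, alternate with integrations by parts at κ = 1/2
and κ = 3/4. The loop stops at the gradient exponent 7/2, which exceeds both dimensions, so that
Morrey applies. -/
theorem hasBounds (hd : d = 2 ∨ d = 3) (hD : IsOpen D) (hDb : Bornology.IsBounded D) :
    HasValueBound D ⊤ ∧ HasGradientBound D 4 := by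
  have hfin : volume D ≠ ⊤ := hDb.measure_lt_top.ne
  have g2 : HasGradientBound D ((2 : ℝ≥0) : ENNReal) := by simpa using hasGradientBound_two
  have v6 : HasValueBound D ((6 : ℝ≥0) : ENNReal) := by
    rcases hd with rfl | rfl
    -- The Sobolev step needs p < d and 1/p - 1/d = 1/6. In the plane this forces the exponent down
    -- from 2 to 3/2; in space 2 itself works.
    · exact (g2.mono hfin (p := 3 / 2) (by norm_num) (by rw [← NNReal.coe_le_coe]; norm_num)).hasValueBound
        hDb (by rw [← NNReal.coe_le_coe]; norm_num) (by rw [← NNReal.coe_lt_coe]; norm_num) (by norm_num)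
    · exact g2.hasValueBound hDb (by norm_num) (by norm_num) (by norm_num)
  have g3 : HasGradientBound D ((3 : ℝ≥0) : ENNReal) :=
    v6.hasGradientBound hD hfin (κ := 1 / 2) (by norm_num) (by norm_num) (by norm_num) (by norm_num)
  have v14 : HasValueBound D ((14 : ℝ≥0) : ENNReal) := by
    rcases hd with rfl | rfl
    -- The exponents 7/4 and 42/17 solve 1/p - 1/d = 1/14 for d = 2 and d = 3.
    · exact (g3.mono hfin (p := 7 / 4) (by norm_num) (by rw [← NNReal.coe_le_coe]; norm_num)).hasValueBound
        hDb (by rw [← NNReal.coe_le_coe]; norm_num) (by rw [← NNReal.coe_lt_coe]; norm_num) (by norm_num)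
    · exact (g3.mono hfin (p := 42 / 17) (by norm_num) (by rw [← NNReal.coe_le_coe]; norm_num)).hasValueBound
        hDb (by rw [← NNReal.coe_le_coe]; norm_num) (by rw [← NNReal.coe_lt_coe]; norm_num) (by norm_num)
  have g72 : HasGradientBound D ((7 / 2 : ℝ≥0) : ENNReal) :=
    v14.hasGradientBound hD hfin (κ := 3 / 4) (by norm_num) (by norm_num) (by norm_num) (by norm_num)
  have vt : HasValueBound D ⊤ := by
    refine g72.hasValueBound_top ?_ hDb (by rw [← NNReal.coe_lt_coe]; norm_num) ?_
    · rcases hd with rfl | rfl <;> norm_num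
    · rcases hd with rfl | rfl <;> (rw [← NNReal.coe_lt_coe]; norm_num)
  exact ⟨vt, vt.hasGradientBound_four hD hfin⟩

end
end Peridynamics

namespace Peridynamics
noncomputable section

variable {d : ℕ} {D : Set (Sp d)}

/-! ### Components, homogeneity and the embedding constants of vector fields -/

theorem norm_basisVec (c : Fin d) : ‖basisVec c‖ = 1 := by simp [basisVec]

theorem inner_basisVec (c : Fin d) (x : Sp d) : inner ℝ (basisVec c) x = x c := by
  simp [basisVec, EuclideanSpace.inner_single_left]

theorem norm_le_sum_inner_basisVec (x : Sp d) : ‖x‖ ≤ ∑ c, |inner ℝ (basisVec c) x| := by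
  have hx : x = ∑ i, x i • basisVec i := by
    have := (EuclideanSpace.basisFun (Fin d) ℝ).sum_repr x
    simpa [basisVec] using this.symm
  calc ‖x‖ = ‖∑ i, x i • basisVec i‖ := by rw [← hx]
    _ ≤ ∑ i, ‖x i • basisVec i‖ := norm_sum_le _ _
    _ = _ := Finset.sum_congr rfl fun i _ => by
        rw [norm_smul, norm_basisVec, mul_one, inner_basisVec]; rfl

theorem eLpNorm_le_sum_inner_basisVec {μ : Measure (Sp d)} {w : Sp d → Sp d}
    (hw : AEStronglyMeasurable w μ) {p : ENNReal} (hp : 1 ≤ p) :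
    eLpNorm w p μ ≤ ∑ c, eLpNorm (fun x => inner ℝ (basisVec c) (w x)) p μ := by
  have hm : ∀ c, AEStronglyMeasurable (fun x => inner ℝ (basisVec c) (w x)) μ := fun c =>
    aestronglyMeasurable_const.inner hw
  calc eLpNorm w p μ ≤ eLpNorm (∑ c, fun x => ‖inner ℝ (basisVec c) (w x)‖) p μ := by
        refine eLpNorm_mono_real fun x => ?_
        rw [Finset.sum_apply]
        exact norm_le_sum_inner_basisVec _
    _ ≤ ∑ c, eLpNorm (fun x => ‖inner ℝ (basisVec c) (w x)‖) p μ :=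
        eLpNorm_sum_le (fun c _ => (hm c).norm) hp
    _ = ∑ c, eLpNorm (fun x => inner ℝ (basisVec c) (w x)) p μ := by
        simp only [eLpNorm_norm]

theorem normL2_weakPartial_le_normH2 (D : Set (Sp d)) (u : Sp d → Sp d) (i : Fin d) :
    normL2 D (weakPartial D i u) ≤ normH2 D u := by
  refine Real.le_sqrt_of_sq_le ?_
  have h1 := Finset.single_le_sum (f := fun i => normL2 D (weakPartial D i u) ^ 2)
    (fun i _ => sq_nonneg _) (Finset.mem_univ i)
  have h2 : 0 ≤ ∑ i, ∑ j, normL2 D (weakPartial D j (weakPartial D i u)) ^ 2 :=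
    Finset.sum_nonneg fun i _ => Finset.sum_nonneg fun j _ => sq_nonneg _
  have h3 := sq_nonneg (normL2 D u)
  linarith

theorem normL2_weakPartial_weakPartial_le_normH2 (D : Set (Sp d)) (u : Sp d → Sp d) (i j : Fin d) :
    normL2 D (weakPartial D j (weakPartial D i u)) ≤ normH2 D u := by
  refine Real.le_sqrt_of_sq_le ?_
  have h1 : 0 ≤ ∑ i, normL2 D (weakPartial D i u) ^ 2 := Finset.sum_nonneg fun i _ => sq_nonneg _
  have h2 := Finset.single_le_sum
    (f := fun i => ∑ j, normL2 D (weakPartial D j (weakPartial D i u)) ^ 2)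
    (fun i _ => Finset.sum_nonneg fun j _ => sq_nonneg _) (Finset.mem_univ i)
  have h2' := Finset.single_le_sum
    (f := fun j => normL2 D (weakPartial D j (weakPartial D i u)) ^ 2)
    (fun i _ => sq_nonneg _) (Finset.mem_univ j)
  have h3 := sq_nonneg (normL2 D u)
  linarith

theorem eLpNorm_le_one_of_normL2 {w : Sp d → Sp d} (hw : MemL2 D w) (h : normL2 D w ≤ 1) :
    eLpNorm w 2 (volume.restrict D) ≤ 1 := by
  rw [← ENNReal.ofReal_toReal hw.eLpNorm_ne_top, ← ENNReal.ofReal_one]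
  exact ENNReal.ofReal_le_ofReal h

theorem MemW.isNormalizedComponent (hD : IsOpen D) {u : Sp d → Sp d} (hu : MemW D u)
    (h1 : normH2 D u ≤ 1) (c : Fin d) :
    IsNormalizedComponent D (D.indicator fun x => inner ℝ (basisVec c) (u x))
      (fun i => D.indicator fun x => inner ℝ (basisVec c) (weakPartial D i u x))
      (fun i x => inner ℝ (basisVec c) (weakPartial D i (weakPartial D i u) x)) := by
  have hDm := hD.measurableSet
  have he : ‖basisVec c‖ ≤ 1 := (norm_basisVec c).le
  have s1 := fun i => hu.1.1.weakPartial_spec i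
  have s2 := fun i => (hu.1.2 i).weakPartial_spec i
  refine ⟨fun x hx => indicator_of_notMem hx _, fun i x hx => indicator_of_notMem hx _,
    memLp_indicator_of_restrict hDm (hu.1.1.1.inner_const _),
    fun i => memLp_indicator_of_restrict hDm ((s1 i).1.inner_const _),
    fun i => (s2 i).1.inner_const _, fun i => ?_, fun i => ?_, fun i => ?_,
    fun i X Y hX hY hXY => ?_⟩
  · rw [eLpNorm_indicator_eq_eLpNorm_restrict hDm]
    exact (eLpNorm_inner_const_le he 2 _).trans (eLpNorm_le_one_of_normL2 (s1 i).1
      ((normL2_weakPartial_le_normH2 D u i).trans h1))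
  · exact (eLpNorm_inner_const_le he 2 _).trans (eLpNorm_le_one_of_normL2 (s2 i).1
      ((normL2_weakPartial_weakPartial_le_normH2 D u i i).trans h1))
  · intro φ p1 p2 p3
    rw [setIntegral_mul_indicator hDm]
    exact (s2 i).2.inner_const (s1 i).1 (s2 i).1 _ φ p1 p2 p3
  · have := hu.2.integral_inner_weakPartial_mul hD i he hX hY hXY
    simp only [mul_comm _ (X _), mul_comm _ (Y _)] at this ⊢
    rw [setIntegral_mul_indicator hDm, setIntegral_mul_indicator hDm]
    exact this

/-- Homogeneity reduces to the unit ball of `W`. Dividing by the norm plus t and letting t tend to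
zero avoids a separate discussion of vanishing norm. -/
theorem MemW.le_of_normalized (hD : IsOpen D) {F : (Sp d → Sp d) → ENNReal} {C : ℝ}
    (hF : ∀ u, MemW D u → ∀ c : ℝ, 0 < c → F (c • u) = ENNReal.ofReal c * F u)
    (h : ∀ u, MemW D u → normH2 D u ≤ 1 → F u ≤ ENNReal.ofReal C) {u : Sp d → Sp d}
    (hu : MemW D u) : F u ≤ ENNReal.ofReal (C * normH2 D u) := by
  have key : ∀ t : ℝ, 0 < t → F u ≤ ENNReal.ofReal (C * (normH2 D u + t)) := by
    intro t ht
    have hN := normH2_nonneg D u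
    have hpos : 0 < normH2 D u + t := by linarith
    have h1 := h _ (hu.const_smul hD (normH2 D u + t)⁻¹) (by
      rw [normH2_const_smul hD hu.1, abs_of_pos (by positivity), inv_mul_le_one₀ hpos]
      linarith)
    have h2 := hF _ (hu.const_smul hD (normH2 D u + t)⁻¹) _ hpos
    rw [smul_smul, mul_inv_cancel₀ hpos.ne', one_smul] at h2
    rw [h2, mul_comm C, ENNReal.ofReal_mul hpos.le]
    gcongr
  have hlim : Tendsto (fun t : ℝ => ENNReal.ofReal (C * (normH2 D u + t))) (𝓝[>] 0)
      (𝓝 (ENNReal.ofReal (C * normH2 D u))) := by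
    have : Continuous fun t : ℝ => ENNReal.ofReal (C * (normH2 D u + t)) :=
      ENNReal.continuous_ofReal.comp (by fun_prop)
    have := this.tendsto 0
    rw [add_zero] at this
    exact this.mono_left nhdsWithin_le_nhds
  exact ge_of_tendsto hlim (by filter_upwards [self_mem_nhdsWithin] with t ht using key t ht)

theorem gradNorm_const_smul_ae (hD : IsOpen D) {u : Sp d → Sp d} (hu : MemH1 D u) {c : ℝ}
    (hc : 0 < c) :
    gradNorm D (c • u) =ᵐ[volume.restrict D] fun x => c * gradNorm D u x := by
  have : ∀ᵐ x ∂(volume.restrict D), ∀ i, weakPartial D i (c • u) x = c • weakPartial D i u x :=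
    ae_all_iff.2 fun i => weakPartial_const_smul hD hu c i
  filter_upwards [this] with x hx
  simp only [gradNorm, hx, norm_smul, Real.norm_of_nonneg hc.le, mul_pow, ← Finset.mul_sum]
  rw [Real.sqrt_mul (by positivity), Real.sqrt_sq hc.le]

theorem gradNorm_le_sum (u : Sp d → Sp d) (x : Sp d) :
    gradNorm D u x ≤ ∑ i, ‖weakPartial D i u x‖ := by
  refine Real.sqrt_le_iff.2 ⟨Finset.sum_nonneg fun i _ => norm_nonneg _, ?_⟩
  exact Finset.sum_sq_le_sq_sum_of_nonneg fun i _ => norm_nonneg _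

theorem gradNorm_nonneg (u : Sp d → Sp d) (x : Sp d) : 0 ≤ gradNorm D u x := Real.sqrt_nonneg _

theorem exists_embeddingConstants (hd : d = 2 ∨ d = 3) (hD : IsOpen D)
    (hDb : Bornology.IsBounded D) : ∃ c₁ c₂ : ℝ≥0, AreEmbeddingConstants D c₁ c₂ := by
  obtain ⟨⟨C1, h1⟩, ⟨C2, h2⟩⟩ := hasBounds hd hD hDb
  have hDm := hD.measurableSet
  -- One factor `d` sums over the components of `u`; for the gradient a second one sums over the
  -- directions of differentiation.
  refine ⟨d * C1, d * (d * C2), fun u hu => ⟨?_, ?_⟩⟩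
  · refine hu.le_of_normalized hD (F := fun u => eLpNorm u ⊤ (volume.restrict D))
      (fun u _ c hc => ?_) fun u hu hn => ?_
    · rw [eLpNorm_const_smul, Real.enorm_of_nonneg hc.le]
    · refine (eLpNorm_le_sum_inner_basisVec hu.1.1.1.1 (by simp)).trans ?_
      rw [ENNReal.ofReal_coe_nnreal]
      refine (Finset.sum_le_sum (g := fun _ => (C1 : ENNReal)) fun c _ => ?_).trans ?_
      · have := h1 _ _ _ (hu.isNormalizedComponent hD hn c)
        rwa [eLpNorm_indicator_eq_eLpNorm_restrict hDm] at this
      · simp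
  · refine hu.le_of_normalized hD (F := fun u => eLpNorm (gradNorm D u) 4 (volume.restrict D))
      (fun u hu c hc => ?_) fun u hu hn => ?_
    · rw [eLpNorm_congr_ae (gradNorm_const_smul_ae hD hu.1.1 hc)]
      have := eLpNorm_const_smul (p := 4) (μ := volume.restrict D) c (gradNorm D u)
      rw [Real.enorm_of_nonneg hc.le] at this
      exact this
    · rw [ENNReal.ofReal_coe_nnreal]
      have hm : ∀ i, AEStronglyMeasurable (weakPartial D i u) (volume.restrict D) := fun i =>
        (hu.1.1.weakPartial_spec i).1.1
      calc eLpNorm (gradNorm D u) 4 (volume.restrict D)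
          ≤ eLpNorm (∑ i, fun x => ‖weakPartial D i u x‖) 4 (volume.restrict D) := by
            refine eLpNorm_mono_real fun x => ?_
            rw [Finset.sum_apply, Real.norm_of_nonneg (gradNorm_nonneg u x)]
            exact gradNorm_le_sum u x
        _ ≤ ∑ i, eLpNorm (fun x => ‖weakPartial D i u x‖) 4 (volume.restrict D) :=
            eLpNorm_sum_le (fun i _ => (hm i).norm) (by norm_num)
        _ ≤ ∑ _i : Fin d, ∑ _c : Fin d, (C2 : ENNReal) := by
            refine Finset.sum_le_sum fun i _ => ?_
            rw [eLpNorm_norm]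
            refine (eLpNorm_le_sum_inner_basisVec (hm i) (by norm_num)).trans
              (Finset.sum_le_sum fun c _ => ?_)
            have := h2 _ _ _ (hu.isNormalizedComponent hD hn c) i
            rwa [eLpNorm_indicator_eq_eLpNorm_restrict hDm] at this
        _ ≤ _ := by simp

/-- Hölder continuity of planar `W` functions in the form of a bound on increments. -/
theorem exists_increment_bound {D : Set (Sp 2)} (hD : IsOpen D) (hDb : Bornology.IsBounded D) :
    ∃ C : ℝ, 0 ≤ C ∧ ∀ u : Sp 2 → Sp 2, MemW D u → ∀ h : Sp 2, ∀ᵐ x,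
      ‖D.indicator u (x + h) - D.indicator u x‖ ≤ C * ‖h‖ ^ (1 / 2 : ℝ) * normH2 D u := by
  obtain ⟨-, ⟨C2, h2⟩⟩ := hasBounds (Or.inl rfl) hD hDb
  have hDm := hD.measurableSet
  -- The gradient is in L⁴, and Morrey's inequality with d = 2 and p = 4 has the exponent 1 - 2/4 =
  -- 1/2.
  set K := morreyConst 2 4 with hK
  have hKt : K ≠ ⊤ := morreyConst_ne_top (by norm_num) (by norm_num)
  -- The outer 2 counts the components of the field, the inner 2 the partial derivatives of each.
  set C : ℝ := 2 * (K.toReal * (2 * C2)) with hCdef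
  have hC0 : 0 ≤ C := by positivity
  refine ⟨C, hC0, fun u hu h => ?_⟩
  set F : (Sp 2 → Sp 2) → ENNReal := fun u =>
    eLpNorm (fun x => D.indicator u (x + h) - D.indicator u x) ⊤ volume with hF
  have hb : F u ≤ ENNReal.ofReal (C * ‖h‖ ^ (1 / 2 : ℝ) * normH2 D u) := by
    refine hu.le_of_normalized hD (F := F) (fun u _ c hc => ?_) fun u hu hn => ?_
    · simp only [hF]
      have := eLpNorm_const_smul (p := ⊤) (μ := volume) c
        (fun x => D.indicator u (x + h) - D.indicator u x)
      rw [Real.enorm_of_nonneg hc.le] at this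
      rw [← this]
      congr 1; ext1 x
      have e : D.indicator (c • u) = c • D.indicator u := indicator_const_smul D c u
      simp only [e, Pi.smul_apply, smul_sub]
    · have hum : AEStronglyMeasurable (D.indicator u) volume :=
        (memLp_indicator_iff_restrict hDm |>.2 hu.1.1.1).1
      have humh : AEStronglyMeasurable (fun x => D.indicator u (x + h)) volume :=
        hum.comp_measurePreserving (measurePreserving_add_right volume h)
      refine (eLpNorm_le_sum_inner_basisVec (humh.sub hum) (by simp)).trans ?_
      have hc : ∀ c : Fin 2, eLpNorm (fun x => inner ℝ (basisVec c)
          (D.indicator u (x + h) - D.indicator u x)) ⊤ volume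
          ≤ K * ENNReal.ofReal (‖h‖ ^ (1 / 2 : ℝ)) * (2 * C2) := by
        intro c
        have hab := hu.isNormalizedComponent hD hn c
        set v : Sp 2 → ℝ := D.indicator fun x => inner ℝ (basisVec c) (u x) with hv
        have lv := locallyIntegrable_of_memLp_two hab.v_mem
        have e : ∀ x, inner ℝ (basisVec c) (D.indicator u x) = v x := fun x => by
          by_cases hx : x ∈ D
          · simp [hv, hx]
          · simp [hv, hx]
        rw [eLpNorm_exponent_top]
        refine essSup_le_of_ae_le _ ?_
        have hl := moll_ae_tendsto lv
        have hl' := (measurePreserving_add_right (volume : Measure (Sp 2)) h).quasiMeasurePreserving.ae hl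
        filter_upwards [hl, hl'] with x hx hx'
        rw [inner_sub_right, e, e]
        refine le_of_tendsto ((continuous_enorm.tendsto _).comp (hx'.sub hx))
          (Eventually.of_forall fun n => ?_)
        refine (enorm_moll_sub_le hab.v_mem hab.a_mem hab.weak_univ (p := 4) (by norm_num) n
          (x + h) x).trans ?_
        rw [add_sub_cancel_left]
        rw [show (1 - ((2 : ℕ) : ℝ) / ((4 : ℝ≥0) : ℝ)) = 1 / 2 by norm_num]
        gcongr
        · exact le_of_eq rfl
        · have := sum_eLpNorm_le (p := 4) (C := C2) (h2 _ _ _ hab)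
          simpa using this
      refine (Finset.sum_le_sum fun c _ => hc c).trans (le_of_eq ?_)
      rw [Finset.sum_const, Finset.card_univ, Fintype.card_fin, nsmul_eq_mul, hCdef,
        ENNReal.ofReal_mul (by positivity), ENNReal.ofReal_mul (by norm_num),
        ENNReal.ofReal_mul (by positivity), ENNReal.ofReal_toReal hKt,
        ENNReal.ofReal_mul (by norm_num), ENNReal.ofReal_coe_nnreal]
      simp only [Nat.cast_ofNat, ENNReal.ofReal_ofNat]
      ring
  have hae : ∀ᵐ x, ‖D.indicator u (x + h) - D.indicator u x‖ₑ
      ≤ ENNReal.ofReal (C * ‖h‖ ^ (1 / 2 : ℝ) * normH2 D u) := by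
    simp only [hF, eLpNorm_exponent_top] at hb
    exact (ae_le_eLpNormEssSup (f := fun x => D.indicator u (x + h) - D.indicator u x)).mono
      fun x hx => hx.trans hb
  filter_upwards [hae] with x hx
  rw [← ofReal_norm] at hx
  exact (ENNReal.ofReal_le_ofReal_iff (mul_nonneg (by positivity) (normH2_nonneg D u))).1 hx

end
end Peridynamics

namespace Peridynamics
noncomputable section
variable {d : ℕ} {D : Set (Sp d)}

/-! ### The data of the model -/

theorem IsInfluence.jbarFinite {J : ℝ → ℝ} (hJ : IsInfluence J) {α : ℝ} (hd : 1 ≤ d)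
    (hα : α < d) : JbarFinite d J α := by
  obtain ⟨M, hM⟩ := hJ.bdd
  refine integrableOn_ball_of_norm_le_rpow (C := M) (α := α) (by simpa using hd)
    (by simpa using hα) ?_ ?_
  · filter_upwards [ae_restrict_mem Metric.isOpen_ball.measurableSet] with x hx
    have hx1 : ‖x‖ < 1 := by simpa using hx
    have h0 := hJ.nonneg _ (norm_nonneg x)
    have hr : 0 ≤ ‖x‖ ^ α := Real.rpow_nonneg (norm_nonneg _) _
    rw [Real.norm_of_nonneg (div_nonneg h0 hr), Real.rpow_neg (norm_nonneg _), ← div_eq_mul_inv]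
    exact div_le_div_of_nonneg_right (hM _ (norm_nonneg _) hx1) hr
  · exact ((hJ.meas.comp measurable_norm).div
      (measurable_norm.pow_const α)).aestronglyMeasurable

/-- The derivatives of the profile `r ↦ f (r²)`. -/
def profile (f : ℝ → ℝ) (k : ℕ) : ℝ → ℝ := iteratedDeriv k fun s : ℝ => f (s ^ 2)

theorem supDeriv_nonneg (f : ℝ → ℝ) (k : ℕ) : 0 ≤ supDeriv f k :=
  Real.iSup_nonneg fun _ => abs_nonneg _

theorem deriv_profile (f : ℝ → ℝ) (k : ℕ) : deriv (profile f k) = profile f (k + 1) :=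
  iteratedDeriv_succ.symm

namespace IsPotential

variable {f : ℝ → ℝ}

theorem contDiff_profile (hf : IsPotential f) (k : ℕ) : ContDiff ℝ ∞ (profile f k) := by
  have h : ContDiff ℝ ∞ fun s : ℝ => f (s ^ 2) := by
    rw [← contDiffOn_univ]
    exact hf.smooth.comp (contDiff_id.pow 2).contDiffOn fun s _ => sq_nonneg s
  rw [profile, iteratedDeriv_eq_iterate]
  exact ContDiff.iterate_deriv k h

theorem continuous_profile (hf : IsPotential f) (k : ℕ) : Continuous (profile f k) := (hf.contDiff_profile k).continuous

theorem hasDerivAt_profile (hf : IsPotential f) (k : ℕ) (r : ℝ) : HasDerivAt (profile f k) (profile f (k + 1) r) r := by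
  rw [← deriv_profile]
  exact ((hf.contDiff_profile k).differentiable (by simp) r).hasDerivAt

theorem abs_profile_le (hf : IsPotential f) {k : ℕ} (h1 : 1 ≤ k) (h4 : k ≤ 4) (r : ℝ) :
    |profile f k r| ≤ supDeriv f k :=
  le_ciSup (hf.bdd k h1 h4) r

theorem abs_profile_sub_le (hf : IsPotential f) {k : ℕ} (h4 : k + 1 ≤ 4) (r s : ℝ) :
    |profile f k r - profile f k s| ≤ supDeriv f (k + 1) * |r - s| := by
  have := Convex.norm_image_sub_le_of_norm_deriv_le (f := profile f k) (s := univ)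
    (C := supDeriv f (k + 1)) (x := s) (y := r)
    (fun x _ => (hf.hasDerivAt_profile k x).differentiableAt)
    (fun x _ => by
      rw [deriv_profile, Real.norm_eq_abs]; exact hf.abs_profile_le (by omega) h4 x)
    convex_univ trivial trivial
  simpa [Real.norm_eq_abs] using this

/-- The profile is even. This gives the linear growth of its derivative, hence force bounds that are
proportional to the displacement. -/
theorem profile_one_zero (hf : IsPotential f) : profile f 1 0 = 0 := by
  have h := hf.hasDerivAt_profile 0 0
  have h2 : HasDerivAt (profile f 0) (-profile f 1 0) 0 := by
    have := h.comp_of_eq 0 (hasDerivAt_neg 0) neg_zero.symm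
    have e : profile f 0 ∘ Neg.neg = profile f 0 := by ext s; simp [profile]
    rwa [e, mul_neg_one] at this
  linarith [h.unique h2]

theorem abs_profile_one_le (hf : IsPotential f) (r : ℝ) : |profile f 1 r| ≤ supDeriv f 2 * |r| := by
  simpa [hf.profile_one_zero] using hf.abs_profile_sub_le (k := 1) (by norm_num) r 0

end IsPotential

end
end Peridynamics

namespace Peridynamics
noncomputable section
variable {d : ℕ} {D : Set (Sp d)}

/-! ### Scalar weak derivatives: translations, restriction, linearity -/

namespace IsWeakPartialScalar

variable {E : Set (Sp d)} {i : Fin d} {a a' b b' : Sp d → ℝ}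

theorem comp_add_right (h : IsWeakPartialScalar E i a b) (v : Sp d) :
    IsWeakPartialScalar ((· + v) ⁻¹' E) i (fun x => a (x + v)) fun x => b (x + v) := by
  intro φ h1 h2 h3
  have hmp := (measurePreserving_add_right (volume : Measure (Sp d)) v)
  have hme := measurableEmbedding_addRight v
  have key := h (fun x => φ (x - v)) (h1.comp (contDiff_id.sub contDiff_const))
    (h2.comp_homeomorph (Homeomorph.subRight v)) (by
      have : tsupport (fun x => φ (x - v)) = Homeomorph.subRight v ⁻¹' tsupport φ :=
        tsupport_comp_eq_preimage φ (Homeomorph.subRight v)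
      rw [this]
      intro x hx
      simpa using h3 hx)
  have e1 := hmp.setIntegral_preimage_emb hme
    (fun x => fderiv ℝ (fun x => φ (x - v)) x (basisVec i) * a x) E
  have e2 := hmp.setIntegral_preimage_emb hme (fun x => φ (x - v) * b x) E
  simp only [fderiv_comp_sub, add_sub_cancel_right] at e1 e2
  simp only [fderiv_comp_sub] at key
  rw [e1, e2, key]

theorem mono (h : IsWeakPartialScalar E i a b) {E' : Set (Sp d)} (hE : MeasurableSet E)
    (hE' : E' ⊆ E) : IsWeakPartialScalar E' i a b := by
  intro φ h1 h2 h3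
  have := h φ h1 h2 (h3.trans hE')
  rw [setIntegral_eq_of_subset_of_forall_sdiff_eq_zero hE hE' fun x hx => ?_,
    setIntegral_eq_of_subset_of_forall_sdiff_eq_zero hE hE' fun x hx => ?_] at this
  · exact this
  · rw [image_eq_zero_of_notMem_tsupport fun hx' => hx.2 (h3 hx'), zero_mul]
  · rw [fderiv_apply_eq_zero_of_notMem_tsupport fun hx' => hx.2 (h3 hx'), zero_mul]

theorem congr (h : IsWeakPartialScalar E i a b) (ha : a =ᵐ[volume.restrict E] a')
    (hb : b =ᵐ[volume.restrict E] b') : IsWeakPartialScalar E i a' b' := by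
  intro φ h1 h2 h3
  have e1 : ∫ x in E, fderiv ℝ φ x (basisVec i) * a' x
      = ∫ x in E, fderiv ℝ φ x (basisVec i) * a x :=
    integral_congr_ae (by filter_upwards [ha] with x hx; rw [hx])
  have e2 : ∫ x in E, φ x * b' x = ∫ x in E, φ x * b x :=
    integral_congr_ae (by filter_upwards [hb] with x hx; rw [hx])
  rw [e1, e2, h φ h1 h2 h3]

theorem const_mul (h : IsWeakPartialScalar E i a b) (c : ℝ) :
    IsWeakPartialScalar E i (fun x => c * a x) fun x => c * b x := by
  intro φ h1 h2 h3
  simp only [mul_left_comm _ c]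
  rw [integral_const_mul, integral_const_mul, h φ h1 h2 h3, mul_neg]

theorem add (h : IsWeakPartialScalar E i a b) (h' : IsWeakPartialScalar E i a' b')
    (ha : MemLp a 2 (volume.restrict E)) (ha' : MemLp a' 2 (volume.restrict E))
    (hb : MemLp b 2 (volume.restrict E)) (hb' : MemLp b' 2 (volume.restrict E)) :
    IsWeakPartialScalar E i (fun x => a x + a' x) fun x => b x + b' x := by
  intro φ h1 h2 h3
  have l1 : MemLp φ 2 (volume.restrict E) := (h1.continuous.memLp_of_hasCompactSupport h2).restrict E
  have l2 : MemLp (fun x => fderiv ℝ φ x (basisVec i)) 2 (volume.restrict E) :=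
    ((continuous_fderiv_apply h1 _).memLp_of_hasCompactSupport (h2.fderiv_apply (𝕜 := ℝ) _)).restrict E
  simp only [mul_add]
  rw [integral_add (integrable_mul_of_memLp_two l2 ha) (integrable_mul_of_memLp_two l2 ha'),
    integral_add (integrable_mul_of_memLp_two l1 hb) (integrable_mul_of_memLp_two l1 hb'),
    h φ h1 h2 h3, h' φ h1 h2 h3]
  ring

theorem sub (h : IsWeakPartialScalar E i a b) (h' : IsWeakPartialScalar E i a' b')
    (ha : MemLp a 2 (volume.restrict E)) (ha' : MemLp a' 2 (volume.restrict E))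
    (hb : MemLp b 2 (volume.restrict E)) (hb' : MemLp b' 2 (volume.restrict E)) :
    IsWeakPartialScalar E i (fun x => a x - a' x) fun x => b x - b' x := by
  have := h.add (h'.const_mul (-1)) ha (ha'.const_mul (-1)) hb (hb'.const_mul (-1))
  simpa [sub_eq_add_neg] using this

end IsWeakPartialScalar

/-! ### Measurable zero extensions and bond strains -/

open Classical in
/-- A Borel measurable function equal almost everywhere to the extension of `g` by zero. -/
def zeroExt (D : Set (Sp d)) (g : Sp d → Sp d) : Sp d → Sp d :=
  if h : AEStronglyMeasurable (D.indicator g) volume then h.mk else 0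

/-- The reason for choosing a Borel representative: joint measurability in the bond and the point,
needed by Tonelli and Minkowski, then follows by composition with (ξ, x) ↦ x + εξ. -/
theorem stronglyMeasurable_zeroExt (D : Set (Sp d)) (g : Sp d → Sp d) :
    StronglyMeasurable (zeroExt D g) := by
  unfold zeroExt
  split_ifs with h
  exacts [h.stronglyMeasurable_mk, stronglyMeasurable_zero]

theorem MemL2.zeroExt_ae_eq (hD : IsOpen D) {g : Sp d → Sp d} (hg : MemL2 D g) :
    zeroExt D g =ᵐ[volume] D.indicator g := by
  have h : AEStronglyMeasurable (D.indicator g) volume :=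
    (aestronglyMeasurable_indicator_iff hD.measurableSet).2 hg.1
  rw [zeroExt, dif_pos h]
  exact h.ae_eq_mk.symm

theorem MemL2.zeroExt_ae_eq_restrict (hD : IsOpen D) {g : Sp d → Sp d} (hg : MemL2 D g) :
    zeroExt D g =ᵐ[volume.restrict D] g :=
  EventuallyEq.trans (ae_restrict_of_ae (hg.zeroExt_ae_eq hD))
    (indicator_ae_eq_restrict hD.measurableSet)

theorem MemL2.memLp_zeroExt (hD : IsOpen D) {g : Sp d → Sp d} (hg : MemL2 D g) :
    MemLp (zeroExt D g) 2 volume :=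
  (memLp_congr_ae (hg.zeroExt_ae_eq hD)).2 ((memLp_indicator_iff_restrict hD.measurableSet).2 hg)

/-- A test function on the whole space is an H¹ function on `D`, and against such functions elements
of H¹₀ integrate by parts with no boundary term. -/
theorem MemH1Zero.weak_univ (hD : IsOpen D) {u : Sp d → Sp d} (hu : MemH1Zero D u) (i : Fin d)
    {e : Sp d} (he : ‖e‖ ≤ 1) :
    IsWeakPartialScalar univ i (fun x => inner ℝ e (zeroExt D u x))
      fun x => inner ℝ e (zeroExt D (weakPartial D i u) x) := by
  intro φ h1 h2 _
  have lφ : MemLp φ 2 (volume.restrict D) := (h1.continuous.memLp_of_hasCompactSupport h2).restrict D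
  have lφ' : MemLp (fun x => fderiv ℝ φ x (basisVec i)) 2 (volume.restrict D) :=
    ((continuous_fderiv_apply h1 _).memLp_of_hasCompactSupport (h2.fderiv_apply (𝕜 := ℝ) _)).restrict D
  have := hu.integral_inner_weakPartial_mul hD i he lφ lφ' (isWeakPartialScalar_of_contDiff h1 i)
  have key : ∀ (g : Sp d → Sp d) (ψ : Sp d → ℝ), MemL2 D g →
      ∫ x, ψ x * inner ℝ e (zeroExt D g x) = ∫ x in D, inner ℝ e (g x) * ψ x := by
    intro g ψ hg
    rw [← integral_indicator hD.measurableSet]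
    refine integral_congr_ae ?_
    filter_upwards [hg.zeroExt_ae_eq hD] with x hx
    rw [hx]
    by_cases hxD : x ∈ D <;> simp [hxD, mul_comm]
  rw [Measure.restrict_univ, key _ _ hu.1.1, key _ _ (hu.1.weakPartial_spec i).1, this, neg_neg]

/-- The strain of the displacement `g` along the bond `ε ξ` at `x`, times the square root of the
bond length. -/
def bondStrain (ε : ℝ) (ξ : Sp d) (g : Sp d → Sp d) (x : Sp d) : ℝ :=
  (√(ε * ‖ξ‖))⁻¹ * inner ℝ (‖ξ‖⁻¹ • ξ) (g (x + ε • ξ) - g x)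

theorem norm_direction_le_one (ξ : Sp d) : ‖‖ξ‖⁻¹ • ξ‖ ≤ 1 := by
  rw [norm_smul, norm_inv, norm_norm]
  exact inv_mul_le_one

theorem memLp_bondStrain (ε : ℝ) (ξ : Sp d) {g : Sp d → Sp d} {p : ENNReal}
    (hg : MemLp g p volume) : MemLp (bondStrain ε ξ g) p volume := by
  have h := hg.comp_measurePreserving (measurePreserving_add_right volume (ε • ξ))
  exact ((h.sub hg).const_inner (‖ξ‖⁻¹ • ξ)).const_mul _

theorem weakPartial_bondStrain_of_translate {E : Set (Sp d)} {i : Fin d} {g g' : Sp d → Sp d}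
    (hg : MemLp g 2 volume) (hg' : MemLp g' 2 volume) (ε : ℝ) (ξ : Sp d) (hE : MeasurableSet E)
    (h : IsWeakPartialScalar E i (fun x => inner ℝ (‖ξ‖⁻¹ • ξ) (g x))
      fun x => inner ℝ (‖ξ‖⁻¹ • ξ) (g' x)) :
    IsWeakPartialScalar (E ∩ (· + ε • ξ) ⁻¹' E) i (bondStrain ε ξ g) (bondStrain ε ξ g') := by
  have hT : MeasurableSet ((· + ε • ξ) ⁻¹' E) := measurable_add_const _ hE
  have h1 := (h.comp_add_right (ε • ξ)).mono hT (inter_subset_right (s := E))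
  have h2 := h.mono hE (inter_subset_left (t := (· + ε • ξ) ⁻¹' E))
  have l : ∀ k : Sp d → Sp d, MemLp k 2 volume →
      MemLp (fun x => inner ℝ (‖ξ‖⁻¹ • ξ) (k x)) 2 volume := fun k hk => hk.const_inner _
  have l' : ∀ k : Sp d → Sp d, MemLp k 2 volume →
      MemLp (fun x => inner ℝ (‖ξ‖⁻¹ • ξ) (k (x + ε • ξ))) 2 volume := fun k hk =>
    (l k hk).comp_measurePreserving (measurePreserving_add_right volume (ε • ξ))
  have := (h1.sub h2 ((l' g hg).restrict _) ((l g hg).restrict _) ((l' g' hg').restrict _)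
    ((l g' hg').restrict _)).const_mul (√(ε * ‖ξ‖))⁻¹
  simp only [← inner_sub_right] at this
  exact this

/-- For the displacement itself both endpoints of the bond may leave `D`, because its zero extension
is weakly differentiable everywhere. -/
theorem MemH1Zero.weakPartial_bondStrain (hD : IsOpen D) {u : Sp d → Sp d} (hu : MemH1Zero D u)
    (i : Fin d) (ε : ℝ) (ξ : Sp d) :
    IsWeakPartialScalar univ i (bondStrain ε ξ (zeroExt D u))
      (bondStrain ε ξ (zeroExt D (weakPartial D i u))) := by
  have := weakPartial_bondStrain_of_translate (hu.1.1.memLp_zeroExt hD)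
    ((hu.1.weakPartial_spec i).1.memLp_zeroExt hD) ε ξ MeasurableSet.univ
    (hu.weak_univ hD i (norm_direction_le_one ξ))
  simpa using this

/-- To be applied to the partial derivatives of the displacement, which carry no boundary condition:
here both endpoints of the bond must stay in `D`. -/
theorem MemH1.weakPartial_bondStrain (hD : IsOpen D) {g : Sp d → Sp d} (hg : MemH1 D g)
    (i : Fin d) (ε : ℝ) (ξ : Sp d) :
    IsWeakPartialScalar (D ∩ (· + ε • ξ) ⁻¹' D) i (bondStrain ε ξ (zeroExt D g))
      (bondStrain ε ξ (zeroExt D (weakPartial D i g))) := by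
  obtain ⟨l, w⟩ := hg.weakPartial_spec i
  refine weakPartial_bondStrain_of_translate (hg.1.memLp_zeroExt hD) (l.memLp_zeroExt hD) ε ξ
    hD.measurableSet ((w.inner_const hg.1 l (‖ξ‖⁻¹ • ξ)).congr ?_ ?_)
  · filter_upwards [hg.1.zeroExt_ae_eq_restrict hD] with x hx; rw [hx]
  · filter_upwards [l.zeroExt_ae_eq_restrict hD] with x hx; rw [hx]

end
end Peridynamics

namespace Peridynamics
noncomputable section
variable {d : ℕ} {D : Set (Sp d)}

/-! ### Weak derivatives of the integrand for a fixed bond -/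

theorem memLp_mul_of_ae_bounded {α : Type*} [MeasurableSpace α] {μ : Measure α} {p : ENNReal}
    {h f : α → ℝ} {C : ℝ} (hh : AEStronglyMeasurable h μ) (hC : ∀ᵐ x ∂μ, |h x| ≤ C)
    (hf : MemLp f p μ) : MemLp (fun x => h x * f x) p μ := by
  refine MemLp.of_le_mul (c := C) hf (hh.mul hf.1) (hC.mono fun _ hx => ?_)
  rw [Real.norm_eq_abs, abs_mul]
  exact mul_le_mul_of_nonneg_right hx (abs_nonneg _)

/-- The weak chain rule with second factor 1, tested with φ η. Finite volume puts the constant 1 in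
L², and the term φ ∂η from the product rule is moved to the other side. -/
theorem isWeakPartialScalar_mul_comp (hD : IsOpen D) (hfin : volume D ≠ ⊤) {j : Fin d}
    {A A' : Sp d → ℝ} (hA : MemLp A 2 (volume.restrict D)) (hA' : MemLp A' 2 (volume.restrict D))
    (wA : IsWeakPartialScalar D j A A') {G : ℝ → ℝ} (hG : ContDiff ℝ 1 G) {C : ℝ}
    (hC : ∀ t, |G t| ≤ C) (hC' : ∀ t, |deriv G t| ≤ C) {η : Sp d → ℝ} (hη : ContDiffOn ℝ 1 η D) :
    IsWeakPartialScalar D j (fun x => η x * G (A x)) fun x =>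
      fderiv ℝ η x (basisVec j) * G (A x) + η x * (deriv G (A x) * A' x) := by
  intro φ h1 h2 h3
  have : IsFiniteMeasure (volume.restrict D) := ⟨by simpa using hfin.lt_top⟩
  have hφ1 : ContDiff ℝ 1 φ := h1.of_le (by norm_cast)
  have hψ := contDiff_mul_of_tsupport_subset hD hφ1 hη h3
  have hψs : tsupport (fun x => φ x * η x) ⊆ tsupport φ :=
    closure_mono fun x hx => by
      simp only [Function.mem_support] at hx ⊢; exact left_ne_zero_of_mul hx
  have hψc : HasCompactSupport fun x => φ x * η x := h2.mul_right
  have key := integral_weak_chain_rule hD hA hA' (memLp_const (1 : ℝ)) (memLp_const (0 : ℝ)) wA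
    (by simpa using isWeakPartialScalar_of_contDiff (contDiff_const (c := (1 : ℝ))) j)
    hG hC hC' hψ hψc
    (hψs.trans h3)
  simp only [fderiv_mul_of_tsupport_subset hD hφ1 hη h3, mul_one, mul_zero, add_zero] at key
  have hGA : AEStronglyMeasurable (fun x => G (A x)) (volume.restrict D) :=
    hG.continuous.comp_aestronglyMeasurable hA.1
  have hGA' : AEStronglyMeasurable (fun x => deriv G (A x)) (volume.restrict D) :=
    (hG.continuous_deriv le_rfl).comp_aestronglyMeasurable hA.1
  have c1 : Continuous fun x => fderiv ℝ φ x (basisVec j) * η x :=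
    contDiff_mul_of_tsupport_subset (k := 0) hD
      (contDiff_zero.2 (continuous_fderiv_apply h1 _)) (hη.of_le (by simp))
      ((tsupport_fderiv_apply_subset ℝ _).trans h3) |>.continuous
  have s1 : HasCompactSupport fun x => fderiv ℝ φ x (basisVec j) * η x :=
    (h2.fderiv_apply (𝕜 := ℝ) _).mul_right
  have i1 := integrable_mul_of_bounded hGA (fun x => hC (A x))
    (c1.integrable_of_hasCompactSupport (μ := volume) s1).restrict
  have c2 : Continuous fun x => φ x * fderiv ℝ η x (basisVec j) := by
    have : (fun x => φ x * fderiv ℝ η x (basisVec j)) = fun x =>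
        fderiv ℝ (fun x => φ x * η x) x (basisVec j) - fderiv ℝ φ x (basisVec j) * η x := by
      ext x; rw [fderiv_mul_of_tsupport_subset hD hφ1 hη h3]; ring
    rw [this]
    exact ((hψ.continuous_fderiv (by simp)).clm_apply continuous_const).sub c1
  have s2 : HasCompactSupport fun x => φ x * fderiv ℝ η x (basisVec j) := h2.mul_right
  have i2 := integrable_mul_of_bounded hGA (fun x => hC (A x))
    (c2.integrable_of_hasCompactSupport (μ := volume) s2).restrict
  have i3 : Integrable (fun x => φ x * η x * (deriv G (A x) * A' x)) (volume.restrict D) :=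
    integrable_mul_of_memLp_two
      ((hψ.continuous.memLp_of_hasCompactSupport hψc).restrict D)
      (memLp_mul_of_bounded hGA' (fun x => hC' (A x)) hA')
  have e1 : ∫ x in D, (fderiv ℝ φ x (basisVec j) * η x + φ x * fderiv ℝ η x (basisVec j)) * G (A x)
      = (∫ x in D, G (A x) * (fderiv ℝ φ x (basisVec j) * η x))
        + ∫ x in D, G (A x) * (φ x * fderiv ℝ η x (basisVec j)) := by
    rw [← integral_add i1 i2]
    congr 1; ext x; ring
  have e2 : ∫ x in D, φ x * (fderiv ℝ η x (basisVec j) * G (A x) + η x * (deriv G (A x) * A' x))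
      = (∫ x in D, G (A x) * (φ x * fderiv ℝ η x (basisVec j)))
        + ∫ x in D, φ x * η x * (deriv G (A x) * A' x) := by
    rw [← integral_add i2 i3]
    congr 1; ext x; ring
  have e3 : ∫ x in D, fderiv ℝ φ x (basisVec j) * (η x * G (A x))
      = ∫ x in D, G (A x) * (fderiv ℝ φ x (basisVec j) * η x) := by
    congr 1; ext x; ring
  rw [e1] at key
  rw [e2, e3]
  linarith

/-- The partial derivative `∂ᵢ η`. -/
def partialD (i : Fin d) (η : Sp d → ℝ) (x : Sp d) : ℝ := fderiv ℝ η x (basisVec i)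

/-- The integrand of the force for one bond, with weight `η` and scaled strain `A`. -/
def bondTerm (f : ℝ → ℝ) (η A : Sp d → ℝ) (x : Sp d) : ℝ := η x * profile f 1 (A x)

/-- The `i`-th partial derivative of `bondTerm`. -/
def bondTermD (f : ℝ → ℝ) (η A : Sp d → ℝ) (A₁ : Fin d → Sp d → ℝ) (i : Fin d) (x : Sp d) : ℝ :=
  partialD i η x * profile f 1 (A x) + η x * (profile f 2 (A x) * A₁ i x)

/-- The `j`-th partial derivative of `bondTermD`. -/
def bondTermDD (f : ℝ → ℝ) (η A : Sp d → ℝ) (A₁ : Fin d → Sp d → ℝ)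
    (A₂ : Fin d → Fin d → Sp d → ℝ) (i j : Fin d) (x : Sp d) : ℝ :=
  (partialD j (partialD i η) x * profile f 1 (A x)
      + partialD i η x * (profile f 2 (A x) * A₁ j x))
    + (partialD j η x * (profile f 2 (A x) * A₁ i x)
      + η x * (profile f 3 (A x) * A₁ j x * A₁ i x + profile f 2 (A x) * A₂ i j x))

/-- A `C²` weight on `D`, bounded with its derivatives, which vanishes on `D` outside `E`. -/
structure IsBondWeight (D E : Set (Sp d)) (c₁ c₂ : ℝ) (η : Sp d → ℝ) : Prop where
  smooth : ContDiffOn ℝ 2 η D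
  nonneg : ∀ x, 0 ≤ η x
  le_one : ∀ x, η x ≤ 1
  eq_zero : ∀ x ∈ D, x ∉ E → η x = 0
  grad_le : ∀ x ∈ D, √(∑ i, partialD i η x ^ 2) ≤ c₁
  hess_le : ∀ x ∈ D, √(∑ i, ∑ j, partialD j (partialD i η) x ^ 2) ≤ c₂

/-- Scaled strains `A` with weak derivatives `A₁` on `D` and weak second derivatives `A₂` on `E`. -/
structure IsBondStrain (D E : Set (Sp d)) (A : Sp d → ℝ) (A₁ : Fin d → Sp d → ℝ)
    (A₂ : Fin d → Fin d → Sp d → ℝ) : Prop where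
  mem : MemLp A 2 (volume.restrict D)
  mem₁ : ∀ i, MemLp (A₁ i) 2 (volume.restrict D)
  mem₁' : ∀ i, MemLp (A₁ i) 4 (volume.restrict D)
  mem₂ : ∀ i j, MemLp (A₂ i j) 2 (volume.restrict D)
  weak₁ : ∀ i, IsWeakPartialScalar D i A (A₁ i)
  weak₂ : ∀ i j, IsWeakPartialScalar E j (A₁ i) (A₂ i j)

theorem abs_le_sqrt_sum_sq {ι : Type*} [Fintype ι] (a : ι → ℝ) (i : ι) :
    |a i| ≤ √(∑ i, a i ^ 2) := by
  refine Real.abs_le_sqrt ?_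
  exact Finset.single_le_sum (f := fun i => a i ^ 2) (fun _ _ => sq_nonneg _) (Finset.mem_univ i)

namespace IsBondWeight

variable {E : Set (Sp d)} {c₁ c₂ : ℝ} {η : Sp d → ℝ}

theorem contDiffOn_partialD (h : IsBondWeight D E c₁ c₂ η) (hD : IsOpen D) (i : Fin d) :
    ContDiffOn ℝ 1 (partialD i η) D :=
  (h.smooth.fderiv_of_isOpen (m := 1) hD (by norm_num)).clm_apply contDiffOn_const

theorem continuousOn_partialD_partialD (h : IsBondWeight D E c₁ c₂ η) (hD : IsOpen D)
    (i j : Fin d) : ContinuousOn (partialD j (partialD i η)) D :=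
  ((h.contDiffOn_partialD hD i).continuousOn_fderiv_of_isOpen hD (by norm_num)).clm_apply
    continuousOn_const

theorem abs_le (h : IsBondWeight D E c₁ c₂ η) (x : Sp d) : |η x| ≤ 1 := by
  rw [abs_of_nonneg (h.nonneg x)]; exact h.le_one x

theorem abs_partialD_le (h : IsBondWeight D E c₁ c₂ η) {x : Sp d} (hx : x ∈ D) (i : Fin d) :
    |partialD i η x| ≤ c₁ :=
  (abs_le_sqrt_sum_sq (fun i => partialD i η x) i).trans (h.grad_le x hx)

theorem abs_partialD_partialD_le (h : IsBondWeight D E c₁ c₂ η) {x : Sp d} (hx : x ∈ D)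
    (i j : Fin d) : |partialD j (partialD i η) x| ≤ c₂ := by
  refine le_trans ?_ (h.hess_le x hx)
  have := abs_le_sqrt_sum_sq (fun p : Fin d × Fin d => partialD p.2 (partialD p.1 η) x) (i, j)
  simpa [Fintype.sum_prod_type] using this

theorem memLp_mul (h : IsBondWeight D E c₁ c₂ η) (hD : IsOpen D) {p : ENNReal} {g : Sp d → ℝ}
    (hg : MemLp g p (volume.restrict D)) : MemLp (fun x => η x * g x) p (volume.restrict D) :=
  memLp_mul_of_bounded (h.smooth.continuousOn.aestronglyMeasurable hD.measurableSet) h.abs_le hg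

theorem memLp_partialD_mul (h : IsBondWeight D E c₁ c₂ η) (hD : IsOpen D) {p : ENNReal}
    {g : Sp d → ℝ} (hg : MemLp g p (volume.restrict D)) (i : Fin d) :
    MemLp (fun x => partialD i η x * g x) p (volume.restrict D) :=
  memLp_mul_of_ae_bounded
    ((h.contDiffOn_partialD hD i).continuousOn.aestronglyMeasurable hD.measurableSet)
    ((ae_restrict_mem hD.measurableSet).mono fun _ hx => h.abs_partialD_le hx i) hg

theorem memLp_partialD_partialD_mul (h : IsBondWeight D E c₁ c₂ η) (hD : IsOpen D) {p : ENNReal}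
    {g : Sp d → ℝ} (hg : MemLp g p (volume.restrict D)) (i j : Fin d) :
    MemLp (fun x => partialD j (partialD i η) x * g x) p (volume.restrict D) :=
  memLp_mul_of_ae_bounded
    ((h.continuousOn_partialD_partialD hD i j).aestronglyMeasurable hD.measurableSet)
    ((ae_restrict_mem hD.measurableSet).mono fun _ hx => h.abs_partialD_partialD_le hx i j) hg

end IsBondWeight

namespace IsBondStrain

variable {E : Set (Sp d)} {A : Sp d → ℝ} {A₁ : Fin d → Sp d → ℝ}
  {A₂ : Fin d → Fin d → Sp d → ℝ} {f : ℝ → ℝ} {c₁ c₂ : ℝ} {η : Sp d → ℝ}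

theorem memLp_profile_mul (hA : IsBondStrain D E A A₁ A₂) (hf : IsPotential f) {k : ℕ}
    (h1 : 1 ≤ k) (h4 : k ≤ 4) {p : ENNReal} {g : Sp d → ℝ} (hg : MemLp g p (volume.restrict D)) :
    MemLp (fun x => profile f k (A x) * g x) p (volume.restrict D) :=
  memLp_mul_of_bounded ((hf.continuous_profile k).comp_aestronglyMeasurable hA.mem.1)
    (fun _ => hf.abs_profile_le h1 h4 _) hg

theorem memLp_profile (hA : IsBondStrain D E A A₁ A₂) (hf : IsPotential f) :
    MemLp (fun x => profile f 1 (A x)) 2 (volume.restrict D) :=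
  MemLp.of_le_mul (c := supDeriv f 2) hA.mem
    ((hf.continuous_profile 1).comp_aestronglyMeasurable hA.mem.1)
    (Eventually.of_forall fun _ => hf.abs_profile_one_le _)

theorem memLp_bondTerm (hA : IsBondStrain D E A A₁ A₂) (hf : IsPotential f) (hD : IsOpen D)
    (hη : IsBondWeight D E c₁ c₂ η) : MemLp (bondTerm f η A) 2 (volume.restrict D) :=
  hη.memLp_mul hD (hA.memLp_profile hf)

theorem memLp_bondTermD (hA : IsBondStrain D E A A₁ A₂) (hf : IsPotential f) (hD : IsOpen D)
    (hη : IsBondWeight D E c₁ c₂ η) (i : Fin d) :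
    MemLp (bondTermD f η A A₁ i) 2 (volume.restrict D) :=
  (hη.memLp_partialD_mul hD (hA.memLp_profile hf) i).add
    (hη.memLp_mul hD (hA.memLp_profile_mul hf (by norm_num) (by norm_num) (hA.mem₁ i)))

theorem memLp_bondTermDD_left (hA : IsBondStrain D E A A₁ A₂) (hf : IsPotential f) (hD : IsOpen D)
    (hη : IsBondWeight D E c₁ c₂ η) (i j : Fin d) :
    MemLp (fun x => partialD j (partialD i η) x * profile f 1 (A x)
      + partialD i η x * (profile f 2 (A x) * A₁ j x)) 2 (volume.restrict D) :=
  (hη.memLp_partialD_partialD_mul hD (hA.memLp_profile hf) i j).add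
    (hη.memLp_partialD_mul hD (hA.memLp_profile_mul hf (by norm_num) (by norm_num) (hA.mem₁ j)) i)

theorem memLp_bondTermDD_right (hA : IsBondStrain D E A A₁ A₂) (hf : IsPotential f)
    (hD : IsOpen D) (hη : IsBondWeight D E c₁ c₂ η) (i j : Fin d) :
    MemLp (fun x => partialD j η x * (profile f 2 (A x) * A₁ i x)
      + η x * (profile f 3 (A x) * A₁ j x * A₁ i x + profile f 2 (A x) * A₂ i j x)) 2
      (volume.restrict D) := by
  have : ENNReal.HolderTriple 4 4 2 := ⟨by
    rw [← two_mul, ← ENNReal.toReal_eq_toReal_iff' (by finiteness) (by finiteness)]; norm_num⟩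
  refine (hη.memLp_partialD_mul hD
    (hA.memLp_profile_mul hf (by norm_num) (by norm_num) (hA.mem₁ i)) j).add (hη.memLp_mul hD ?_)
  refine MemLp.add ?_ (hA.memLp_profile_mul hf (by norm_num) (by norm_num) (hA.mem₂ i j))
  simp only [mul_assoc]
  -- The quadratic term is in L² because each first derivative is in L⁴.
  exact hA.memLp_profile_mul hf (by norm_num) (by norm_num) ((hA.mem₁' i).mul (hA.mem₁' j))

theorem weakPartial_bondTerm (hA : IsBondStrain D E A A₁ A₂) (hf : IsPotential f) (hD : IsOpen D)
    (hfin : volume D ≠ ⊤) (hη : IsBondWeight D E c₁ c₂ η) (i : Fin d) :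
    IsWeakPartialScalar D i (bondTerm f η A) (bondTermD f η A A₁ i) := by
  have := isWeakPartialScalar_mul_comp hD hfin hA.mem (hA.mem₁ i) (hA.weak₁ i)
    ((hf.contDiff_profile 1).of_le (by norm_cast)) (C := max (supDeriv f 1) (supDeriv f 2))
    (fun t => (hf.abs_profile_le (by norm_num) (by norm_num) t).trans (le_max_left _ _))
    (fun t => by
      rw [deriv_profile]
      exact (hf.abs_profile_le (by norm_num) (by norm_num) t).trans (le_max_right _ _))
    (hη.smooth.of_le (by norm_num))
  rw [deriv_profile] at this
  exact this

/-- The two summands of the first derivative behave differently. The one with ∂η contains only the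
strain and is differentiated on all of `D`. The one with the strain derivative can be differentiated
only on `E`, and the vanishing of the weight outside `E` extends the identity to `D`. -/
theorem weakPartial_bondTermD (hA : IsBondStrain D E A A₁ A₂) (hf : IsPotential f) (hD : IsOpen D)
    (hE : IsOpen E) (hED : E ⊆ D) (hfin : volume D ≠ ⊤) (hη : IsBondWeight D E c₁ c₂ η)
    (i j : Fin d) :
    IsWeakPartialScalar D j (bondTermD f η A A₁ i) (bondTermDD f η A A₁ A₂ i j) := by
  have h1 := isWeakPartialScalar_mul_comp hD hfin hA.mem (hA.mem₁ j) (hA.weak₁ j)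
    ((hf.contDiff_profile 1).of_le (by norm_cast)) (C := max (supDeriv f 1) (supDeriv f 2))
    (fun t => (hf.abs_profile_le (by norm_num) (by norm_num) t).trans (le_max_left _ _))
    (fun t => by
      rw [deriv_profile]
      exact (hf.abs_profile_le (by norm_num) (by norm_num) t).trans (le_max_right _ _))
    (hη.contDiffOn_partialD hD i)
  have hr : volume.restrict E ≤ volume.restrict D := Measure.restrict_mono hED le_rfl
  have h2 : IsWeakPartialScalar D j (fun x => η x * (profile f 2 (A x) * A₁ i x)) fun x =>
      partialD j η x * (profile f 2 (A x) * A₁ i x)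
        + η x * (profile f 3 (A x) * A₁ j x * A₁ i x + profile f 2 (A x) * A₂ i j x) := by
    intro φ p1 p2 p3
    have := integral_weak_chain_rule_of_weight hD hE hED (hA.mem.mono_measure hr)
      ((hA.mem₁ j).mono_measure hr) ((hA.mem₁ i).mono_measure hr) ((hA.mem₂ i j).mono_measure hr)
      ((hA.weak₁ j).mono hD.measurableSet hED) (hA.weak₂ i j)
      ((hf.contDiff_profile 2).of_le (by norm_cast)) (C := max (supDeriv f 2) (supDeriv f 3))
      (fun t => (hf.abs_profile_le (by norm_num) (by norm_num) t).trans (le_max_left _ _))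
      (fun t => by
        rw [deriv_profile]
        exact (hf.abs_profile_le (by norm_num) (by norm_num) t).trans (le_max_right _ _))
      p1 p2 p3 (hη.smooth.of_le (by norm_num)) (fun x _ => hη.nonneg x) hη.eq_zero
    rw [deriv_profile] at this
    exact this
  rw [deriv_profile] at h1
  exact h1.add h2 (hη.memLp_partialD_mul hD (hA.memLp_profile hf) i)
    (hη.memLp_mul hD (hA.memLp_profile_mul hf (by norm_num) (by norm_num) (hA.mem₁ i)))
    (hA.memLp_bondTermDD_left hf hD hη i j) (hA.memLp_bondTermDD_right hf hD hη i j)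

end IsBondStrain

end
end Peridynamics

namespace Peridynamics
noncomputable section
variable {d : ℕ} {D : Set (Sp d)}

/-! ### Superposition of functions with weak derivatives -/

section Minkowski

variable {Ξ X : Type*} [MeasurableSpace Ξ] [MeasurableSpace X] {ν : Measure Ξ} {μ : Measure X}

theorem lintegral_mul_le_of_sq_le {g h : X → ENNReal} (hg : AEMeasurable g μ)
    (hh : AEMeasurable h μ) {a b : ENNReal} (ha : ∫⁻ x, g x ^ 2 ∂μ ≤ a ^ 2)
    (hb : ∫⁻ x, h x ^ 2 ∂μ ≤ b ^ 2) : ∫⁻ x, g x * h x ∂μ ≤ a * b := by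
  have hpq : (2 : ℝ).HolderConjugate 2 := by
    rw [Real.holderConjugate_iff]; norm_num
  have key := ENNReal.lintegral_mul_le_Lp_mul_Lq μ hpq hg hh
  simp only [Pi.mul_apply, ENNReal.rpow_two] at key
  have hs : ∀ c : ENNReal, (c ^ 2) ^ (1 / 2 : ℝ) = c := fun c => by
    rw [← ENNReal.rpow_two, ← ENNReal.rpow_mul]; norm_num
  calc _ ≤ _ := key
    _ ≤ (a ^ 2) ^ (1 / 2 : ℝ) * (b ^ 2) ^ (1 / 2 : ℝ) := by gcongr
    _ = a * b := by rw [hs, hs]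

/-- Minkowski's integral inequality for `p = 2`. -/
theorem lintegral_sq_lintegral_le [SFinite ν] [SFinite μ] {g : Ξ → X → ENNReal}
    (hg : Measurable (Function.uncurry g)) {β : Ξ → ENNReal} (hβ : AEMeasurable β ν)
    (h : ∀ᵐ ξ ∂ν, ∫⁻ x, g ξ x ^ 2 ∂μ ≤ β ξ ^ 2) :
    ∫⁻ x, (∫⁻ ξ, g ξ x ∂ν) ^ 2 ∂μ ≤ (∫⁻ ξ, β ξ ∂ν) ^ 2 := by
  have m1 : ∀ x, Measurable fun ξ => g ξ x := fun x => hg.comp (measurable_id.prodMk measurable_const)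
  have m2 : ∀ ξ, Measurable (g ξ) := fun ξ => hg.comp (measurable_const.prodMk measurable_id)
  have mG : Measurable fun x => ∫⁻ ξ, g ξ x ∂ν := hg.lintegral_prod_left'
  -- The square is written as a double integral over ξ and ζ; after Tonelli, Cauchy–Schwarz in x
  -- applies to each pair.
  calc ∫⁻ x, (∫⁻ ξ, g ξ x ∂ν) ^ 2 ∂μ = ∫⁻ x, ∫⁻ ξ, g ξ x * ∫⁻ ζ, g ζ x ∂ν ∂ν ∂μ := by
        refine lintegral_congr fun x => ?_
        rw [sq, lintegral_mul_const _ (m1 x)]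
    _ = ∫⁻ ξ, ∫⁻ x, g ξ x * ∫⁻ ζ, g ζ x ∂ν ∂μ ∂ν := by
        refine lintegral_lintegral_swap ?_
        exact ((hg.comp measurable_swap).mul (mG.comp measurable_fst)).aemeasurable
    _ = ∫⁻ ξ, ∫⁻ ζ, ∫⁻ x, g ξ x * g ζ x ∂μ ∂ν ∂ν := by
        refine lintegral_congr fun ξ => ?_
        rw [lintegral_lintegral_swap]
        · refine lintegral_congr fun x => ?_
          rw [lintegral_const_mul _ (m1 x)]
        · exact (((m2 ξ).comp measurable_snd).mul hg).aemeasurable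
    _ ≤ ∫⁻ ξ, ∫⁻ ζ, β ξ * β ζ ∂ν ∂ν := by
        refine lintegral_mono_ae ?_
        filter_upwards [h] with ξ hξ
        refine lintegral_mono_ae ?_
        filter_upwards [h] with ζ hζ
        exact lintegral_mul_le_of_sq_le (m2 ξ).aemeasurable (m2 ζ).aemeasurable hξ hζ
    _ = (∫⁻ ξ, β ξ ∂ν) ^ 2 := by
        rw [sq, ← lintegral_mul_const'' _ hβ]
        refine lintegral_congr fun ξ => ?_
        rw [lintegral_const_mul'' _ hβ]

theorem lintegral_enorm_sq_le_of_eLpNorm_le {g : X → ℝ} {b : ENNReal}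
    (h : eLpNorm g 2 μ ≤ b) : ∫⁻ x, ‖g x‖ₑ ^ 2 ∂μ ≤ b ^ 2 := by
  calc ∫⁻ x, ‖g x‖ₑ ^ 2 ∂μ = eLpNorm g 2 μ ^ 2 := by
        rw [eLpNorm_two_eq, ← ENNReal.rpow_two, ← ENNReal.rpow_mul]; norm_num
    _ ≤ b ^ 2 := by gcongr

end Minkowski

variable {Ξ : Type*} [MeasurableSpace Ξ] {ν : Measure Ξ} {e : Ξ → Sp d}

/-- The superposition `∫ Q_ξ e_ξ dν(ξ)`. -/
def superpose (ν : Measure Ξ) (e : Ξ → Sp d) (Q : Ξ → Sp d → ℝ) (x : Sp d) : Sp d :=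
  ∫ ξ, Q ξ x • e ξ ∂ν

/-- `Q` is a jointly measurable family of functions of `L²(D)` with norms at most `B`, where `B`
is integrable. -/
structure IsSquareBounded (D : Set (Sp d)) (ν : Measure Ξ) (Q : Ξ → Sp d → ℝ) (B : Ξ → ℝ) :
    Prop where
  meas : Measurable (Function.uncurry Q)
  integrable : Integrable B ν
  le : ∀ᵐ ξ ∂ν, eLpNorm (Q ξ) 2 (volume.restrict D) ≤ ENNReal.ofReal (B ξ)

namespace IsSquareBounded

variable {Q R : Ξ → Sp d → ℝ} {B B' : Ξ → ℝ}

theorem measurable_section (h : IsSquareBounded D ν Q B) (ξ : Ξ) : Measurable (Q ξ) :=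
  h.meas.comp (measurable_const.prodMk measurable_id)

theorem memLp (h : IsSquareBounded D ν Q B) :
    ∀ᵐ ξ ∂ν, MemLp (Q ξ) 2 (volume.restrict D) :=
  h.le.mono fun ξ hξ => ⟨(h.measurable_section ξ).aestronglyMeasurable,
    hξ.trans_lt ENNReal.ofReal_lt_top⟩

theorem lintegral_sq_le [SFinite ν] (h : IsSquareBounded D ν Q B) :
    ∫⁻ x in D, (∫⁻ ξ, ‖Q ξ x‖ₑ ∂ν) ^ 2 ≤ (∫⁻ ξ, ENNReal.ofReal (B ξ) ∂ν) ^ 2 :=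
  lintegral_sq_lintegral_le h.meas.enorm h.integrable.1.aemeasurable.ennreal_ofReal
    (h.le.mono fun _ hξ => lintegral_enorm_sq_le_of_eLpNorm_le hξ)

theorem lintegral_lt_top (h : IsSquareBounded D ν Q B) :
    ∫⁻ ξ, ENNReal.ofReal (B ξ) ∂ν < ⊤ :=
  (lintegral_mono fun ξ => Real.ofReal_le_enorm (B ξ)).trans_lt h.integrable.2

theorem ae_integrable [SFinite ν] (h : IsSquareBounded D ν Q B) :
    ∀ᵐ x ∂(volume.restrict D), Integrable (fun ξ => Q ξ x) ν := by
  have hlt := h.lintegral_sq_le.trans_lt (ENNReal.pow_lt_top h.lintegral_lt_top)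
  have hm : Measurable fun x => (∫⁻ ξ, ‖Q ξ x‖ₑ ∂ν) ^ 2 :=
    (h.meas.enorm.lintegral_prod_left').pow_const 2
  filter_upwards [ae_lt_top hm hlt.ne] with x hx
  refine ⟨(h.meas.comp (measurable_id.prodMk measurable_const)).aestronglyMeasurable, ?_⟩
  exact (ENNReal.pow_lt_top_iff.1 hx).resolve_right (by norm_num)

theorem integrable_prod [SFinite ν] (h : IsSquareBounded D ν Q B) (he : Measurable e)
    (he1 : ∀ ξ, ‖e ξ‖ ≤ 1) {φ : Sp d → ℝ} (hφ : Measurable φ)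
    (hφ2 : MemLp φ 2 (volume.restrict D)) :
    Integrable (fun p : Ξ × Sp d => φ p.2 • (Q p.1 p.2 • e p.1)) (ν.prod (volume.restrict D)) := by
  have hm : Measurable fun p : Ξ × Sp d => φ p.2 • (Q p.1 p.2 • e p.1) :=
    (hφ.comp measurable_snd).smul (h.meas.smul (he.comp measurable_fst))
  have hle : ∀ ξ x, ‖φ x • (Q ξ x • e ξ)‖ ≤ |φ x * Q ξ x| := fun ξ x => by
    rw [smul_smul, norm_smul, Real.norm_eq_abs]
    exact mul_le_of_le_one_right (abs_nonneg _) (he1 ξ)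
  rw [integrable_prod_iff hm.aestronglyMeasurable]
  have hI : ∀ᵐ ξ ∂ν, Integrable (fun x => φ x * Q ξ x) (volume.restrict D) :=
    h.memLp.mono fun ξ hξ => integrable_mul_of_memLp_two hφ2 hξ
  refine ⟨?_, ?_⟩
  · filter_upwards [hI] with ξ hξ
    exact hξ.abs.mono' (hm.comp (measurable_const.prodMk measurable_id)).aestronglyMeasurable
      (Eventually.of_forall (hle ξ))
  · refine (h.integrable.norm.const_mul (eLpNorm φ 2 (volume.restrict D)).toReal).mono'
      hm.norm.aestronglyMeasurable.integral_prod_right' ?_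
    filter_upwards [hI, h.le, h.memLp] with ξ hξ hB hQ
    rw [Real.norm_of_nonneg (integral_nonneg fun _ => norm_nonneg _)]
    calc ∫ x in D, ‖φ x • (Q ξ x • e ξ)‖ ≤ ∫ x in D, |φ x * Q ξ x| :=
          integral_mono_of_nonneg (Eventually.of_forall fun _ => norm_nonneg _) hξ.abs
            (Eventually.of_forall (hle ξ))
      _ ≤ _ := abs_integral_mul_le_eLpNorm hφ2 hQ
      _ ≤ _ := by
          gcongr
          exact (ENNReal.toReal_mono ENNReal.ofReal_ne_top
            (hB.trans (ENNReal.ofReal_le_ofReal (le_abs_self _)))).trans_eq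
            (ENNReal.toReal_ofReal (abs_nonneg _))

/-- Fubini moves the test integral inside the superposition, where the weak identity holds for
almost every parameter. -/
theorem isWeakPartial_superpose [SFinite ν] (h : IsSquareBounded D ν Q B)
    (h' : IsSquareBounded D ν R B') (he : Measurable e) (he1 : ∀ ξ, ‖e ξ‖ ≤ 1) {i : Fin d}
    (w : ∀ᵐ ξ ∂ν, IsWeakPartialScalar D i (Q ξ) (R ξ)) :
    IsWeakPartial D i (superpose ν e Q) (superpose ν e R) := by
  intro φ h1 h2 h3
  have key : ∀ {K : Ξ → Sp d → ℝ} {B : Ξ → ℝ}, IsSquareBounded D ν K B → ∀ ψ : Sp d → ℝ,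
      Continuous ψ → HasCompactSupport ψ →
      ∫ x in D, ψ x • superpose ν e K x = ∫ ξ, (∫ x in D, ψ x * K ξ x) • e ξ ∂ν := by
    intro K B hK ψ hc hs
    have hi := hK.integrable_prod he he1 hc.measurable
      ((hc.memLp_of_hasCompactSupport hs).restrict D)
    have := integral_integral_swap (f := fun ξ x => ψ x • (K ξ x • e ξ)) hi
    simp only [superpose, ← integral_smul]
    rw [← this]
    refine integral_congr_ae (Eventually.of_forall fun ξ => ?_)
    simp only [smul_smul]
    exact integral_smul_const _ _
  rw [key h _ (continuous_fderiv_apply h1 _) (h2.fderiv_apply (𝕜 := ℝ) _),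
    key h' _ h1.continuous h2, ← integral_neg]
  refine integral_congr_ae ?_
  filter_upwards [w] with ξ hξ
  rw [hξ φ h1 h2 h3, neg_smul]

end IsSquareBounded

/-- Minkowski's inequality for a finite family of superpositions. -/
theorem sum_normL2_superpose_le [SFinite ν] {ι : Type*} [Fintype ι] {Q : ι → Ξ → Sp d → ℝ}
    {B : Ξ → ℝ} (he : Measurable e) (he1 : ∀ ξ, ‖e ξ‖ ≤ 1)
    (hm : ∀ i, Measurable (Function.uncurry (Q i)))
    (h : IsSquareBounded D ν (fun ξ x => √(∑ i, Q i ξ x ^ 2)) B) :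
    (∀ i, MemL2 D (superpose ν e (Q i))) ∧
      √(∑ i, normL2 D (superpose ν e (Q i)) ^ 2) ≤ ∫ ξ, |B ξ| ∂ν := by
  -- With the discrete σ-algebra and counting measure on `ι`, Minkowski's inequality says that the
  -- Euclidean norm of an integral is at most the integral of the Euclidean norm.
  let _ : MeasurableSpace ι := ⊤
  have hS : ∀ i, StronglyMeasurable (superpose ν e (Q i)) := fun i =>
    ((hm i).smul (he.comp measurable_fst)).stronglyMeasurable.integral_prod_left'
  have hpt : ∀ x, ∑ i, ‖superpose ν e (Q i) x‖ₑ ^ 2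
      ≤ (∫⁻ ξ, ‖√(∑ i, Q i ξ x ^ 2)‖ₑ ∂ν) ^ 2 := by
    intro x
    have hmx : ∀ i, Measurable fun ξ => Q i ξ x := fun i =>
      (hm i).comp (measurable_id.prodMk measurable_const)
    have hmE : Measurable fun ξ => ‖√(∑ i, Q i ξ x ^ 2)‖ₑ :=
      (h.meas.comp (measurable_id.prodMk measurable_const)).enorm
    have := lintegral_sq_lintegral_le (ν := ν) (μ := Measure.count)
      (g := fun ξ (i : ι) => ‖Q i ξ x‖ₑ) (β := fun ξ => ‖√(∑ i, Q i ξ x ^ 2)‖ₑ)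
      (measurable_from_prod_countable_left fun i => (hmx i).enorm) hmE.aemeasurable
      (Eventually.of_forall fun ξ => by
        rw [lintegral_count, tsum_fintype]
        simp only [← enorm_pow, Real.sq_sqrt (Finset.sum_nonneg fun i _ => sq_nonneg (Q i ξ x))]
        simp only [Real.enorm_of_nonneg (Finset.sum_nonneg fun i _ => sq_nonneg (Q i ξ x)),
          Real.enorm_of_nonneg (sq_nonneg _)]
        rw [ENNReal.ofReal_sum_of_nonneg fun i _ => sq_nonneg _])
    rw [lintegral_count, tsum_fintype] at this
    refine le_trans (Finset.sum_le_sum fun i _ => ?_) this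
    gcongr
    refine (enorm_integral_le_lintegral_enorm _).trans (lintegral_mono fun ξ => ?_)
    rw [enorm_smul]
    refine mul_le_of_le_one_right' ?_
    rw [← ofReal_norm]
    exact ENNReal.ofReal_le_one.2 (he1 ξ)
  -- A second use of Minkowski's inequality, now in x. Handling the whole family at once avoids a
  -- constant depending on the number of components.
  have htot : ∑ i, ∫⁻ x in D, ‖superpose ν e (Q i) x‖ₑ ^ 2
      ≤ (∫⁻ ξ, ENNReal.ofReal (B ξ) ∂ν) ^ 2 := by
    rw [← lintegral_finsetSum _ fun i _ => (hS i).measurable.enorm.pow_const 2]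
    exact (lintegral_mono hpt).trans h.lintegral_sq_le
  have hlt := htot.trans_lt (ENNReal.pow_lt_top h.lintegral_lt_top)
  have hsq : ∀ i, eLpNorm (superpose ν e (Q i)) 2 (volume.restrict D) ^ 2
      = ∫⁻ x in D, ‖superpose ν e (Q i) x‖ₑ ^ 2 := fun i => by
    rw [eLpNorm_two_eq, ← ENNReal.rpow_two, ← ENNReal.rpow_mul]; norm_num
  have hfin : ∀ i, eLpNorm (superpose ν e (Q i)) 2 (volume.restrict D) < ⊤ := fun i => by
    have h1 : ∫⁻ x in D, ‖superpose ν e (Q i) x‖ₑ ^ 2 < ⊤ :=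
      (Finset.single_le_sum (f := fun i => ∫⁻ x in D, ‖superpose ν e (Q i) x‖ₑ ^ 2)
        (fun _ _ => zero_le) (Finset.mem_univ i)).trans_lt hlt
    rw [← hsq] at h1
    exact (ENNReal.pow_lt_top_iff.1 h1).resolve_right (by norm_num)
  refine ⟨fun i => ⟨(hS i).aestronglyMeasurable, hfin i⟩, ?_⟩
  have hB : ∫ ξ, |B ξ| ∂ν = (∫⁻ ξ, ‖B ξ‖ₑ ∂ν).toReal := by
    rw [← integral_norm_eq_lintegral_enorm h.integrable.1]; rfl
  have e1 : ∑ i, normL2 D (superpose ν e (Q i)) ^ 2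
      = (∑ i, ∫⁻ x in D, ‖superpose ν e (Q i) x‖ₑ ^ 2).toReal := by
    rw [ENNReal.toReal_sum fun i _ => by rw [← hsq]; exact (ENNReal.pow_lt_top (hfin i)).ne]
    refine Finset.sum_congr rfl fun i _ => ?_
    rw [← hsq, ENNReal.toReal_pow]; rfl
  rw [e1, hB]
  refine Real.sqrt_le_iff.2 ⟨ENNReal.toReal_nonneg, ?_⟩
  rw [← ENNReal.toReal_pow]
  refine ENNReal.toReal_mono (ENNReal.pow_ne_top h.integrable.2.ne) (htot.trans ?_)
  gcongr with ξ
  exact Real.ofReal_le_enorm (B ξ)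

theorem IsSquareBounded.mono {Q R : Ξ → Sp d → ℝ} {B : Ξ → ℝ} (h : IsSquareBounded D ν Q B)
    (hR : Measurable (Function.uncurry R)) (hle : ∀ ξ x, |R ξ x| ≤ |Q ξ x|) :
    IsSquareBounded D ν R B :=
  ⟨hR, h.integrable, h.le.mono fun ξ hξ => (eLpNorm_mono (hle ξ)).trans hξ⟩

/-- Weak derivatives pass through the superposition, and each order of differentiation is estimated
by its own Frobenius norm. The three orders are separated by subadditivity of the square root, so
the constants depend on no dimension. -/
theorem memH2_superpose [SFinite ν] (hD : IsOpen D) (he : Measurable e) (he1 : ∀ ξ, ‖e ξ‖ ≤ 1)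
    {Q₀ : Ξ → Sp d → ℝ} {Q₁ : Fin d → Ξ → Sp d → ℝ} {Q₂ : Fin d → Fin d → Ξ → Sp d → ℝ}
    {B₀ B₁ B₂ : Ξ → ℝ} (hB₀ : ∀ ξ, 0 ≤ B₀ ξ) (hB₁ : ∀ ξ, 0 ≤ B₁ ξ) (hB₂ : ∀ ξ, 0 ≤ B₂ ξ)
    (h₀ : IsSquareBounded D ν Q₀ B₀) (m₁ : ∀ i, Measurable (Function.uncurry (Q₁ i)))
    (h₁ : IsSquareBounded D ν (fun ξ x => √(∑ i, Q₁ i ξ x ^ 2)) B₁)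
    (m₂ : ∀ i j, Measurable (Function.uncurry (Q₂ i j)))
    (h₂ : IsSquareBounded D ν (fun ξ x => √(∑ i, ∑ j, Q₂ i j ξ x ^ 2)) B₂)
    (w₁ : ∀ᵐ ξ ∂ν, ∀ i, IsWeakPartialScalar D i (Q₀ ξ) (Q₁ i ξ))
    (w₂ : ∀ᵐ ξ ∂ν, ∀ i j, IsWeakPartialScalar D j (Q₁ i ξ) (Q₂ i j ξ)) :
    MemH2 D (superpose ν e Q₀) ∧
      normH2 D (superpose ν e Q₀) ≤ (∫ ξ, B₀ ξ ∂ν) + (∫ ξ, B₁ ξ ∂ν) + ∫ ξ, B₂ ξ ∂ν := by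
  -- The function itself is treated as a family indexed by `Unit`, so that one lemma serves all
  -- three orders.
  have h₀' : IsSquareBounded D ν (fun ξ x => √(∑ _i : Unit, Q₀ ξ x ^ 2)) B₀ := by
    simpa [Real.sqrt_sq_eq_abs] using h₀.mono (R := fun ξ x => |Q₀ ξ x|) h₀.meas.abs
      (fun ξ x => (abs_abs _).le)
  obtain ⟨l₀, n₀⟩ := sum_normL2_superpose_le (Q := fun _ : Unit => Q₀) he he1 (fun _ => h₀.meas) h₀'
  obtain ⟨l₁, n₁⟩ := sum_normL2_superpose_le he he1 m₁ h₁
  obtain ⟨l₂, n₂⟩ := sum_normL2_superpose_le (Q := fun p : Fin d × Fin d => Q₂ p.1 p.2) he he1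
    (fun p => m₂ p.1 p.2) (by simpa only [Fintype.sum_prod_type] using h₂)
  have s₁ : ∀ i, IsSquareBounded D ν (Q₁ i) B₁ := fun i => h₁.mono (m₁ i) fun ξ x =>
    (abs_le_sqrt_sum_sq (fun i => Q₁ i ξ x) i).trans (le_abs_self _)
  have s₂ : ∀ i j, IsSquareBounded D ν (Q₂ i j) B₂ := fun i j => h₂.mono (m₂ i j) fun ξ x => by
    have := abs_le_sqrt_sum_sq (fun p : Fin d × Fin d => Q₂ p.1 p.2 ξ x) (i, j)
    rw [Fintype.sum_prod_type] at this
    exact this.trans (le_abs_self _)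
  have p₁ : ∀ i, IsWeakPartial D i (superpose ν e Q₀) (superpose ν e (Q₁ i)) := fun i =>
    h₀.isWeakPartial_superpose (s₁ i) he he1 (w₁.mono fun _ h => h i)
  have p₂ : ∀ i j, IsWeakPartial D j (superpose ν e (Q₁ i)) (superpose ν e (Q₂ i j)) := fun i j =>
    (s₁ i).isWeakPartial_superpose (s₂ i j) he he1 (w₂.mono fun _ h => h i j)
  have q₁ : ∀ i, weakPartial D i (superpose ν e Q₀) =ᵐ[volume.restrict D] superpose ν e (Q₁ i) :=
    fun i => weakPartial_ae_eq hD (l₁ i) (p₁ i)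
  have H₁ : ∀ i, MemH1 D (superpose ν e (Q₁ i)) := fun i =>
    ⟨l₁ i, fun j => ⟨_, l₂ (i, j), p₂ i j⟩⟩
  have q₂ : ∀ i j, weakPartial D j (weakPartial D i (superpose ν e Q₀))
      =ᵐ[volume.restrict D] superpose ν e (Q₂ i j) := fun i j =>
    (weakPartial_congr hD ((H₁ i).congr (q₁ i).symm) (q₁ i)).trans
      (weakPartial_ae_eq hD (l₂ (i, j)) (p₂ i j))
  refine ⟨⟨⟨l₀ (), fun i => ⟨_, l₁ i, p₁ i⟩⟩, fun i => (H₁ i).congr (q₁ i).symm⟩, ?_⟩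
  have r₁ : ∀ i, normL2 D (weakPartial D i (superpose ν e Q₀)) = normL2 D (superpose ν e (Q₁ i)) :=
    fun i => normL2_congr (q₁ i)
  have r₂ : ∀ i j, normL2 D (weakPartial D j (weakPartial D i (superpose ν e Q₀)))
      = normL2 D (superpose ν e (Q₂ i j)) := fun i j => normL2_congr (q₂ i j)
  rw [normH2]
  simp only [r₁, r₂]
  simp only [Finset.univ_unique, Finset.sum_singleton, Fintype.sum_prod_type,
    abs_of_nonneg (hB₀ _), abs_of_nonneg (hB₁ _), abs_of_nonneg (hB₂ _)] at n₀ n₁ n₂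
  have sq : ∀ a b : ℝ, 0 ≤ a → 0 ≤ b → √(a + b) ≤ √a + √b := fun a b ha hb => by
    refine Real.sqrt_le_iff.2 ⟨by positivity, ?_⟩
    nlinarith [Real.sq_sqrt ha, Real.sq_sqrt hb, Real.sqrt_nonneg a, Real.sqrt_nonneg b,
      mul_nonneg (Real.sqrt_nonneg a) (Real.sqrt_nonneg b)]
  exact (sq _ _ (by positivity) (by positivity)).trans (add_le_add
    ((sq _ _ (by positivity) (by positivity)).trans (add_le_add n₀ n₁)) n₂)

/-- The superposition of a difference. -/
theorem superpose_sub_ae_eq [SFinite ν] (he : Measurable e) (he1 : ∀ ξ, ‖e ξ‖ ≤ 1)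
    {Q R : Ξ → Sp d → ℝ} {B B' : Ξ → ℝ} (h : IsSquareBounded D ν Q B)
    (h' : IsSquareBounded D ν R B') :
    superpose ν e (fun ξ x => Q ξ x - R ξ x) =ᵐ[volume.restrict D]
      superpose ν e Q - superpose ν e R := by
  filter_upwards [h.ae_integrable, h'.ae_integrable] with x hx hx'
  have hi : ∀ {g : Ξ → ℝ}, Integrable g ν → Integrable (fun ξ => g ξ • e ξ) ν := fun hg =>
    hg.norm.mono' (hg.1.smul he.aestronglyMeasurable) (Eventually.of_forall fun ξ => by
      rw [norm_smul]; exact mul_le_of_le_one_right (norm_nonneg _) (he1 ξ))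
  simp only [superpose, Pi.sub_apply, sub_smul]
  exact integral_sub (hi hx) (hi hx')

end
end Peridynamics

namespace Peridynamics
noncomputable section
variable {d : ℕ} {D : Set (Sp d)}

/-! ### The force as a superposition over bonds -/

/-- The density of the bond measure. -/
def bondDensity (d : ℕ) (J : ℝ → ℝ) (ε : ℝ) (ξ : Sp d) : ℝ :=
  2 / unitBallVol d * (J ‖ξ‖ / (ε * √(ε * ‖ξ‖)))

/-- The measure on bonds over which the force is a superposition. -/
def bondMeasure (d : ℕ) (J : ℝ → ℝ) (ε : ℝ) : Measure (Sp d) :=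
  (volume.restrict (Metric.ball 0 1)).withDensity fun ξ => (bondDensity d J ε ξ).toNNReal

instance (J : ℝ → ℝ) (ε : ℝ) : SFinite (bondMeasure d J ε) := by
  unfold bondMeasure; infer_instance

theorem unitBallVol_pos (d : ℕ) : 0 < unitBallVol d :=
  ENNReal.toReal_pos (Metric.measure_ball_pos volume _ one_pos).ne' measure_ball_lt_top.ne

theorem IsInfluence.measurable_bondDensity {J : ℝ → ℝ} (hJ : IsInfluence J) (ε : ℝ) :
    Measurable (bondDensity d J ε) := by
  refine measurable_const.mul ((hJ.meas.comp measurable_norm).div (measurable_const.mul ?_))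
  exact Real.continuous_sqrt.measurable.comp (measurable_norm.const_mul ε)

theorem IsInfluence.bondDensity_nonneg {J : ℝ → ℝ} (hJ : IsInfluence J) {ε : ℝ} (hε : 0 < ε)
    (ξ : Sp d) : 0 ≤ bondDensity d J ε ξ := by
  have := hJ.nonneg _ (norm_nonneg ξ)
  have := unitBallVol_pos d
  unfold bondDensity
  positivity

theorem IsInfluence.integral_bondMeasure {J : ℝ → ℝ} (hJ : IsInfluence J) {ε : ℝ} (hε : 0 < ε)
    {E : Type*} [NormedAddCommGroup E] [NormedSpace ℝ E] (g : Sp d → E) :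
    ∫ ξ, g ξ ∂(bondMeasure d J ε) = ∫ ξ in Metric.ball 0 1, bondDensity d J ε ξ • g ξ := by
  rw [bondMeasure, integral_withDensity_eq_integral_smul (hJ.measurable_bondDensity ε).real_toNNReal]
  refine integral_congr_ae (Eventually.of_forall fun ξ => ?_)
  simp only [NNReal.smul_def, Real.coe_toNNReal _ (hJ.bondDensity_nonneg hε ξ)]

theorem IsInfluence.integrable_bondMeasure_iff {J : ℝ → ℝ} (hJ : IsInfluence J) {ε : ℝ}
    (hε : 0 < ε) (g : Sp d → ℝ) :
    Integrable g (bondMeasure d J ε) ↔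
      IntegrableOn (fun ξ => bondDensity d J ε ξ * g ξ) (Metric.ball 0 1) := by
  rw [bondMeasure, integrable_withDensity_iff_integrable_smul
    (hJ.measurable_bondDensity ε).real_toNNReal]
  simp only [NNReal.smul_def, Real.coe_toNNReal _ (hJ.bondDensity_nonneg hε _), smul_eq_mul]
  rfl

theorem ae_bondMeasure {J : ℝ → ℝ} {ε : ℝ} {p : Sp d → Prop} (h : ∀ ξ, ‖ξ‖ < 1 → p ξ) :
    ∀ᵐ ξ ∂(bondMeasure d J ε), p ξ := by
  refine (withDensity_absolutelyContinuous _ _).ae_le ?_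
  filter_upwards [ae_restrict_mem Metric.isOpen_ball.measurableSet] with ξ hξ
  exact h ξ (by simpa using hξ)

theorem setIntegral_ball_eq_smul {E : Type*} [NormedAddCommGroup E] [NormedSpace ℝ E]
    (g : Sp d → E) (x : Sp d) {ε : ℝ} (hε : 0 < ε) :
    ∫ y in Metric.ball x ε, g y = ε ^ d • ∫ ξ in Metric.ball 0 1, g (x + ε • ξ) := by
  have h1 := Measure.setIntegral_comp_smul_of_pos volume (fun z => g (x + z))
    (Metric.ball (0 : Sp d) 1) hε
  rw [h1, smul_unitBall_of_pos hε, finrank_euclideanSpace_fin, smul_smul, mul_inv_cancel₀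
    (pow_pos hε d).ne', one_smul]
  have h2 := (measurePreserving_add_left (volume : Measure (Sp d)) x).setIntegral_preimage_emb
    (measurableEmbedding_addLeft x) g (Metric.ball x ε)
  rw [← h2]
  congr 2
  ext z; simp

/-- Since f(s S²) = F(√s S) with bond length s, differentiation in S produces √s. It cancels half of
the factor 1/s in the potential and leaves the kernel of `bondDensity`. For ξ = 0 both sides vanish.
-/
theorem deriv_pairPotential_smul {f : ℝ → ℝ} (hf : IsPotential f) (J : ℝ → ℝ) (w : Sp d → ℝ)
    {ε : ℝ} (hε : 0 < ε) (g : Sp d → Sp d) (x ξ : Sp d) :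
    deriv (pairPotential f J w ε x (x + ε • ξ)) (strain g x (x + ε • ξ)) • bondDir x (x + ε • ξ)
      = (J ‖ξ‖ / (ε * √(ε * ‖ξ‖))) •
        (bondTerm f (omegaBar w ε ξ) (bondStrain ε ξ g) x • (‖ξ‖⁻¹ • ξ)) := by
  rcases eq_or_ne ξ 0 with rfl | hξ
  · simp [bondDir]
  have hn : 0 < ‖ξ‖ := norm_pos_iff.2 hξ
  have hdir : bondDir x (x + ε • ξ) = ‖ξ‖⁻¹ • ξ := by
    rw [bondDir, add_sub_cancel_left, norm_smul, Real.norm_of_nonneg hε.le, smul_smul]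
    congr 1; field_simp
  set s := ε * ‖ξ‖ with hs
  have hs0 : 0 < s := mul_pos hε hn
  have hq : 0 < √s := Real.sqrt_pos.2 hs0
  have hqq : √s * √s = s := Real.mul_self_sqrt hs0.le
  have hnorm : ‖x + ε • ξ - x‖ = s := by
    rw [add_sub_cancel_left, norm_smul, Real.norm_of_nonneg hε.le]
  have hstr : √s * strain g x (x + ε • ξ) = bondStrain ε ξ g x := by
    rw [strain, hdir, bondStrain, hnorm, real_inner_comm, inner_smul_right, ← hs]
    have : s⁻¹ = (√s)⁻¹ * (√s)⁻¹ := by rw [← mul_inv, hqq]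
    rw [this, ← mul_assoc, ← mul_assoc, mul_inv_cancel₀ hq.ne', one_mul]
  have hJ' : J (s / ε) = J ‖ξ‖ := by rw [hs, mul_div_cancel_left₀ _ hε.ne']
  have hfun : pairPotential f J w ε x (x + ε • ξ) = fun S =>
      omegaBar w ε ξ x * (J ‖ξ‖ / (ε * s)) * profile f 0 (√s * S) := by
    ext S
    rw [pairPotential, hnorm, hJ', omegaBar]
    simp only [profile, iteratedDeriv_zero, mul_pow, Real.sq_sqrt hs0.le]
  have hder : deriv (pairPotential f J w ε x (x + ε • ξ)) (strain g x (x + ε • ξ))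
      = omegaBar w ε ξ x * (J ‖ξ‖ / (ε * s)) * (profile f 1 (bondStrain ε ξ g x) * √s) := by
    rw [hfun, ← hstr]
    have h1 : HasDerivAt (fun S : ℝ => √s * S) (√s) (strain g x (x + ε • ξ)) := by
      simpa using (hasDerivAt_id (strain g x (x + ε • ξ))).const_mul (√s)
    exact (((hf.hasDerivAt_profile 0 _).comp _ h1).const_mul _).deriv
  rw [hder, hdir, smul_smul (J ‖ξ‖ / (ε * √s)), bondTerm]
  congr 1
  have : J ‖ξ‖ / (ε * s) * √s = J ‖ξ‖ / (ε * √s) := by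
    have h : ∀ q : ℝ, 0 < q → J ‖ξ‖ / (ε * (q * q)) * q = J ‖ξ‖ / (ε * q) := fun q hq => by
      field_simp
    simpa only [hqq] using h _ hq
  rw [← this]; ring

/-- After substituting y = x + εξ the factor ε^d cancels against the normalisation. The equality is
only almost everywhere because the Borel representative may differ from the zero extension on a null
set, both at x and at y. -/
theorem force_ae_eq {f J : ℝ → ℝ} (hf : IsPotential f) (hJ : IsInfluence J) (w : Sp d → ℝ)
    {ε : ℝ} (hε : 0 < ε) (hD : IsOpen D) {u : Sp d → Sp d} (hu : MemL2 D u) :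
    force D f J w ε u =ᵐ[volume.restrict D] superpose (bondMeasure d J ε) (fun ξ => ‖ξ‖⁻¹ • ξ)
      fun ξ => bondTerm f (omegaBar w ε ξ) (bondStrain ε ξ (zeroExt D u)) := by
  have hz := hu.zeroExt_ae_eq hD
  refine ae_restrict_of_ae ?_
  filter_upwards [hz] with x hx
  have h1 : ∫ y in Metric.ball x ε,
      deriv (pairPotential f J w ε x y) (strain (D.indicator u) x y) • bondDir x y
      = ∫ y in Metric.ball x ε,
        deriv (pairPotential f J w ε x y) (strain (zeroExt D u) x y) • bondDir x y := by
    refine integral_congr_ae (ae_restrict_of_ae ?_)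
    filter_upwards [hz] with y hy
    simp only [strain, hx, hy]
  rw [force, h1, setIntegral_ball_eq_smul _ x hε, superpose, hJ.integral_bondMeasure hε, smul_smul]
  simp only [deriv_pairPotential_smul hf J w hε]
  rw [← integral_smul]
  refine integral_congr_ae (Eventually.of_forall fun ξ => ?_)
  simp only [smul_smul, bondDensity]
  congr 1
  have := (pow_pos hε d).ne'
  have := (unitBallVol_pos d).ne'
  field_simp

end
end Peridynamics

namespace Peridynamics
noncomputable section
variable {d : ℕ} {D : Set (Sp d)}

/-! ### Frobenius norms of finite families -/

section Frobenius

variable {ι κ : Type*} [Fintype ι] [Fintype κ]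

/-- The Euclidean norm of a finite family of reals. -/
def frob (a : ι → ℝ) : ℝ := √(∑ i, a i ^ 2)

theorem frob_eq_norm (a : ι → ℝ) : frob a = ‖WithLp.toLp 2 a‖ := by
  rw [frob, EuclideanSpace.norm_eq]; simp

theorem frob_nonneg (a : ι → ℝ) : 0 ≤ frob a := Real.sqrt_nonneg _

theorem frob_add_le (a b : ι → ℝ) : frob (fun i => a i + b i) ≤ frob a + frob b := by
  simp only [frob_eq_norm]
  exact norm_add_le (WithLp.toLp 2 a) (WithLp.toLp 2 b)

theorem frob_const_mul (c : ℝ) (a : ι → ℝ) : frob (fun i => c * a i) = |c| * frob a := by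
  simp only [frob_eq_norm]
  exact norm_smul c (WithLp.toLp 2 a)

theorem frob_mono {a b : ι → ℝ} (h : ∀ i, |a i| ≤ b i) : frob a ≤ frob b :=
  Real.sqrt_le_sqrt (Finset.sum_le_sum fun i _ => by
    rw [← sq_abs]; exact pow_le_pow_left₀ (abs_nonneg _) (h i) 2)

theorem frob_tensor (a : ι → ℝ) (b : κ → ℝ) :
    frob (fun p : ι × κ => a p.1 * b p.2) = frob a * frob b := by
  simp only [frob, Fintype.sum_prod_type, mul_pow, ← Finset.mul_sum, ← Finset.sum_mul]
  exact Real.sqrt_mul (Finset.sum_nonneg fun i _ => sq_nonneg _) _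

theorem frob_tensor_swap (a : ι → ℝ) (b : κ → ℝ) :
    frob (fun p : ι × κ => b p.2 * a p.1) = frob a * frob b := by
  simp only [mul_comm (b _), frob_tensor]

theorem frob_mul_le {c C : ℝ} (h : |c| ≤ C) (a : ι → ℝ) : frob (fun i => c * a i) ≤ C * frob a := by
  rw [frob_const_mul]
  exact mul_le_mul_of_nonneg_right h (frob_nonneg _)

/-- The difference of two products, symmetrised. -/
theorem frob_mul_sub_mul_le {g g' C L : ℝ} (h : |g| ≤ C) (h' : |g'| ≤ C) (hL : |g - g'| ≤ L)
    (a b : ι → ℝ) : frob (fun i => g * a i - g' * b i)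
      ≤ 1 / 2 * L * (frob a + frob b) + C * frob fun i => a i - b i := by
  -- The symmetric splitting yields the mean of the two norms. A one-sided splitting would give a
  -- full norm and double the coefficient of the sum of the norms.
  have e : (fun i => g * a i - g' * b i) = fun i =>
      (1 / 2 * (g - g')) * (a i + b i) + (1 / 2 * (g + g')) * (a i - b i) := by ext i; ring
  rw [e]
  refine (frob_add_le _ _).trans (add_le_add ?_ (frob_mul_le ?_ _))
  · refine (frob_mul_le (C := 1 / 2 * L) ?_ _).trans ?_
    · rw [abs_mul, abs_of_nonneg (by norm_num : (0 : ℝ) ≤ 1 / 2)]; linarith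
    · have := (abs_nonneg _).trans hL
      exact mul_le_mul_of_nonneg_left (frob_add_le a b) (by positivity)
  · rw [abs_mul, abs_of_nonneg (by norm_num : (0 : ℝ) ≤ 1 / 2)]
    linarith [abs_add_le g g']

/-- The difference of the two squares is the symmetrised product of a - b and a + b, so no constant
is lost. -/
theorem frob_tensor_sub_le (a b : ι → ℝ) :
    frob (fun p : ι × ι => a p.2 * a p.1 - b p.2 * b p.1)
      ≤ frob (fun i => a i - b i) * (frob a + frob b) := by
  have e : (fun p : ι × ι => a p.2 * a p.1 - b p.2 * b p.1) = fun p =>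
      (1 / 2) * ((a p.1 - b p.1) * (a p.2 + b p.2)) + (1 / 2) * ((a p.1 + b p.1) * (a p.2 - b p.2)) := by
    ext p; ring
  rw [e]
  refine (frob_add_le _ _).trans ?_
  rw [frob_const_mul, frob_const_mul, frob_tensor (fun i => a i - b i) (fun i => a i + b i),
    frob_tensor (fun i => a i + b i) (fun i => a i - b i),
    abs_of_nonneg (by norm_num : (0 : ℝ) ≤ 1 / 2)]
  nlinarith [frob_add_le a b, frob_nonneg fun i => a i - b i]

end Frobenius

/-! ### Pointwise bounds for the bond terms -/

section Pointwise

variable {E : Set (Sp d)} {c₁ c₂ : ℝ} {η : Sp d → ℝ} {f : ℝ → ℝ} {A B : Sp d → ℝ}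
  {A₁ B₁ : Fin d → Sp d → ℝ} {A₂ B₂ : Fin d → Fin d → Sp d → ℝ} {x : Sp d}

theorem IsBondWeight.nonneg_grad (h : IsBondWeight D E c₁ c₂ η) (hx : x ∈ D) : 0 ≤ c₁ :=
  (Real.sqrt_nonneg _).trans (h.grad_le x hx)

theorem IsBondWeight.frob_grad_le (h : IsBondWeight D E c₁ c₂ η) (hx : x ∈ D) :
    frob (fun i => partialD i η x) ≤ c₁ := h.grad_le x hx

theorem IsBondWeight.frob_hess_le (h : IsBondWeight D E c₁ c₂ η) (hx : x ∈ D) :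
    frob (fun p : Fin d × Fin d => partialD p.2 (partialD p.1 η) x) ≤ c₂ := by
  simpa [frob, Fintype.sum_prod_type] using h.hess_le x hx

theorem abs_bondTerm_le (hf : IsPotential f) (hη : IsBondWeight D E c₁ c₂ η) :
    |bondTerm f η A x| ≤ supDeriv f 2 * |A x| := by
  rw [bondTerm, abs_mul]
  exact (mul_le_of_le_one_left (abs_nonneg _) (hη.abs_le x)).trans (hf.abs_profile_one_le _)

theorem frob_bondTermD_le (hf : IsPotential f) (hη : IsBondWeight D E c₁ c₂ η) (hx : x ∈ D) :
    frob (fun i => bondTermD f η A A₁ i x)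
      ≤ c₁ * (supDeriv f 2 * |A x|) + supDeriv f 2 * frob fun i => A₁ i x := by
  refine (frob_add_le _ _).trans (add_le_add ?_ ?_)
  · simp only [mul_comm (partialD _ η x)]
    rw [frob_const_mul, mul_comm]
    have := hη.nonneg_grad hx
    exact mul_le_mul (hη.frob_grad_le hx) (hf.abs_profile_one_le _) (abs_nonneg _) this
  · rw [frob_const_mul]
    refine (mul_le_of_le_one_left (frob_nonneg _) (hη.abs_le x)).trans ?_
    exact frob_mul_le (hf.abs_profile_le (by norm_num) (by norm_num) _) _

theorem frob_bondTermDD_le (hf : IsPotential f) (hη : IsBondWeight D E c₁ c₂ η) (hx : x ∈ D) :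
    frob (fun p : Fin d × Fin d => bondTermDD f η A A₁ A₂ p.1 p.2 x)
      ≤ c₂ * (supDeriv f 2 * |A x|) + 2 * c₁ * (supDeriv f 2 * frob fun i => A₁ i x)
        + (supDeriv f 3 * ((frob fun i => A₁ i x) * frob fun i => A₁ i x)
          + supDeriv f 2 * frob fun p : Fin d × Fin d => A₂ p.1 p.2 x) := by
  have hc := hη.nonneg_grad hx
  have h2 := hf.abs_profile_le (k := 2) (by norm_num) (by norm_num) (A x)
  have h3 := hf.abs_profile_le (k := 3) (by norm_num) (by norm_num) (A x)
  have s2 := supDeriv_nonneg f 2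
  have t1 : frob (fun p : Fin d × Fin d => partialD p.2 (partialD p.1 η) x * profile f 1 (A x))
      ≤ c₂ * (supDeriv f 2 * |A x|) := by
    simp only [mul_comm (partialD _ _ x)]
    rw [frob_const_mul, mul_comm]
    exact mul_le_mul (hη.frob_hess_le hx) (hf.abs_profile_one_le _) (abs_nonneg _)
      ((frob_nonneg _).trans (hη.frob_hess_le hx))
  have g1 : frob (fun i => profile f 2 (A x) * A₁ i x) ≤ supDeriv f 2 * frob fun i => A₁ i x :=
    frob_mul_le h2 _
  have t2 : frob (fun p : Fin d × Fin d => partialD p.1 η x * (profile f 2 (A x) * A₁ p.2 x))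
      ≤ c₁ * (supDeriv f 2 * frob fun i => A₁ i x) := by
    rw [frob_tensor (fun i => partialD i η x) fun i => profile f 2 (A x) * A₁ i x]
    exact mul_le_mul (hη.frob_grad_le hx) g1 (frob_nonneg _) hc
  have t3 : frob (fun p : Fin d × Fin d => partialD p.2 η x * (profile f 2 (A x) * A₁ p.1 x))
      ≤ c₁ * (supDeriv f 2 * frob fun i => A₁ i x) := by
    rw [frob_tensor_swap (fun i => profile f 2 (A x) * A₁ i x) fun i => partialD i η x, mul_comm]
    exact mul_le_mul (hη.frob_grad_le hx) g1 (frob_nonneg _) hc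
  have t4 : frob (fun p : Fin d × Fin d =>
        η x * (profile f 3 (A x) * A₁ p.2 x * A₁ p.1 x + profile f 2 (A x) * A₂ p.1 p.2 x))
      ≤ supDeriv f 3 * ((frob fun i => A₁ i x) * frob fun i => A₁ i x)
          + supDeriv f 2 * frob fun p : Fin d × Fin d => A₂ p.1 p.2 x := by
    rw [frob_const_mul]
    refine (mul_le_of_le_one_left (frob_nonneg _) (hη.abs_le x)).trans ?_
    refine (frob_add_le _ _).trans (add_le_add ?_ (frob_mul_le h2 _))
    simp only [mul_assoc]
    refine (frob_mul_le h3 _).trans_eq ?_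
    rw [frob_tensor_swap (fun i => A₁ i x) fun i => A₁ i x]
  have u1 := frob_add_le (fun p : Fin d × Fin d => partialD p.2 (partialD p.1 η) x * profile f 1 (A x))
    fun p => partialD p.1 η x * (profile f 2 (A x) * A₁ p.2 x)
  have u2 := frob_add_le (fun p : Fin d × Fin d => partialD p.2 η x * (profile f 2 (A x) * A₁ p.1 x))
    fun p => η x * (profile f 3 (A x) * A₁ p.2 x * A₁ p.1 x + profile f 2 (A x) * A₂ p.1 p.2 x)
  refine (frob_add_le _ _).trans ((add_le_add u1 u2).trans ?_)
  linarith

theorem abs_bondTerm_sub_le (hf : IsPotential f) (hη : IsBondWeight D E c₁ c₂ η) :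
    |bondTerm f η A x - bondTerm f η B x| ≤ supDeriv f 2 * |A x - B x| := by
  rw [bondTerm, bondTerm, ← mul_sub, abs_mul]
  exact (mul_le_of_le_one_left (abs_nonneg _) (hη.abs_le x)).trans
    (hf.abs_profile_sub_le (by norm_num) _ _)

/-- The common bound for the differences of the terms `F''(A) ∂A`. -/
theorem frob_profile_two_sub_le (hf : IsPotential f) (a b : ℝ) {ι : Type*} [Fintype ι]
    (v v' : ι → ℝ) :
    frob (fun i => profile f 2 a * v i - profile f 2 b * v' i)
      ≤ 1 / 2 * (supDeriv f 3 * |a - b|) * (frob v + frob v')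
        + supDeriv f 2 * frob fun i => v i - v' i :=
  frob_mul_sub_mul_le (hf.abs_profile_le (by norm_num) (by norm_num) _)
    (hf.abs_profile_le (by norm_num) (by norm_num) _) (hf.abs_profile_sub_le (by norm_num) _ _) _ _

theorem frob_bondTermD_sub_le (hf : IsPotential f) (hη : IsBondWeight D E c₁ c₂ η) (hx : x ∈ D) :
    frob (fun i => bondTermD f η A A₁ i x - bondTermD f η B B₁ i x)
      ≤ c₁ * (supDeriv f 2 * |A x - B x|)
        + (1 / 2 * (supDeriv f 3 * |A x - B x|) * ((frob fun i => A₁ i x) + frob fun i => B₁ i x)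
          + supDeriv f 2 * frob fun i => A₁ i x - B₁ i x) := by
  have e : (fun i => bondTermD f η A A₁ i x - bondTermD f η B B₁ i x) = fun i =>
      (profile f 1 (A x) - profile f 1 (B x)) * partialD i η x
        + η x * (profile f 2 (A x) * A₁ i x - profile f 2 (B x) * B₁ i x) := by
    ext i; simp only [bondTermD]; ring
  rw [e]
  refine (frob_add_le _ _).trans (add_le_add ?_ ?_)
  · rw [frob_const_mul, mul_comm]
    exact mul_le_mul (hη.frob_grad_le hx) (hf.abs_profile_sub_le (by norm_num) _ _) (abs_nonneg _)
      (hη.nonneg_grad hx)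
  · rw [frob_const_mul]
    exact (mul_le_of_le_one_left (frob_nonneg _) (hη.abs_le x)).trans
      (frob_profile_two_sub_le hf _ _ _ _)

/-- Every term pairs a coefficient difference or a strain difference with bounded factors. The one
product of three strain factors is the difference of third profile derivatives times ∇A ⊗ ∇A; it
carries C₄ and is the origin of the quadratic dependence on the norms. -/
theorem frob_bondTermDD_sub_le (hf : IsPotential f) (hη : IsBondWeight D E c₁ c₂ η) (hx : x ∈ D) :
    frob (fun p : Fin d × Fin d =>
        bondTermDD f η A A₁ A₂ p.1 p.2 x - bondTermDD f η B B₁ B₂ p.1 p.2 x)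
      ≤ c₂ * (supDeriv f 2 * |A x - B x|)
        + 2 * c₁ * (1 / 2 * (supDeriv f 3 * |A x - B x|)
            * ((frob fun i => A₁ i x) + frob fun i => B₁ i x)
          + supDeriv f 2 * frob fun i => A₁ i x - B₁ i x)
        + ((1 / 2 * (supDeriv f 4 * |A x - B x|) * ((frob fun i => A₁ i x) * (frob fun i => A₁ i x)
              + (frob fun i => B₁ i x) * frob fun i => B₁ i x)
            + supDeriv f 3 * ((frob fun i => A₁ i x - B₁ i x)
              * ((frob fun i => A₁ i x) + frob fun i => B₁ i x)))
          + (1 / 2 * (supDeriv f 3 * |A x - B x|) * ((frob fun p : Fin d × Fin d => A₂ p.1 p.2 x)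
              + frob fun p : Fin d × Fin d => B₂ p.1 p.2 x)
            + supDeriv f 2 * frob fun p : Fin d × Fin d => A₂ p.1 p.2 x - B₂ p.1 p.2 x)) := by
  have hc := hη.nonneg_grad hx
  have s3 := supDeriv_nonneg f 3
  have e : (fun p : Fin d × Fin d =>
        bondTermDD f η A A₁ A₂ p.1 p.2 x - bondTermDD f η B B₁ B₂ p.1 p.2 x) = fun p =>
      ((profile f 1 (A x) - profile f 1 (B x)) * partialD p.2 (partialD p.1 η) x
        + partialD p.1 η x * (profile f 2 (A x) * A₁ p.2 x - profile f 2 (B x) * B₁ p.2 x))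
      + (partialD p.2 η x * (profile f 2 (A x) * A₁ p.1 x - profile f 2 (B x) * B₁ p.1 x)
        + η x * ((profile f 3 (A x) * (A₁ p.2 x * A₁ p.1 x)
            - profile f 3 (B x) * (B₁ p.2 x * B₁ p.1 x))
          + (profile f 2 (A x) * A₂ p.1 p.2 x - profile f 2 (B x) * B₂ p.1 p.2 x))) := by
    ext p; simp only [bondTermDD]; ring
  rw [e]
  have t1 : frob (fun p : Fin d × Fin d =>
        (profile f 1 (A x) - profile f 1 (B x)) * partialD p.2 (partialD p.1 η) x)
      ≤ c₂ * (supDeriv f 2 * |A x - B x|) := by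
    rw [frob_const_mul, mul_comm]
    exact mul_le_mul (hη.frob_hess_le hx) (hf.abs_profile_sub_le (by norm_num) _ _) (abs_nonneg _)
      ((frob_nonneg _).trans (hη.frob_hess_le hx))
  have g1 := frob_profile_two_sub_le hf (A x) (B x) (fun i => A₁ i x) fun i => B₁ i x
  have t2 := (frob_tensor (fun i => partialD i η x) fun i =>
    profile f 2 (A x) * A₁ i x - profile f 2 (B x) * B₁ i x).trans_le
      (mul_le_mul (hη.frob_grad_le hx) g1 (frob_nonneg _) hc)
  have t3 := ((frob_tensor_swap (fun i =>
    profile f 2 (A x) * A₁ i x - profile f 2 (B x) * B₁ i x) fun i => partialD i η x).trans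
      (mul_comm _ _)).trans_le (mul_le_mul (hη.frob_grad_le hx) g1 (frob_nonneg _) hc)
  have g2 := frob_profile_two_sub_le hf (A x) (B x) (fun p : Fin d × Fin d => A₂ p.1 p.2 x)
    fun p : Fin d × Fin d => B₂ p.1 p.2 x
  have g3 := frob_mul_sub_mul_le (hf.abs_profile_le (k := 3) (by norm_num) (by norm_num) (A x))
    (hf.abs_profile_le (by norm_num) (by norm_num) (B x))
    (hf.abs_profile_sub_le (by norm_num) (A x) (B x))
    (fun p : Fin d × Fin d => A₁ p.2 x * A₁ p.1 x) fun p => B₁ p.2 x * B₁ p.1 x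
  rw [frob_tensor_swap (fun i => A₁ i x) fun i => A₁ i x,
    frob_tensor_swap (fun i => B₁ i x) fun i => B₁ i x] at g3
  have g4 := mul_le_mul_of_nonneg_left (frob_tensor_sub_le (fun i => A₁ i x) fun i => B₁ i x) s3
  have t4 := (frob_const_mul (η x) fun p : Fin d × Fin d =>
      (profile f 3 (A x) * (A₁ p.2 x * A₁ p.1 x) - profile f 3 (B x) * (B₁ p.2 x * B₁ p.1 x))
        + (profile f 2 (A x) * A₂ p.1 p.2 x - profile f 2 (B x) * B₂ p.1 p.2 x)).trans_le
    ((mul_le_of_le_one_left (frob_nonneg _) (hη.abs_le x)).trans (frob_add_le _ _))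
  refine (frob_add_le _ _).trans ((add_le_add (frob_add_le _ _) (frob_add_le _ _)).trans ?_)
  refine (add_le_add (add_le_add t1 t2) (add_le_add t3 t4)).trans ?_
  linarith

end Pointwise

end
end Peridynamics

namespace Peridynamics
noncomputable section
variable {d : ℕ} {D : Set (Sp d)}

/-! ### The boundary function as a bond weight -/

/-- The functional is evaluated at its own gradient vector. The Euclidean norm of the gradient thus
meets the operator norm bound without a dimensional factor. -/
theorem frob_apply_basisVec_le (L : Sp d →L[ℝ] ℝ) : frob (fun i => L (basisVec i)) ≤ ‖L‖ := by
  set v : Sp d := WithLp.toLp 2 fun i => L (basisVec i) with hv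
  have hvn : ‖v‖ = frob fun i => L (basisVec i) := (frob_eq_norm _).symm
  have hL : L v = ‖v‖ ^ 2 := by
    have h1 : v = ∑ i, L (basisVec i) • basisVec i := by
      ext j
      simp [hv, basisVec, Finset.sum_apply, Pi.single_apply]
    conv_lhs => rw [h1]
    rw [map_sum, hvn, frob, Real.sq_sqrt (Finset.sum_nonneg fun _ _ => sq_nonneg _)]
    simp [sq]
  have h2 : ‖v‖ ^ 2 ≤ ‖L‖ * ‖v‖ := by
    rw [← hL]; exact (le_abs_self _).trans (L.le_opNorm v)
  rw [← hvn]
  rcases (norm_nonneg v).eq_or_lt with h0 | h0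
  · rw [← h0]; exact norm_nonneg _
  · nlinarith

namespace IsBoundaryFunction

variable {ε c₁ c₂ : ℝ} {w : Sp d → ℝ}

theorem isBondWeight (h : IsBoundaryFunction D ε c₁ c₂ w) (hD : IsOpen D) {ξ : Sp d}
    (hξ : ‖ξ‖ < 1) :
    IsBondWeight D (D ∩ (· + ε • ξ) ⁻¹' D) c₁ c₂ (omegaBar w ε ξ) where
  smooth := h.smooth ξ hξ
  nonneg x := mul_nonneg (h.nonneg _) (h.nonneg _)
  le_one x := mul_le_one₀ (h.le_one _) (h.nonneg _) (h.le_one _)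
  eq_zero x hx hxE := by
    have : x + ε • ξ ∉ D := fun hx' => hxE ⟨hx, hx'⟩
    rw [omegaBar, h.eq_zero _ this, mul_zero]
  grad_le x hx := (frob_apply_basisVec_le _).trans (h.grad_le ξ hξ x hx)
  hess_le x hx := by
    refine le_of_eq_of_le ?_ (h.hess_le ξ hξ x hx)
    have hd : DifferentiableAt ℝ (fderiv ℝ (omegaBar w ε ξ)) x :=
      ((((h.smooth ξ hξ).fderiv_of_isOpen (m := 1) hD (by norm_num)).differentiableOn
        (by norm_num)) x hx).differentiableAt (hD.mem_nhds hx)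
    -- The indices come out in reverse order. Exchanging the two finite sums repairs this, so
    -- symmetry of the second derivative is not needed.
    have e : ∀ i j, partialD j (partialD i (omegaBar w ε ξ)) x
        = iteratedFDeriv ℝ 2 (omegaBar w ε ξ) x ![basisVec j, basisVec i] := by
      intro i j
      rw [iteratedFDeriv_two_apply]
      have := (hd.hasFDerivAt.clm_apply (hasFDerivAt_const (basisVec i) x)).fderiv
      change fderiv ℝ (fun y => fderiv ℝ (omegaBar w ε ξ) y (basisVec i)) x (basisVec j) = _
      rw [this]
      simp
    simp only [e]
    rw [Finset.sum_comm]

theorem continuous_omegaBar (h : IsBoundaryFunction D ε c₁ c₂ w) :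
    Continuous fun p : Sp d × Sp d => omegaBar w ε p.1 p.2 :=
  (h.cont.comp continuous_snd).mul
    (h.cont.comp (continuous_snd.add (continuous_fst.const_smul ε)))

theorem measurable_partialD (h : IsBoundaryFunction D ε c₁ c₂ w) (i : Fin d) :
    Measurable fun p : Sp d × Sp d => partialD i (omegaBar w ε p.1) p.2 :=
  measurable_fderiv_apply_const_with_param ℝ h.continuous_omegaBar (basisVec i)

/-- Joint continuity of ω̄ gives joint measurability of its first derivatives, but their joint
continuity is not known. The second derivatives are therefore obtained as pointwise limits of
difference quotients, on the set where they exist. -/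
theorem measurable_partialD_partialD (h : IsBoundaryFunction D ε c₁ c₂ w) (hD : IsOpen D)
    (i j : Fin d) :
    Measurable ((Metric.ball (0 : Sp d) 1 ×ˢ D).indicator
      fun p : Sp d × Sp d => partialD j (partialD i (omegaBar w ε p.1)) p.2) := by
  have hS : MeasurableSet (Metric.ball (0 : Sp d) 1 ×ˢ D) :=
    Metric.isOpen_ball.measurableSet.prod hD.measurableSet
  set q : ℕ → Sp d × Sp d → ℝ := fun n p => (n : ℝ) *
    (partialD i (omegaBar w ε p.1) (p.2 + (n : ℝ)⁻¹ • basisVec j)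
      - partialD i (omegaBar w ε p.1) p.2) with hq
  refine measurable_of_tendsto_metrizable
    (f := fun n => (Metric.ball (0 : Sp d) 1 ×ˢ D).indicator (q n)) (fun n => ?_) ?_
  · refine Measurable.indicator (measurable_const.mul (Measurable.sub ?_ (h.measurable_partialD i))) hS
    exact (h.measurable_partialD i).comp
      (measurable_fst.prodMk (measurable_snd.add measurable_const))
  · rw [tendsto_pi_nhds]
    intro p
    by_cases hp : p ∈ Metric.ball (0 : Sp d) 1 ×ˢ D
    · simp only [indicator_of_mem hp]
      have hw := h.isBondWeight hD (ξ := p.1) (by simpa using hp.1)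
      have hd : HasFDerivAt (partialD i (omegaBar w ε p.1))
          (fderiv ℝ (partialD i (omegaBar w ε p.1)) p.2) p.2 :=
        ((((hw.contDiffOn_partialD hD i).differentiableOn (by norm_num)) p.2
          hp.2).differentiableAt (hD.mem_nhds hp.2)).hasFDerivAt
      have := hd.lim_real (basisVec j)
      have h2 := this.comp (tendsto_natCast_atTop_atTop (R := ℝ))
      exact h2
    · simp only [indicator_of_notMem hp]
      exact tendsto_const_nhds

end IsBoundaryFunction

/-! ### Bond strains of elements of `W` -/

theorem measurable_bondStrain (ε : ℝ) {g : Sp d → Sp d} (hg : Measurable g) :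
    Measurable fun p : Sp d × Sp d => bondStrain ε p.1 g p.2 := by
  unfold bondStrain
  refine Measurable.mul ?_ (Measurable.inner ?_ ?_)
  · exact (Real.continuous_sqrt.measurable.comp (measurable_fst.norm.const_mul ε)).inv
  · exact measurable_fst.norm.inv.smul measurable_fst
  · exact (hg.comp (measurable_snd.add (measurable_fst.const_smul ε))).sub (hg.comp measurable_snd)

theorem norm_weakPartial_le_gradNorm (u : Sp d → Sp d) (i : Fin d) (x : Sp d) :
    ‖weakPartial D i u x‖ ≤ gradNorm D u x :=
  (le_abs_self _).trans (abs_le_sqrt_sum_sq (fun i => ‖weakPartial D i u x‖) i)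

theorem AreEmbeddingConstants.memLp_weakPartial {c₁ c₂ : ℝ≥0} (h : AreEmbeddingConstants D c₁ c₂)
    {u : Sp d → Sp d} (hu : MemW D u) (i : Fin d) :
    MemLp (weakPartial D i u) 4 (volume.restrict D) :=
  ⟨(hu.1.1.weakPartial_spec i).1.1, (eLpNorm_mono fun x => (norm_weakPartial_le_gradNorm u i x).trans
    (le_abs_self _)).trans_lt ((h u hu).2.trans_lt ENNReal.ofReal_lt_top)⟩

theorem memLp_zeroExt_of_memLp (hD : IsOpen D) {g : Sp d → Sp d} (hg : MemL2 D g) {p : ENNReal}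
    (hp : MemLp g p (volume.restrict D)) : MemLp (zeroExt D g) p volume :=
  (memLp_congr_ae (hg.zeroExt_ae_eq hD)).2 ((memLp_indicator_iff_restrict hD.measurableSet).2 hp)

theorem MemW.isBondStrain {c₁ c₂ : ℝ≥0} (h : AreEmbeddingConstants D c₁ c₂) (hD : IsOpen D)
    {u : Sp d → Sp d} (hu : MemW D u) (ε : ℝ) (ξ : Sp d) :
    IsBondStrain D (D ∩ (· + ε • ξ) ⁻¹' D) (bondStrain ε ξ (zeroExt D u))
      (fun i => bondStrain ε ξ (zeroExt D (weakPartial D i u)))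
      (fun i j => bondStrain ε ξ (zeroExt D (weakPartial D j (weakPartial D i u)))) where
  mem := (memLp_bondStrain ε ξ (hu.1.1.1.memLp_zeroExt hD)).restrict D
  mem₁ i := (memLp_bondStrain ε ξ ((hu.1.1.weakPartial_spec i).1.memLp_zeroExt hD)).restrict D
  mem₁' i := (memLp_bondStrain ε ξ (memLp_zeroExt_of_memLp hD (hu.1.1.weakPartial_spec i).1
    (h.memLp_weakPartial hu i))).restrict D
  mem₂ i j := (memLp_bondStrain ε ξ (((hu.1.2 i).weakPartial_spec j).1.memLp_zeroExt hD)).restrict D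
  weak₁ i := (hu.2.weakPartial_bondStrain hD i ε ξ).mono MeasurableSet.univ (subset_univ D)
  weak₂ i j := (hu.1.2 i).weakPartial_bondStrain hD j ε ξ

/-! ### Norm bounds for bond strains -/

/-- `g` is in `L^p(μ)` with norm at most `b`. -/
structure NormLe (p : ENNReal) (μ : Measure (Sp d)) (g : Sp d → ℝ) (b : ℝ) : Prop where
  meas : AEStronglyMeasurable g μ
  nonneg : 0 ≤ b
  le : eLpNorm g p μ ≤ ENNReal.ofReal b

namespace NormLe

variable {p : ENNReal} {μ : Measure (Sp d)} {g h : Sp d → ℝ} {a b : ℝ}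

theorem add (hg : NormLe p μ g a) (hh : NormLe p μ h b) (hp : 1 ≤ p) :
    NormLe p μ (fun x => g x + h x) (a + b) :=
  ⟨hg.meas.add hh.meas, add_nonneg hg.nonneg hh.nonneg, (eLpNorm_add_le hg.meas hh.meas hp).trans
    ((add_le_add hg.le hh.le).trans_eq (ENNReal.ofReal_add hg.nonneg hh.nonneg).symm)⟩

theorem const_mul (hg : NormLe p μ g a) {c : ℝ} (hc : 0 ≤ c) :
    NormLe p μ (fun x => c * g x) (c * a) :=
  ⟨hg.meas.const_mul c, mul_nonneg hc hg.nonneg, by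
    refine (eLpNorm_const_smul c g p μ).trans_le ?_
    rw [ENNReal.ofReal_mul hc, Real.enorm_of_nonneg hc]
    gcongr
    exact hg.le⟩

theorem mul {q r : ENNReal} [ENNReal.HolderTriple p q r] (hg : NormLe p μ g a)
    (hh : NormLe q μ h b) : NormLe r μ (fun x => g x * h x) (a * b) :=
  ⟨hg.meas.mul hh.meas, mul_nonneg hg.nonneg hh.nonneg, by
    refine (eLpNorm_smul_le_mul_eLpNorm (p := p) (q := q) (r := r) hh.meas hg.meas).trans ?_
    rw [ENNReal.ofReal_mul hg.nonneg]
    exact mul_le_mul' hg.le hh.le⟩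

theorem mono (hg : NormLe p μ g a) (hm : AEStronglyMeasurable h μ) (hle : ∀ᵐ x ∂μ, |h x| ≤ g x) :
    NormLe p μ h a :=
  ⟨hm, hg.nonneg, (eLpNorm_mono_ae (hle.mono fun _ hx => hx.trans (le_abs_self _))).trans hg.le⟩

theorem abs (hg : NormLe p μ g a) : NormLe p μ (fun x => |g x|) a :=
  ⟨hg.meas.norm, hg.nonneg, (eLpNorm_norm g).trans_le hg.le⟩

end NormLe

/-- The reciprocal square root of the bond length. -/
def bondScale (ε : ℝ) (ξ : Sp d) : ℝ := (√(ε * ‖ξ‖))⁻¹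

theorem bondScale_nonneg (ε : ℝ) (ξ : Sp d) : 0 ≤ bondScale ε ξ := inv_nonneg.2 (Real.sqrt_nonneg _)

theorem abs_bondStrain_le (ε : ℝ) (ξ : Sp d) (g : Sp d → Sp d) (x : Sp d) :
    |bondStrain ε ξ g x| ≤ bondScale ε ξ * ‖g (x + ε • ξ) - g x‖ := by
  rw [bondStrain, abs_mul, abs_of_nonneg (inv_nonneg.2 (Real.sqrt_nonneg _))]
  exact mul_le_mul_of_nonneg_left (abs_inner_le_norm_of_le_one (norm_direction_le_one ξ) _)
    (bondScale_nonneg ε ξ)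

theorem aestronglyMeasurable_bondStrain (ε : ℝ) (ξ : Sp d) {g : Sp d → Sp d}
    (hg : AEStronglyMeasurable g volume) : AEStronglyMeasurable (bondStrain ε ξ g) volume := by
  have h := hg.comp_measurePreserving (measurePreserving_add_right (volume : Measure (Sp d)) (ε • ξ))
  have h' : AEStronglyMeasurable (fun x => g (x + ε • ξ) - g x) volume := h.sub hg
  exact (aestronglyMeasurable_const.inner h').const_mul _

/-- The two endpoints of the bond contribute equally by translation invariance of Lebesgue measure,
whence the factor 2. The Euclidean norm is taken before integrating, so no factor counts components.
-/
theorem normLe_frob_bondStrain {ι : Type*} [Fintype ι] {p : ENNReal} (hp : 1 ≤ p) (ε : ℝ)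
    (ξ : Sp d) {g : ι → Sp d → Sp d} (hg : ∀ i, AEStronglyMeasurable (g i) volume) {b : ℝ}
    (hb : 0 ≤ b) (h : eLpNorm (fun x => frob fun i => ‖g i x‖) p volume ≤ ENNReal.ofReal b) :
    NormLe p (volume.restrict D) (fun x => frob fun i => bondStrain ε ξ (g i) x)
      (2 * bondScale ε ξ * b) := by
  set N : Sp d → ℝ := fun x => frob fun i => ‖g i x‖ with hN
  have frobm : ∀ a : ι → Sp d → ℝ, (∀ i, AEStronglyMeasurable (a i) volume) →
      AEStronglyMeasurable (fun x => frob fun i => a i x) volume := fun a ha => by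
    refine Real.continuous_sqrt.comp_aestronglyMeasurable ?_
    exact Finset.aestronglyMeasurable_fun_sum _ fun i _ => (ha i).pow 2
  have hmp := measurePreserving_add_right (volume : Measure (Sp d)) (ε • ξ)
  have h1 : NormLe p volume N b := ⟨frobm _ fun i => (hg i).norm, hb, h⟩
  have h2 : NormLe p volume (fun x => N (x + ε • ξ)) b :=
    ⟨h1.meas.comp_measurePreserving hmp, hb,
      (eLpNorm_comp_measurePreserving h1.meas hmp).trans_le h⟩
  have h3 := (h2.add h1 hp).const_mul (bondScale_nonneg ε ξ)
  have hm : AEStronglyMeasurable (fun x => frob fun i => bondStrain ε ξ (g i) x) volume :=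
    frobm _ fun i => aestronglyMeasurable_bondStrain ε ξ (hg i)
  have h4 := h3.mono hm (Eventually.of_forall fun x => by
    rw [abs_of_nonneg (frob_nonneg _)]
    refine (frob_mono (b := fun i => bondScale ε ξ * (‖g i (x + ε • ξ)‖ + ‖g i x‖)) fun i =>
      (abs_bondStrain_le ε ξ (g i) x).trans
        (mul_le_mul_of_nonneg_left (norm_sub_le _ _) (bondScale_nonneg ε ξ))).trans ?_
    rw [frob_const_mul, abs_of_nonneg (bondScale_nonneg ε ξ)]
    exact mul_le_mul_of_nonneg_left (frob_add_le _ _) (bondScale_nonneg ε ξ))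
  refine ⟨h4.meas.restrict, by have := bondScale_nonneg ε ξ; positivity,
    (eLpNorm_mono_measure _ Measure.restrict_le_self).trans (h4.le.trans_eq ?_)⟩
  congr 1; ring

theorem eLpNorm_frob_norm_le {ι : Type*} [Fintype ι] {G : ι → Sp d → Sp d}
    (hG : ∀ i, MemL2 D (G i)) {b : ℝ} (hb : 0 ≤ b) (h : ∑ i, normL2 D (G i) ^ 2 ≤ b ^ 2) :
    eLpNorm (fun x => frob fun i => ‖G i x‖) 2 (volume.restrict D) ≤ ENNReal.ofReal b := by
  have e1 : ∫⁻ x in D, ‖frob fun i => ‖G i x‖‖ₑ ^ 2 = ENNReal.ofReal (∑ i, normL2 D (G i) ^ 2) := by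
    have hp : ∀ x, ‖frob fun i => ‖G i x‖‖ₑ ^ 2 = ∑ i, ‖G i x‖ₑ ^ 2 := fun x => by
      rw [← enorm_pow, frob, Real.sq_sqrt (Finset.sum_nonneg fun _ _ => sq_nonneg _),
        Real.enorm_of_nonneg (Finset.sum_nonneg fun _ _ => sq_nonneg _),
        ENNReal.ofReal_sum_of_nonneg fun _ _ => sq_nonneg _]
      refine Finset.sum_congr rfl fun i _ => ?_
      rw [ENNReal.ofReal_pow (norm_nonneg _), ofReal_norm]
    simp only [hp]
    rw [lintegral_finsetSum' _ fun i _ => (hG i).1.enorm.pow_const 2,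
      ENNReal.ofReal_sum_of_nonneg fun _ _ => sq_nonneg _]
    refine Finset.sum_congr rfl fun i _ => ?_
    rw [normL2, ENNReal.ofReal_pow ENNReal.toReal_nonneg, ENNReal.ofReal_toReal (hG i).2.ne,
      eLpNorm_two_eq, ← ENNReal.rpow_two, ← ENNReal.rpow_mul]
    norm_num
  rw [eLpNorm_two_eq, e1]
  calc (ENNReal.ofReal (∑ i, normL2 D (G i) ^ 2)) ^ (1 / 2 : ℝ)
      ≤ (ENNReal.ofReal (b ^ 2)) ^ (1 / 2 : ℝ) := by gcongr
    _ = ENNReal.ofReal b := by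
      rw [ENNReal.ofReal_rpow_of_nonneg (sq_nonneg b) (by norm_num), ← Real.sqrt_eq_rpow,
        Real.sqrt_sq hb]

theorem eLpNorm_frob_indicator {ι : Type*} [Fintype ι] (hD : IsOpen D) {g G : ι → Sp d → Sp d}
    (h : ∀ i, g i =ᵐ[volume] D.indicator (G i)) (p : ENNReal) :
    eLpNorm (fun x => frob fun i => ‖g i x‖) p volume
      = eLpNorm (fun x => frob fun i => ‖G i x‖) p (volume.restrict D) := by
  rw [← eLpNorm_indicator_eq_eLpNorm_restrict hD.measurableSet]
  refine eLpNorm_congr_ae ?_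
  filter_upwards [ae_all_iff.2 h] with x hx
  simp only [hx]
  by_cases hxD : x ∈ D <;> simp [hxD, frob]

/-- Bounds for a scaled strain with its first and second derivatives, at bond scale `s`. -/
structure IsStrainBound (D : Set (Sp d)) (s c₁ c₂ U : ℝ) (A : Sp d → ℝ) (A₁ : Fin d → Sp d → ℝ)
    (A₂ : Fin d → Fin d → Sp d → ℝ) : Prop where
  sup : NormLe ⊤ (volume.restrict D) A (2 * s * (c₁ * U))
  zero : NormLe 2 (volume.restrict D) A (2 * s * U)
  one : NormLe 2 (volume.restrict D) (fun x => frob fun i => A₁ i x) (2 * s * U)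
  one_four : NormLe 4 (volume.restrict D) (fun x => frob fun i => A₁ i x) (2 * s * (c₂ * U))
  two : NormLe 2 (volume.restrict D) (fun x => frob fun p : Fin d × Fin d => A₂ p.1 p.2 x)
    (2 * s * U)

/-- Arbitrary almost everywhere representatives are admitted so that the lemma also covers
differences of zero extensions, which represent the zero extension of the difference only almost
everywhere. -/
theorem MemW.isStrainBound {c₁ c₂ : ℝ≥0} (h : AreEmbeddingConstants D c₁ c₂) (hD : IsOpen D)
    {u : Sp d → Sp d} (hu : MemW D u) (ε : ℝ) (ξ : Sp d) {g : Sp d → Sp d}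
    {g₁ : Fin d → Sp d → Sp d} {g₂ : Fin d → Fin d → Sp d → Sp d}
    (hg : g =ᵐ[volume] D.indicator u) (hg₁ : ∀ i, g₁ i =ᵐ[volume] D.indicator (weakPartial D i u))
    (hg₂ : ∀ i j, g₂ i j =ᵐ[volume] D.indicator (weakPartial D j (weakPartial D i u))) :
    IsStrainBound D (bondScale ε ξ) c₁ c₂ (normH2 D u) (bondStrain ε ξ g)
      (fun i => bondStrain ε ξ (g₁ i)) (fun i j => bondStrain ε ξ (g₂ i j)) := by
  have hU := normH2_nonneg D u
  have l₀ : MemL2 D u := hu.1.1.1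
  have l₁ : ∀ i, MemL2 D (weakPartial D i u) := fun i => (hu.1.1.weakPartial_spec i).1
  have l₂ : ∀ i j, MemL2 D (weakPartial D j (weakPartial D i u)) := fun i j =>
    ((hu.1.2 i).weakPartial_spec j).1
  have am : ∀ {k K : Sp d → Sp d}, MemL2 D K → k =ᵐ[volume] D.indicator K →
      AEStronglyMeasurable k volume := fun hK hk =>
    ((aestronglyMeasurable_indicator_iff hD.measurableSet).2 hK.1).congr hk.symm
  have p0 : 0 ≤ normL2 D u ^ 2 := sq_nonneg _
  have p1 : 0 ≤ ∑ i, normL2 D (weakPartial D i u) ^ 2 := Finset.sum_nonneg fun _ _ => sq_nonneg _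
  have p2 : 0 ≤ ∑ i, ∑ j, normL2 D (weakPartial D j (weakPartial D i u)) ^ 2 :=
    Finset.sum_nonneg fun _ _ => Finset.sum_nonneg fun _ _ => sq_nonneg _
  have hsq : normH2 D u ^ 2 = normL2 D u ^ 2 + ∑ i, normL2 D (weakPartial D i u) ^ 2
      + ∑ i, ∑ j, normL2 D (weakPartial D j (weakPartial D i u)) ^ 2 :=
    Real.sq_sqrt (add_nonneg (add_nonneg p0 p1) p2)
  have s₀ : (fun x => frob fun _ : Unit => bondStrain ε ξ g x) = fun x => |bondStrain ε ξ g x| := by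
    ext x; simp [frob, Real.sqrt_sq_eq_abs]
  have unabs : ∀ {p : ENNReal} {k : Sp d → ℝ} {b : ℝ}, AEStronglyMeasurable k (volume.restrict D) →
      NormLe p (volume.restrict D) (fun x => |k x|) b → NormLe p (volume.restrict D) k b :=
    fun hm hk => hk.mono hm (Eventually.of_forall fun _ => le_rfl)
  have m₀ : AEStronglyMeasurable (bondStrain ε ξ g) (volume.restrict D) :=
    (aestronglyMeasurable_bondStrain ε ξ (am l₀ hg)).restrict
  refine ⟨unabs m₀ ?_, unabs m₀ ?_, ?_, ?_, ?_⟩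
  · rw [← s₀]
    refine normLe_frob_bondStrain le_top ε ξ (fun _ => am l₀ hg) (by positivity) ?_
    rw [eLpNorm_frob_indicator hD (fun _ => hg)]
    refine le_trans (le_of_eq ?_) (h u hu).1
    simp only [frob, Finset.univ_unique, Finset.sum_singleton, Real.sqrt_sq_eq_abs, abs_norm]
    exact eLpNorm_norm u
  · rw [← s₀]
    refine normLe_frob_bondStrain (by norm_num) ε ξ (fun _ => am l₀ hg) hU ?_
    rw [eLpNorm_frob_indicator hD (fun _ => hg)]
    refine eLpNorm_frob_norm_le (fun _ => l₀) hU ?_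
    simp only [Finset.univ_unique, Finset.sum_singleton]
    linarith
  · refine normLe_frob_bondStrain (by norm_num) ε ξ (fun i => am (l₁ i) (hg₁ i)) hU ?_
    rw [eLpNorm_frob_indicator hD hg₁]
    exact eLpNorm_frob_norm_le l₁ hU (by linarith)
  · refine normLe_frob_bondStrain (by norm_num) ε ξ (fun i => am (l₁ i) (hg₁ i)) (by positivity) ?_
    rw [eLpNorm_frob_indicator hD hg₁]
    exact (h u hu).2
  · refine normLe_frob_bondStrain (g := fun p : Fin d × Fin d => g₂ p.1 p.2) (by norm_num) ε ξ
      (fun p => am (l₂ p.1 p.2) (hg₂ p.1 p.2)) hU ?_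
    rw [eLpNorm_frob_indicator hD (fun p : Fin d × Fin d => hg₂ p.1 p.2)]
    refine eLpNorm_frob_norm_le (G := fun p : Fin d × Fin d => weakPartial D p.2 (weakPartial D p.1 u))
      (fun p => l₂ p.1 p.2) hU ?_
    rw [Fintype.sum_prod_type]
    linarith

end
end Peridynamics

namespace Peridynamics
noncomputable section
variable {d : ℕ} {D : Set (Sp d)}

/-! ### `L²` bounds for the terms of one bond -/

instance : ENNReal.HolderTriple 4 4 2 := ⟨by
  rw [← two_mul, ← ENNReal.toReal_eq_toReal_iff' (by finiteness) (by finiteness)]; norm_num⟩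

theorem aestronglyMeasurable_frob {ι : Type*} [Fintype ι] {μ : Measure (Sp d)} {a : ι → Sp d → ℝ}
    (ha : ∀ i, AEStronglyMeasurable (a i) μ) :
    AEStronglyMeasurable (fun x => frob fun i => a i x) μ :=
  Real.continuous_sqrt.comp_aestronglyMeasurable
    (Finset.aestronglyMeasurable_fun_sum _ fun i _ => (ha i).pow 2)

section OneBond

variable {E : Set (Sp d)} {c₁ c₂ s k₁ k₂ U V W T : ℝ} {η : Sp d → ℝ} {f : ℝ → ℝ} {A B : Sp d → ℝ}
  {A₁ B₁ : Fin d → Sp d → ℝ} {A₂ B₂ : Fin d → Fin d → Sp d → ℝ}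

theorem IsBondStrain.memLp_bondTermDD (hA : IsBondStrain D E A A₁ A₂) (hf : IsPotential f)
    (hD : IsOpen D) (hη : IsBondWeight D E c₁ c₂ η) (i j : Fin d) :
    MemLp (bondTermDD f η A A₁ A₂ i j) 2 (volume.restrict D) :=
  (hA.memLp_bondTermDD_left hf hD hη i j).add (hA.memLp_bondTermDD_right hf hD hη i j)

theorem normLe_bondTerm (hf : IsPotential f) (hD : IsOpen D) (hη : IsBondWeight D E c₁ c₂ η)
    (hA : IsBondStrain D E A A₁ A₂) (bA : IsStrainBound D s k₁ k₂ U A A₁ A₂) :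
    NormLe 2 (volume.restrict D) (bondTerm f η A) (2 * supDeriv f 2 * U * s) := by
  have := (bA.zero.abs.const_mul (supDeriv_nonneg f 2)).mono (hA.memLp_bondTerm hf hD hη).1
    (Eventually.of_forall fun x => abs_bondTerm_le hf hη)
  convert this using 1; ring

theorem normLe_bondTermD (hf : IsPotential f) (hD : IsOpen D) (hc₁ : 0 ≤ c₁)
    (hη : IsBondWeight D E c₁ c₂ η) (hA : IsBondStrain D E A A₁ A₂)
    (bA : IsStrainBound D s k₁ k₂ U A A₁ A₂) :
    NormLe 2 (volume.restrict D) (fun x => frob fun i => bondTermD f η A A₁ i x)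
      ((c₁ + 1) * (2 * supDeriv f 2 * U) * s) := by
  have s2 := supDeriv_nonneg f 2
  have := (((bA.zero.abs.const_mul s2).const_mul hc₁).add (bA.one.const_mul s2)
    (by norm_num)).mono (aestronglyMeasurable_frob fun i => (hA.memLp_bondTermD hf hD hη i).1)
    ((ae_restrict_mem hD.measurableSet).mono fun x hx => by
      rw [abs_of_nonneg (frob_nonneg _)]; exact frob_bondTermD_le hf hη hx)
  convert this using 1; ring

theorem normLe_bondTermDD (hf : IsPotential f) (hD : IsOpen D) (hc₁ : 0 ≤ c₁) (hc₂ : 0 ≤ c₂)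
    (hη : IsBondWeight D E c₁ c₂ η) (hA : IsBondStrain D E A A₁ A₂)
    (bA : IsStrainBound D s k₁ k₂ U A A₁ A₂) :
    NormLe 2 (volume.restrict D)
      (fun x => frob fun p : Fin d × Fin d => bondTermDD f η A A₁ A₂ p.1 p.2 x)
      ((c₂ + 2 * c₁ + 1) * (2 * supDeriv f 2 * U) * s
        + 4 * supDeriv f 3 * k₂ ^ 2 * U ^ 2 * s ^ 2) := by
  have s2 := supDeriv_nonneg f 2
  have s3 := supDeriv_nonneg f 3
  have := ((((bA.zero.abs.const_mul s2).const_mul hc₂).add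
    ((bA.one.const_mul s2).const_mul (mul_nonneg zero_le_two hc₁)) (by norm_num)).add
    (((bA.one_four.mul bA.one_four (r := 2)).const_mul s3).add (bA.two.const_mul s2) (by norm_num))
    (by norm_num)).mono
    (aestronglyMeasurable_frob fun p : Fin d × Fin d => (hA.memLp_bondTermDD hf hD hη p.1 p.2).1)
    ((ae_restrict_mem hD.measurableSet).mono fun x hx => by
      rw [abs_of_nonneg (frob_nonneg _)]; exact frob_bondTermDD_le hf hη hx)
  convert this using 1; ring

theorem normLe_bondTerm_sub (hf : IsPotential f) (hD : IsOpen D) (hη : IsBondWeight D E c₁ c₂ η)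
    (hA : IsBondStrain D E A A₁ A₂) (hB : IsBondStrain D E B B₁ B₂)
    (bAB : IsStrainBound D s k₁ k₂ W (fun x => A x - B x) (fun i x => A₁ i x - B₁ i x)
      (fun i j x => A₂ i j x - B₂ i j x)) :
    NormLe 2 (volume.restrict D) (fun x => bondTerm f η A x - bondTerm f η B x)
      (2 * supDeriv f 2 * W * s) := by
  have := (bAB.zero.abs.const_mul (supDeriv_nonneg f 2)).mono
    ((hA.memLp_bondTerm hf hD hη).1.sub (hB.memLp_bondTerm hf hD hη).1)
    (Eventually.of_forall fun x => abs_bondTerm_sub_le hf hη)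
  convert this using 1
  · rfl
  · ring

theorem normLe_profile_two_sub {ι : Type*} [Fintype ι] {δ : Sp d → ℝ} {a b a' : ι → Sp d → ℝ}
    {M N₁ N₂ N₃ : ℝ} (f : ℝ → ℝ) (hδ : NormLe ⊤ (volume.restrict D) δ M)
    (ha : NormLe 2 (volume.restrict D) (fun x => frob fun i => a i x) N₁)
    (hb : NormLe 2 (volume.restrict D) (fun x => frob fun i => b i x) N₂)
    (ha' : NormLe 2 (volume.restrict D) (fun x => frob fun i => a' i x) N₃) :
    NormLe 2 (volume.restrict D) (fun x =>
      1 / 2 * (supDeriv f 3 * |δ x|) * ((frob fun i => a i x) + frob fun i => b i x)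
        + supDeriv f 2 * frob fun i => a' i x)
      (1 / 2 * (supDeriv f 3 * M) * (N₁ + N₂) + supDeriv f 2 * N₃) :=
  (((hδ.abs.const_mul (supDeriv_nonneg f 3)).const_mul (by norm_num)).mul
    (ha.add hb (by norm_num)) (r := 2)).add (ha'.const_mul (supDeriv_nonneg f 2)) (by norm_num)

theorem normLe_bondTermD_sub (hf : IsPotential f) (hD : IsOpen D) (hc₁ : 0 ≤ c₁)
    (hη : IsBondWeight D E c₁ c₂ η)
    (hA : IsBondStrain D E A A₁ A₂) (hB : IsBondStrain D E B B₁ B₂)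
    (bA : IsStrainBound D s k₁ k₂ U A A₁ A₂) (bB : IsStrainBound D s k₁ k₂ V B B₁ B₂)
    (bAB : IsStrainBound D s k₁ k₂ W (fun x => A x - B x) (fun i x => A₁ i x - B₁ i x)
      (fun i j x => A₂ i j x - B₂ i j x)) :
    NormLe 2 (volume.restrict D)
      (fun x => frob fun i => bondTermD f η A A₁ i x - bondTermD f η B B₁ i x)
      ((c₁ + 1) * (2 * supDeriv f 2 * W) * s
        + 2 * supDeriv f 3 * k₁ * W * (U + V) * s ^ 2) := by
  have := (((bAB.zero.abs.const_mul (supDeriv_nonneg f 2)).const_mul hc₁).add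
    (normLe_profile_two_sub f bAB.sup bA.one bB.one bAB.one) (by norm_num)).mono
    (aestronglyMeasurable_frob fun i =>
      (hA.memLp_bondTermD hf hD hη i).1.sub (hB.memLp_bondTermD hf hD hη i).1)
    ((ae_restrict_mem hD.measurableSet).mono fun x hx => by
      rw [abs_of_nonneg (frob_nonneg _)]; exact frob_bondTermD_sub_le hf hη hx)
  convert this using 1
  · rfl
  · ring

/-- The bound `T` for the strain difference is kept free in the term with the fourth profile
derivative. There the general bound would bring a third power of the bond scale, which need not be
integrable when d = 2. -/
theorem normLe_bondTermDD_sub (hf : IsPotential f) (hD : IsOpen D) (hc₁ : 0 ≤ c₁) (hc₂ : 0 ≤ c₂)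
    (hη : IsBondWeight D E c₁ c₂ η)
    (hA : IsBondStrain D E A A₁ A₂) (hB : IsBondStrain D E B B₁ B₂)
    (bA : IsStrainBound D s k₁ k₂ U A A₁ A₂) (bB : IsStrainBound D s k₁ k₂ V B B₁ B₂)
    (bAB : IsStrainBound D s k₁ k₂ W (fun x => A x - B x) (fun i x => A₁ i x - B₁ i x)
      (fun i j x => A₂ i j x - B₂ i j x))
    (hT : NormLe ⊤ (volume.restrict D) (fun x => A x - B x) T) :
    NormLe 2 (volume.restrict D) (fun x => frob fun p : Fin d × Fin d =>
        bondTermDD f η A A₁ A₂ p.1 p.2 x - bondTermDD f η B B₁ B₂ p.1 p.2 x)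
      ((c₂ + 2 * c₁ + 1) * (2 * supDeriv f 2 * W) * s
        + ((2 * c₁ + 1) * (2 * supDeriv f 3 * k₁ * W * (U + V))
          + 4 * supDeriv f 3 * k₂ ^ 2 * W * (U + V)) * s ^ 2
        + 2 * supDeriv f 4 * k₂ ^ 2 * (U ^ 2 + V ^ 2) * (s ^ 2 * T)) := by
  have s2 := supDeriv_nonneg f 2
  have s3 := supDeriv_nonneg f 3
  have s4 := supDeriv_nonneg f 4
  have h2c : 0 ≤ 2 * c₁ := mul_nonneg zero_le_two hc₁
  have q1 := (bAB.zero.abs.const_mul s2).const_mul hc₂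
  have q2 := (normLe_profile_two_sub f bAB.sup bA.one bB.one bAB.one).const_mul h2c
  have q3 := ((hT.abs.const_mul s4).const_mul (c := 1 / 2) (by norm_num)).mul
    ((bA.one_four.mul bA.one_four (r := 2)).add (bB.one_four.mul bB.one_four (r := 2))
      (by norm_num)) (r := 2)
  have q4 := ((bAB.one_four.mul (bA.one_four.add bB.one_four (by norm_num)) (r := 2)).const_mul s3)
  have q5 := normLe_profile_two_sub (a := fun (p : Fin d × Fin d) x => A₂ p.1 p.2 x)
    (b := fun (p : Fin d × Fin d) x => B₂ p.1 p.2 x)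
    (a' := fun (p : Fin d × Fin d) x => A₂ p.1 p.2 x - B₂ p.1 p.2 x) f bAB.sup bA.two bB.two bAB.two
  have := ((q1.add q2 (by norm_num)).add ((q3.add q4 (by norm_num)).add q5 (by norm_num))
    (by norm_num)).mono (aestronglyMeasurable_frob fun p : Fin d × Fin d =>
      (hA.memLp_bondTermDD hf hD hη p.1 p.2).1.sub (hB.memLp_bondTermDD hf hD hη p.1 p.2).1)
    ((ae_restrict_mem hD.measurableSet).mono fun x hx => by
      rw [abs_of_nonneg (frob_nonneg _)]; exact frob_bondTermDD_sub_le hf hη hx)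
  convert this using 1
  · rfl
  · ring

end OneBond

/-! ### Integrals of powers of the bond scale -/

section Scale

variable {J : ℝ → ℝ} {ε : ℝ}

/-- The density contributes one power of (ε|ξ|)^(-1/2) and every scale factor another. Hence k
factors lead to the exponent α = (k + 1)/2 in J̄ and to ε^(-1-α). -/
theorem bondDensity_mul_bondScale_pow (J : ℝ → ℝ) (hε : 0 < ε) (k : ℕ) {α : ℝ}
    (hα : α = (k + 1) / 2) (ξ : Sp d) :
    bondDensity d J ε ξ * bondScale ε ξ ^ k
      = 2 / unitBallVol d / (ε * ε ^ α) * (J ‖ξ‖ / ‖ξ‖ ^ α) := by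
  have hr : √(ε * ‖ξ‖) ^ (k + 1) = ε ^ α * ‖ξ‖ ^ α := by
    rw [← Real.mul_rpow hε.le (norm_nonneg _), Real.sqrt_eq_rpow, ← Real.rpow_natCast,
      ← Real.rpow_mul (mul_nonneg hε.le (norm_nonneg _)), hα]
    congr 1; push_cast; ring
  have : bondDensity d J ε ξ * bondScale ε ξ ^ k
      = 2 / unitBallVol d * (J ‖ξ‖ / (ε * √(ε * ‖ξ‖) ^ (k + 1))) := by
    simp only [bondDensity, bondScale, pow_succ, div_eq_mul_inv, mul_inv, inv_pow]; ring
  rw [this, hr]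
  simp only [div_eq_mul_inv, mul_inv]; ring

theorem IsInfluence.integrable_bondScale_pow (hJ : IsInfluence J) (hε : 0 < ε) (k : ℕ) {α : ℝ}
    (hα : α = (k + 1) / 2) (h : JbarFinite d J α) :
    Integrable (fun ξ => bondScale ε ξ ^ k) (bondMeasure d J ε) := by
  rw [hJ.integrable_bondMeasure_iff hε]
  simp only [bondDensity_mul_bondScale_pow J hε k hα]
  exact h.const_mul _

theorem IsInfluence.integral_bondScale_pow (hJ : IsInfluence J) (hε : 0 < ε) (k : ℕ) {α : ℝ}
    (hα : α = (k + 1) / 2) :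
    ∫ ξ, bondScale ε ξ ^ k ∂(bondMeasure d J ε) = 2 * Jbar d J α / (ε * ε ^ α) := by
  rw [hJ.integral_bondMeasure hε]
  simp only [smul_eq_mul, bondDensity_mul_bondScale_pow J hε k hα]
  rw [integral_const_mul, Jbar]
  ring

theorem IsInfluence.jbar_nonneg (hJ : IsInfluence J) (α : ℝ) : 0 ≤ Jbar d J α :=
  mul_nonneg (one_div_nonneg.2 (unitBallVol_pos d).le) (integral_nonneg fun ξ =>
    div_nonneg (hJ.nonneg _ (norm_nonneg ξ)) (Real.rpow_nonneg (norm_nonneg _) _))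

end Scale

end
end Peridynamics

namespace Peridynamics
noncomputable section
variable {d : ℕ} {D : Set (Sp d)}

/-! ### The families of bond terms of an element of `W` -/

/-- The integrand of the force of `u`. -/
def forceTerm (D : Set (Sp d)) (f : ℝ → ℝ) (w : Sp d → ℝ) (ε : ℝ) (u : Sp d → Sp d) (ξ : Sp d) :
    Sp d → ℝ :=
  bondTerm f (omegaBar w ε ξ) (bondStrain ε ξ (zeroExt D u))

/-- The first derivatives of `forceTerm`. -/
def forceTermD (D : Set (Sp d)) (f : ℝ → ℝ) (w : Sp d → ℝ) (ε : ℝ) (u : Sp d → Sp d) (i : Fin d)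
    (ξ : Sp d) : Sp d → ℝ :=
  bondTermD f (omegaBar w ε ξ) (bondStrain ε ξ (zeroExt D u))
    (fun i => bondStrain ε ξ (zeroExt D (weakPartial D i u))) i

/-- The second derivatives of `forceTerm` on `D`, for bonds in the unit ball. -/
def forceTermDD (D : Set (Sp d)) (f : ℝ → ℝ) (w : Sp d → ℝ) (ε : ℝ) (u : Sp d → Sp d)
    (i j : Fin d) (ξ x : Sp d) : ℝ :=
  (Metric.ball (0 : Sp d) 1 ×ˢ D).indicator (fun p : Sp d × Sp d =>
    bondTermDD f (omegaBar w ε p.1) (bondStrain ε p.1 (zeroExt D u))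
      (fun i => bondStrain ε p.1 (zeroExt D (weakPartial D i u)))
      (fun i j => bondStrain ε p.1 (zeroExt D (weakPartial D j (weakPartial D i u)))) i j p.2) (ξ, x)

section Measurability

variable {f : ℝ → ℝ} {w : Sp d → ℝ} {ε c₁ c₂ : ℝ} (u : Sp d → Sp d)

theorem IsPotential.measurable_profile_bondStrain (hf : IsPotential f) (k : ℕ) (ε : ℝ)
    (g : Sp d → Sp d) :
    Measurable fun p : Sp d × Sp d => profile f k (bondStrain ε p.1 (zeroExt D g) p.2) :=
  (hf.continuous_profile k).measurable.comp
    (measurable_bondStrain ε (stronglyMeasurable_zeroExt D g).measurable)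

theorem measurable_forceTerm (hf : IsPotential f) (hw : IsBoundaryFunction D ε c₁ c₂ w) :
    Measurable (Function.uncurry (forceTerm D f w ε u)) :=
  hw.continuous_omegaBar.measurable.mul (hf.measurable_profile_bondStrain 1 ε u)

theorem measurable_forceTermD (hf : IsPotential f) (hw : IsBoundaryFunction D ε c₁ c₂ w)
    (i : Fin d) : Measurable (Function.uncurry (forceTermD D f w ε u i)) :=
  ((hw.measurable_partialD i).mul (hf.measurable_profile_bondStrain 1 ε u)).add
    (hw.continuous_omegaBar.measurable.mul ((hf.measurable_profile_bondStrain 2 ε u).mul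
      (measurable_bondStrain ε (stronglyMeasurable_zeroExt D _).measurable)))

/-- Measurability of the second derivatives of the weight is known only after cutting off to ball ×
D. The indicator in the definition permits this cutoff to be inserted without changing the function.
-/
theorem measurable_forceTermDD (hf : IsPotential f) (hw : IsBoundaryFunction D ε c₁ c₂ w)
    (hD : IsOpen D) (i j : Fin d) : Measurable (Function.uncurry (forceTermDD D f w ε u i j)) := by
  have hS : MeasurableSet (Metric.ball (0 : Sp d) 1 ×ˢ D) :=
    Metric.isOpen_ball.measurableSet.prod hD.measurableSet
  have m0 := fun k => hf.measurable_profile_bondStrain (D := D) k ε u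
  have m1 := fun i => measurable_bondStrain ε
    (stronglyMeasurable_zeroExt D (weakPartial D i u)).measurable
  have m2 := measurable_bondStrain ε
    (stronglyMeasurable_zeroExt D (weakPartial D j (weakPartial D i u))).measurable
  have key : Function.uncurry (forceTermDD D f w ε u i j)
      = (Metric.ball (0 : Sp d) 1 ×ˢ D).indicator fun p : Sp d × Sp d =>
        ((Metric.ball (0 : Sp d) 1 ×ˢ D).indicator
            (fun p : Sp d × Sp d => partialD j (partialD i (omegaBar w ε p.1)) p.2) p
            * profile f 1 (bondStrain ε p.1 (zeroExt D u) p.2)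
          + partialD i (omegaBar w ε p.1) p.2
            * (profile f 2 (bondStrain ε p.1 (zeroExt D u) p.2)
              * bondStrain ε p.1 (zeroExt D (weakPartial D j u)) p.2))
        + (partialD j (omegaBar w ε p.1) p.2
            * (profile f 2 (bondStrain ε p.1 (zeroExt D u) p.2)
              * bondStrain ε p.1 (zeroExt D (weakPartial D i u)) p.2)
          + omegaBar w ε p.1 p.2
            * (profile f 3 (bondStrain ε p.1 (zeroExt D u) p.2)
                * bondStrain ε p.1 (zeroExt D (weakPartial D j u)) p.2
                * bondStrain ε p.1 (zeroExt D (weakPartial D i u)) p.2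
              + profile f 2 (bondStrain ε p.1 (zeroExt D u) p.2)
                * bondStrain ε p.1 (zeroExt D (weakPartial D j (weakPartial D i u))) p.2)) := by
    ext p
    by_cases hp : p ∈ Metric.ball (0 : Sp d) 1 ×ˢ D
    · simp only [Function.uncurry, forceTermDD, Prod.mk.eta, indicator_of_mem hp, bondTermDD]
    · simp only [Function.uncurry, forceTermDD, Prod.mk.eta, indicator_of_notMem hp]
  rw [key]
  refine Measurable.indicator ?_ hS
  exact (((hw.measurable_partialD_partialD hD i j).mul (m0 1)).add
    ((hw.measurable_partialD i).mul ((m0 2).mul (m1 j)))).add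
    (((hw.measurable_partialD j).mul ((m0 2).mul (m1 i))).add
      (hw.continuous_omegaBar.measurable.mul ((((m0 3).mul (m1 j)).mul (m1 i)).add
        ((m0 2).mul m2))))

theorem forceTermDD_eq {ξ : Sp d} (hξ : ‖ξ‖ < 1) {x : Sp d} (hx : x ∈ D) (i j : Fin d) :
    forceTermDD D f w ε u i j ξ x = bondTermDD f (omegaBar w ε ξ) (bondStrain ε ξ (zeroExt D u))
      (fun i => bondStrain ε ξ (zeroExt D (weakPartial D i u)))
      (fun i j => bondStrain ε ξ (zeroExt D (weakPartial D j (weakPartial D i u)))) i j x :=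
  indicator_of_mem (s := Metric.ball (0 : Sp d) 1 ×ˢ D) (a := (ξ, x))
    ⟨by simpa using hξ, hx⟩ _

theorem measurable_frob_uncurry {ι : Type*} [Fintype ι] {Q : ι → Sp d → Sp d → ℝ}
    (h : ∀ i, Measurable (Function.uncurry (Q i))) :
    Measurable (Function.uncurry fun ξ x => frob fun i => Q i ξ x) :=
  Real.continuous_sqrt.measurable.comp
    (Finset.measurable_fun_sum _ fun i _ => (h i).pow_const 2)

end Measurability

/-! ### H² estimates for the force of an element of W and for differences of forces -/

section Force

variable {f J : ℝ → ℝ} {w : Sp d → ℝ} {ε c₁ c₂ : ℝ} {k₁ k₂ : ℝ≥0} {u v : Sp d → Sp d}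

theorem MemW.isStrainBound_zeroExt (hk : AreEmbeddingConstants D k₁ k₂) (hD : IsOpen D)
    (hu : MemW D u) (ε : ℝ) (ξ : Sp d) :
    IsStrainBound D (bondScale ε ξ) k₁ k₂ (normH2 D u) (bondStrain ε ξ (zeroExt D u))
      (fun i => bondStrain ε ξ (zeroExt D (weakPartial D i u)))
      (fun i j => bondStrain ε ξ (zeroExt D (weakPartial D j (weakPartial D i u)))) :=
  hu.isStrainBound hk hD ε ξ (hu.1.1.1.zeroExt_ae_eq hD)
    (fun i => (hu.1.1.weakPartial_spec i).1.zeroExt_ae_eq hD)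
    fun i j => ((hu.1.2 i).weakPartial_spec j).1.zeroExt_ae_eq hD

theorem zeroExt_sub_ae_eq (hD : IsOpen D) {a b c : Sp d → Sp d} (ha : MemL2 D a) (hb : MemL2 D b)
    (h : c =ᵐ[volume.restrict D] a - b) :
    (fun x => zeroExt D a x - zeroExt D b x) =ᵐ[volume] D.indicator c := by
  have h' := (ae_restrict_iff' hD.measurableSet).1 h
  filter_upwards [ha.zeroExt_ae_eq hD, hb.zeroExt_ae_eq hD, h'] with x h1 h2 h3
  rw [h1, h2]
  by_cases hx : x ∈ D
  · simp [hx, h3 hx]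
  · simp [hx]

theorem bondStrain_sub (ε : ℝ) (ξ : Sp d) (g h : Sp d → Sp d) :
    bondStrain ε ξ (fun x => g x - h x) = fun x => bondStrain ε ξ g x - bondStrain ε ξ h x := by
  ext x
  simp only [bondStrain, ← mul_sub, ← inner_sub_right]
  congr 2; abel

/-- The strain is linear in the displacement, so its differences are the strain of u - v, which
again lies in `W`. -/
theorem MemW.isStrainBound_sub (hk : AreEmbeddingConstants D k₁ k₂) (hD : IsOpen D)
    (hu : MemW D u) (hv : MemW D v) (ε : ℝ) (ξ : Sp d) :
    IsStrainBound D (bondScale ε ξ) k₁ k₂ (normH2 D (u - v))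
      (fun x => bondStrain ε ξ (zeroExt D u) x - bondStrain ε ξ (zeroExt D v) x)
      (fun i x => bondStrain ε ξ (zeroExt D (weakPartial D i u)) x
        - bondStrain ε ξ (zeroExt D (weakPartial D i v)) x)
      (fun i j x => bondStrain ε ξ (zeroExt D (weakPartial D j (weakPartial D i u))) x
        - bondStrain ε ξ (zeroExt D (weakPartial D j (weakPartial D i v))) x) := by
  have := (hu.sub hD hv).isStrainBound hk hD ε ξ
    (zeroExt_sub_ae_eq hD hu.1.1.1 hv.1.1.1 EventuallyEq.rfl)
    (fun i => zeroExt_sub_ae_eq hD (hu.1.1.weakPartial_spec i).1 (hv.1.1.weakPartial_spec i).1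
      (weakPartial_sub hD hu.1.1 hv.1.1 i))
    (fun i j => zeroExt_sub_ae_eq hD ((hu.1.2 i).weakPartial_spec j).1
      ((hv.1.2 i).weakPartial_spec j).1 (weakPartial_weakPartial_sub hD hu.1 hv.1 i j))
  simpa only [bondStrain_sub] using this

theorem NormLe.eLpNorm_congr_le {p : ENNReal} {g h : Sp d → ℝ} {b : ℝ} (hD : IsOpen D)
    (hg : NormLe p (volume.restrict D) g b) (e : ∀ x ∈ D, h x = g x) :
    eLpNorm h p (volume.restrict D) ≤ ENNReal.ofReal b :=
  (eLpNorm_congr_ae ((ae_restrict_mem hD.measurableSet).mono e)).trans_le hg.le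

theorem memW_weak (hk : AreEmbeddingConstants D k₁ k₂) (hf : IsPotential f) (hD : IsOpen D)
    (hfin : volume D ≠ ⊤) (hw : IsBoundaryFunction D ε c₁ c₂ w) (hu : MemW D u) {ξ : Sp d}
    (hξ : ‖ξ‖ < 1) :
    (∀ i, IsWeakPartialScalar D i (forceTerm D f w ε u ξ) (forceTermD D f w ε u i ξ)) ∧
    ∀ i j, IsWeakPartialScalar D j (forceTermD D f w ε u i ξ) (forceTermDD D f w ε u i j ξ) := by
  have hA := hu.isBondStrain hk hD ε ξ
  have hη := hw.isBondWeight hD hξ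
  have hE : IsOpen (D ∩ (· + ε • ξ) ⁻¹' D) := hD.inter (hD.preimage (by fun_prop))
  exact ⟨hA.weakPartial_bondTerm hf hD hfin hη, fun i j =>
    (hA.weakPartial_bondTermD hf hD hE inter_subset_left hfin hη i j).congr EventuallyEq.rfl
      ((ae_restrict_mem hD.measurableSet).mono fun x hx => (forceTermDD_eq u hξ hx i j).symm)⟩

theorem memLp_forceTerms (hk : AreEmbeddingConstants D k₁ k₂) (hf : IsPotential f) (hD : IsOpen D)
    (hw : IsBoundaryFunction D ε c₁ c₂ w) (hu : MemW D u) {ξ : Sp d} (hξ : ‖ξ‖ < 1) :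
    MemLp (forceTerm D f w ε u ξ) 2 (volume.restrict D) ∧
    (∀ i, MemLp (forceTermD D f w ε u i ξ) 2 (volume.restrict D)) ∧
    ∀ i j, MemLp (forceTermDD D f w ε u i j ξ) 2 (volume.restrict D) := by
  have hA := hu.isBondStrain hk hD ε ξ
  have hη := hw.isBondWeight hD hξ
  exact ⟨hA.memLp_bondTerm hf hD hη, hA.memLp_bondTermD hf hD hη, fun i j =>
    (memLp_congr_ae ((ae_restrict_mem hD.measurableSet).mono fun x hx =>
      forceTermDD_eq u hξ hx i j)).2 (hA.memLp_bondTermDD hf hD hη i j)⟩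

theorem sqrt_sum_sum_eq_frob (a : Fin d → Fin d → ℝ) :
    √(∑ i, ∑ j, a i j ^ 2) = frob fun p : Fin d × Fin d => a p.1 p.2 := by
  rw [frob, Fintype.sum_prod_type]

theorem isSquareBounded_forceTerm (hk : AreEmbeddingConstants D k₁ k₂) (hf : IsPotential f)
    (hD : IsOpen D) (hw : IsBoundaryFunction D ε c₁ c₂ w) (hu : MemW D u)
    (i₁ : Integrable (bondScale ε) (bondMeasure d J ε)) :
    IsSquareBounded D (bondMeasure d J ε) (forceTerm D f w ε u)
      fun ξ => 2 * supDeriv f 2 * normH2 D u * bondScale ε ξ :=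
  ⟨measurable_forceTerm u hf hw, i₁.const_mul _, ae_bondMeasure fun ξ hξ =>
    (normLe_bondTerm hf hD (hw.isBondWeight hD hξ) (hu.isBondStrain hk hD ε ξ)
      (hu.isStrainBound_zeroExt hk hD ε ξ)).le⟩

theorem MemH2.congr (hD : IsOpen D) (hu : MemH2 D u) (h : u =ᵐ[volume.restrict D] v) :
    MemH2 D v :=
  ⟨hu.1.congr h, fun i => (hu.2 i).congr (weakPartial_congr hD hu.1 h)⟩

theorem normH2_congr (hD : IsOpen D) (hu : MemH2 D u) (h : u =ᵐ[volume.restrict D] v) :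
    normH2 D v = normH2 D u := by
  have h1 := fun i => weakPartial_congr hD (i := i) hu.1 h
  simp only [normH2, normL2_congr h, fun i => normL2_congr (h1 i),
    fun i j => normL2_congr (weakPartial_congr hD (i := j) (hu.2 i) (h1 i))]

/-- The force of an element of `W` is in `H²`, with a linear and quadratic bound. -/
theorem memH2_force (hk : AreEmbeddingConstants D k₁ k₂) (hf : IsPotential f) (hJ : IsInfluence J)
    (hε : 0 < ε) (hD : IsOpen D) (hfin : volume D ≠ ⊤) (hc₁ : 0 ≤ c₁) (hc₂ : 0 ≤ c₂)
    (hw : IsBoundaryFunction D ε c₁ c₂ w) (hu : MemW D u)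
    (i₁ : Integrable (bondScale ε) (bondMeasure d J ε))
    (i₂ : Integrable (fun ξ => bondScale ε ξ ^ 2) (bondMeasure d J ε)) :
    MemH2 D (force D f J w ε u) ∧ normH2 D (force D f J w ε u) ≤
      (3 + 3 * c₁ + c₂) * (2 * supDeriv f 2 * normH2 D u)
          * (∫ ξ, bondScale ε ξ ∂(bondMeasure d J ε))
        + 4 * supDeriv f 3 * k₂ ^ 2 * normH2 D u ^ 2
          * ∫ ξ, bondScale ε ξ ^ 2 ∂(bondMeasure d J ε) := by
  have hU := normH2_nonneg D u
  have s2 := supDeriv_nonneg f 2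
  have s3 := supDeriv_nonneg f 3
  have hs := bondScale_nonneg (d := d) ε
  have he : Measurable fun ξ : Sp d => ‖ξ‖⁻¹ • ξ := measurable_norm.inv.smul measurable_id
  -- The three orders contribute 1, c₁ + 1 and c₂ + 2c₁ + 1 to the coefficient of the linear part,
  -- hence 3 + 3c₁ + c₂. Only the second order has a quadratic part.
  have key := memH2_superpose hD he norm_direction_le_one
    (Q₁ := forceTermD D f w ε u) (Q₂ := forceTermDD D f w ε u)
    (B₁ := fun ξ => (c₁ + 1) * (2 * supDeriv f 2 * normH2 D u) * bondScale ε ξ)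
    (B₂ := fun ξ => (c₂ + 2 * c₁ + 1) * (2 * supDeriv f 2 * normH2 D u) * bondScale ε ξ
        + 4 * supDeriv f 3 * k₂ ^ 2 * normH2 D u ^ 2 * bondScale ε ξ ^ 2)
    (fun ξ => by have := hs ξ; positivity) (fun ξ => by have := hs ξ; positivity)
    (fun ξ => by have := hs ξ; positivity)
    (isSquareBounded_forceTerm hk hf hD hw hu i₁) (measurable_forceTermD u hf hw)
    ⟨measurable_frob_uncurry (measurable_forceTermD u hf hw), i₁.const_mul _,
      ae_bondMeasure fun ξ hξ => (normLe_bondTermD hf hD hc₁ (hw.isBondWeight hD hξ)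
        (hu.isBondStrain hk hD ε ξ) (hu.isStrainBound_zeroExt hk hD ε ξ)).le⟩
    (measurable_forceTermDD u hf hw hD)
    (by
      simp only [sqrt_sum_sum_eq_frob]
      exact ⟨measurable_frob_uncurry (Q := fun p : Fin d × Fin d => forceTermDD D f w ε u p.1 p.2)
          fun p => measurable_forceTermDD u hf hw hD p.1 p.2,
        (i₁.const_mul _).add (i₂.const_mul _), ae_bondMeasure fun ξ hξ =>
        (normLe_bondTermDD hf hD hc₁ hc₂ (hw.isBondWeight hD hξ) (hu.isBondStrain hk hD ε ξ)
          (hu.isStrainBound_zeroExt hk hD ε ξ)).eLpNorm_congr_le hD fun x hx => by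
            simp only [forceTermDD_eq u hξ hx]⟩)
    (ae_bondMeasure fun ξ hξ => (memW_weak hk hf hD hfin hw hu hξ).1)
    (ae_bondMeasure fun ξ hξ => (memW_weak hk hf hD hfin hw hu hξ).2)
  obtain ⟨m, le⟩ := key
  have hae : superpose (bondMeasure d J ε) (fun ξ => ‖ξ‖⁻¹ • ξ) (forceTerm D f w ε u)
      =ᵐ[volume.restrict D] force D f J w ε u := (force_ae_eq hf hJ w hε hD hu.1.1.1).symm
  refine ⟨m.congr hD hae, ?_⟩
  rw [normH2_congr hD m hae]
  refine le.trans_eq ?_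
  rw [integral_add (i₁.const_mul _) (i₂.const_mul _), integral_const_mul, integral_const_mul,
    integral_const_mul, integral_const_mul]
  ring

/-- The Lipschitz bound for the force, in terms of a bound `T` for the strain differences. -/
theorem normH2_force_sub_le (hk : AreEmbeddingConstants D k₁ k₂) (hf : IsPotential f)
    (hJ : IsInfluence J) (hε : 0 < ε) (hD : IsOpen D) (hfin : volume D ≠ ⊤) (hc₁ : 0 ≤ c₁)
    (hc₂ : 0 ≤ c₂) (hw : IsBoundaryFunction D ε c₁ c₂ w) (hu : MemW D u) (hv : MemW D v)
    {U V W : ℝ} (eU : normH2 D u = U) (eV : normH2 D v = V) (eW : normH2 D (u - v) = W)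
    (i₁ : Integrable (bondScale ε) (bondMeasure d J ε))
    (i₂ : Integrable (fun ξ => bondScale ε ξ ^ 2) (bondMeasure d J ε)) {T : Sp d → ℝ}
    (hT0 : ∀ ξ, 0 ≤ T ξ) (hT : ∀ ξ : Sp d, ‖ξ‖ < 1 → NormLe ⊤ (volume.restrict D)
      (fun x => bondStrain ε ξ (zeroExt D u) x - bondStrain ε ξ (zeroExt D v) x) (T ξ))
    (iT : Integrable (fun ξ => bondScale ε ξ ^ 2 * T ξ) (bondMeasure d J ε)) :
    normH2 D (force D f J w ε u - force D f J w ε v) ≤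
      (3 + 3 * c₁ + c₂) * (2 * supDeriv f 2 * W)
          * (∫ ξ, bondScale ε ξ ∂(bondMeasure d J ε))
        + ((2 * c₁ + 2) * (2 * supDeriv f 3 * k₁ * W * (U + V))
            + 4 * supDeriv f 3 * k₂ ^ 2 * W * (U + V))
          * (∫ ξ, bondScale ε ξ ^ 2 ∂(bondMeasure d J ε))
        + 2 * supDeriv f 4 * k₂ ^ 2 * (U ^ 2 + V ^ 2)
          * ∫ ξ, bondScale ε ξ ^ 2 * T ξ ∂(bondMeasure d J ε) := by
  have hU : 0 ≤ U := eU ▸ normH2_nonneg D u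
  have hV : 0 ≤ V := eV ▸ normH2_nonneg D v
  have hW : 0 ≤ W := eW ▸ normH2_nonneg D (u - v)
  have s2 := supDeriv_nonneg f 2
  have s3 := supDeriv_nonneg f 3
  have s4 := supDeriv_nonneg f 4
  have hs := bondScale_nonneg (d := d) ε
  have he : Measurable fun ξ : Sp d => ‖ξ‖⁻¹ • ξ := measurable_norm.inv.smul measurable_id
  have bu := fun ξ => hu.isBondStrain hk hD ε ξ
  have bv := fun ξ => hv.isBondStrain hk hD ε ξ
  have nu := fun ξ => eU ▸ hu.isStrainBound_zeroExt hk hD ε ξ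
  have nv := fun ξ => eV ▸ hv.isStrainBound_zeroExt hk hD ε ξ
  have nuv := fun ξ => eW ▸ hu.isStrainBound_sub hk hD hv ε ξ
  have m₀ : Measurable (Function.uncurry fun ξ x =>
      forceTerm D f w ε u ξ x - forceTerm D f w ε v ξ x) :=
    (measurable_forceTerm u hf hw).sub (measurable_forceTerm v hf hw)
  have m₁ : ∀ i, Measurable (Function.uncurry fun ξ x =>
      forceTermD D f w ε u i ξ x - forceTermD D f w ε v i ξ x) := fun i =>
    (measurable_forceTermD u hf hw i).sub (measurable_forceTermD v hf hw i)
  have m₂ : ∀ i j, Measurable (Function.uncurry fun ξ x =>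
      forceTermDD D f w ε u i j ξ x - forceTermDD D f w ε v i j ξ x) := fun i j =>
    (measurable_forceTermDD u hf hw hD i j).sub (measurable_forceTermDD v hf hw hD i j)
  have p₂ : ∀ ξ : Sp d, 0 ≤ (c₂ + 2 * c₁ + 1) * (2 * supDeriv f 2 * W) * bondScale ε ξ
      + ((2 * c₁ + 1) * (2 * supDeriv f 3 * k₁ * W * (U + V))
          + 4 * supDeriv f 3 * k₂ ^ 2 * W * (U + V)) * bondScale ε ξ ^ 2
      + 2 * supDeriv f 4 * k₂ ^ 2 * (U ^ 2 + V ^ 2) * (bondScale ε ξ ^ 2 * T ξ) := by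
    intro ξ
    have := hs ξ; have := hT0 ξ; positivity
  have h₀ : IsSquareBounded D (bondMeasure d J ε)
      (fun ξ x => forceTerm D f w ε u ξ x - forceTerm D f w ε v ξ x)
      fun ξ => 2 * supDeriv f 2 * W * bondScale ε ξ :=
    ⟨m₀, i₁.const_mul _, ae_bondMeasure fun ξ hξ =>
      (normLe_bondTerm_sub hf hD (hw.isBondWeight hD hξ) (bu ξ) (bv ξ) (nuv ξ)).le⟩
  have h₁ : IsSquareBounded D (bondMeasure d J ε)
      (fun ξ x => √(∑ i, (forceTermD D f w ε u i ξ x - forceTermD D f w ε v i ξ x) ^ 2))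
      fun ξ => (c₁ + 1) * (2 * supDeriv f 2 * W) * bondScale ε ξ
        + 2 * supDeriv f 3 * k₁ * W * (U + V) * bondScale ε ξ ^ 2 :=
    ⟨measurable_frob_uncurry m₁, (i₁.const_mul _).add (i₂.const_mul _), ae_bondMeasure fun ξ hξ =>
      (normLe_bondTermD_sub hf hD hc₁ (hw.isBondWeight hD hξ) (bu ξ) (bv ξ) (nu ξ) (nv ξ)
        (nuv ξ)).le⟩
  have h₂ : IsSquareBounded D (bondMeasure d J ε)
      (fun ξ x => √(∑ i, ∑ j,
        (forceTermDD D f w ε u i j ξ x - forceTermDD D f w ε v i j ξ x) ^ 2))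
      fun ξ => (c₂ + 2 * c₁ + 1) * (2 * supDeriv f 2 * W) * bondScale ε ξ
        + ((2 * c₁ + 1) * (2 * supDeriv f 3 * k₁ * W * (U + V))
            + 4 * supDeriv f 3 * k₂ ^ 2 * W * (U + V)) * bondScale ε ξ ^ 2
        + 2 * supDeriv f 4 * k₂ ^ 2 * (U ^ 2 + V ^ 2) * (bondScale ε ξ ^ 2 * T ξ) := by
    have hm := measurable_frob_uncurry (Q := fun (p : Fin d × Fin d) ξ x =>
      forceTermDD D f w ε u p.1 p.2 ξ x - forceTermDD D f w ε v p.1 p.2 ξ x) fun p => m₂ p.1 p.2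
    simp only [fun ξ x => sqrt_sum_sum_eq_frob
      fun i j => forceTermDD D f w ε u i j ξ x - forceTermDD D f w ε v i j ξ x]
    refine ⟨hm, ((i₁.const_mul _).add (i₂.const_mul _)).add (iT.const_mul _),
      ae_bondMeasure fun ξ hξ => ?_⟩
    refine (normLe_bondTermDD_sub hf hD hc₁ hc₂ (hw.isBondWeight hD hξ) (bu ξ) (bv ξ) (nu ξ) (nv ξ)
      (nuv ξ) (hT ξ hξ)).eLpNorm_congr_le hD fun x hx => ?_
    simp only [forceTermDD_eq _ hξ hx]
  have w₁ : ∀ᵐ ξ ∂(bondMeasure d J ε), ∀ i, IsWeakPartialScalar D i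
      (fun x => forceTerm D f w ε u ξ x - forceTerm D f w ε v ξ x)
      fun x => forceTermD D f w ε u i ξ x - forceTermD D f w ε v i ξ x :=
    ae_bondMeasure fun ξ hξ i => by
      obtain ⟨a0, a1, -⟩ := memLp_forceTerms hk hf hD hw hu hξ
      obtain ⟨b0, b1, -⟩ := memLp_forceTerms hk hf hD hw hv hξ
      exact ((memW_weak hk hf hD hfin hw hu hξ).1 i).sub ((memW_weak hk hf hD hfin hw hv hξ).1 i)
        a0 b0 (a1 i) (b1 i)
  have w₂ : ∀ᵐ ξ ∂(bondMeasure d J ε), ∀ i j, IsWeakPartialScalar D j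
      (fun x => forceTermD D f w ε u i ξ x - forceTermD D f w ε v i ξ x)
      fun x => forceTermDD D f w ε u i j ξ x - forceTermDD D f w ε v i j ξ x :=
    ae_bondMeasure fun ξ hξ i j => by
      obtain ⟨-, a1, a2⟩ := memLp_forceTerms hk hf hD hw hu hξ
      obtain ⟨-, b1, b2⟩ := memLp_forceTerms hk hf hD hw hv hξ
      exact ((memW_weak hk hf hD hfin hw hu hξ).2 i j).sub
        ((memW_weak hk hf hD hfin hw hv hξ).2 i j) (a1 i) (b1 i) (a2 i j) (b2 i j)
  obtain ⟨m, le⟩ := memH2_superpose hD he norm_direction_le_one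
    (Q₁ := fun i ξ x => forceTermD D f w ε u i ξ x - forceTermD D f w ε v i ξ x)
    (Q₂ := fun i j ξ x => forceTermDD D f w ε u i j ξ x - forceTermDD D f w ε v i j ξ x)
    (fun ξ => by have := hs ξ; positivity) (fun ξ => by have := hs ξ; positivity)
    p₂ h₀ m₁ h₁ m₂ h₂ w₁ w₂
  have hae : superpose (bondMeasure d J ε) (fun ξ => ‖ξ‖⁻¹ • ξ)
      (fun ξ x => forceTerm D f w ε u ξ x - forceTerm D f w ε v ξ x)
      =ᵐ[volume.restrict D] force D f J w ε u - force D f J w ε v :=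
    (superpose_sub_ae_eq he norm_direction_le_one
      (isSquareBounded_forceTerm hk hf hD hw hu i₁)
      (isSquareBounded_forceTerm hk hf hD hw hv i₁)).trans
      ((force_ae_eq hf hJ w hε hD hu.1.1.1).symm.sub (force_ae_eq hf hJ w hε hD hv.1.1.1).symm)
  rw [normH2_congr hD m hae]
  -- The coefficient 2c₁ + 2 is the sum of 1 from the first derivatives and 2c₁ + 1 from the second.
  refine le.trans_eq ?_
  rw [integral_add (i₁.const_mul _) (i₂.const_mul _),
    integral_add ((i₁.const_mul _).fun_add (i₂.const_mul _)) (iT.const_mul _),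
    integral_add (i₁.const_mul _) (i₂.const_mul _)]
  simp only [integral_const_mul]
  ring

end Force

end
end Peridynamics

namespace Peridynamics
noncomputable section
variable {d : ℕ} {D : Set (Sp d)}

/-! ### The constants -/

section Constants

variable {f J : ℝ → ℝ} {ε : ℝ}

theorem IsInfluence.integrable_bondScale (hJ : IsInfluence J) (hd : 2 ≤ d) (hε : 0 < ε) :
    Integrable (bondScale (d := d) ε) (bondMeasure d J ε) := by
  have hd' : (2 : ℝ) ≤ d := by exact_mod_cast hd
  simpa using hJ.integrable_bondScale_pow (d := d) hε 1 (α := 1) (by norm_num)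
    (hJ.jbarFinite (by omega) (by linarith))

theorem IsInfluence.integrable_bondScale_sq (hJ : IsInfluence J) (hd : 2 ≤ d) (hε : 0 < ε) :
    Integrable (fun ξ => bondScale (d := d) ε ξ ^ 2) (bondMeasure d J ε) := by
  have hd' : (2 : ℝ) ≤ d := by exact_mod_cast hd
  exact hJ.integrable_bondScale_pow (d := d) hε 2 (α := 3 / 2) (by norm_num)
    (hJ.jbarFinite (by omega) (by linarith))

theorem IsInfluence.integral_bondScale (hJ : IsInfluence J) (hε : 0 < ε) :
    ∫ ξ, bondScale (d := d) ε ξ ∂(bondMeasure d J ε) = 2 * Jbar d J 1 / ε ^ 2 := by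
  have := hJ.integral_bondScale_pow (d := d) hε 1 (α := 1) (by norm_num)
  simpa [Real.rpow_one, ← sq] using this

theorem IsInfluence.integral_bondScale_sq (hJ : IsInfluence J) (hε : 0 < ε) :
    ∫ ξ, bondScale (d := d) ε ξ ^ 2 ∂(bondMeasure d J ε)
      = 2 * Jbar d J (3 / 2) / ε ^ (5 / 2 : ℝ) := by
  rw [hJ.integral_bondScale_pow hε 2 (α := 3 / 2) (by norm_num)]
  congr 1
  rw [← Real.rpow_one_add' hε.le (by norm_num)]
  norm_num

theorem IsInfluence.integral_bondScale_cube (hJ : IsInfluence J) (hε : 0 < ε) :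
    ∫ ξ, bondScale (d := d) ε ξ ^ 3 ∂(bondMeasure d J ε) = 2 * Jbar d J 2 / ε ^ 3 := by
  rw [hJ.integral_bondScale_pow hε 3 (α := 2) (by norm_num)]
  congr 1
  rw [Real.rpow_two]; ring

theorem inv_pow_two_le_inv_rpow {ε : ℝ} (hε : 0 < ε) (hε1 : ε < 1) :
    (ε ^ 2)⁻¹ ≤ (ε ^ (5 / 2 : ℝ))⁻¹ := by
  refine inv_anti₀ (Real.rpow_pos_of_pos hε _) ?_
  rw [← Real.rpow_two]
  exact Real.rpow_le_rpow_of_exponent_ge hε hε1.le (by norm_num)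

theorem inv_rpow_le_inv_pow_three {ε : ℝ} (hε : 0 < ε) (hε1 : ε < 1) :
    (ε ^ (5 / 2 : ℝ))⁻¹ ≤ (ε ^ 3)⁻¹ := by
  refine inv_anti₀ (pow_pos hε 3) ?_
  rw [← Real.rpow_natCast]
  exact Real.rpow_le_rpow_of_exponent_ge hε hε1.le (by norm_num)

/-- The strain differences of two elements of `W` are bounded so that the cubic term of the
Lipschitz estimate is controlled: if `J̄₂ = ∞` then `d = 2`, and Hölder continuity is used. -/
theorem exists_cubic_constant (hd : d = 2 ∨ d = 3) (hD : IsOpen D) (hDb : Bornology.IsBounded D)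
    (f : ℝ → ℝ) (hJ : IsInfluence J) {k₁ k₂ : ℝ≥0} (hk : AreEmbeddingConstants D k₁ k₂) :
    ∃ L : ℝ, 0 ≤ L ∧ (JbarFinite d J 2 → L = constL3 d f J k₁ k₂) ∧
      ∀ ε : ℝ, 0 < ε → ε < 1 → ∀ u v : Sp d → Sp d, MemW D u → MemW D v →
        ∃ T : Sp d → ℝ, (∀ ξ, 0 ≤ T ξ) ∧
          (∀ ξ : Sp d, NormLe ⊤ (volume.restrict D)
            (fun x => bondStrain ε ξ (zeroExt D u) x - bondStrain ε ξ (zeroExt D v) x) (T ξ)) ∧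
          Integrable (fun ξ => bondScale ε ξ ^ 2 * T ξ) (bondMeasure d J ε) ∧
          4 * supDeriv f 4 * k₂ ^ 2 * ∫ ξ, bondScale ε ξ ^ 2 * T ξ ∂(bondMeasure d J ε)
            ≤ L * (ε ^ 3)⁻¹ * normH2 D (u - v) := by
  have s4 := supDeriv_nonneg f 4
  -- If J̄₂ is finite the general sup bound 2 s C_{e₁} ‖u - v‖ is good enough: the integral of s³ is
  -- 2J̄₂/ε³, and the constants multiply to 16.
  by_cases hfin : JbarFinite d J 2
  · have hj := hJ.jbar_nonneg (d := d) 2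
    refine ⟨constL3 d f J k₁ k₂, by unfold constL3; positivity, fun _ => rfl, ?_⟩
    intro ε hε hε1 u v hu hv
    have hW := normH2_nonneg D (u - v)
    have e : ∀ ξ : Sp d, bondScale ε ξ ^ 2 * (2 * bondScale ε ξ * (k₁ * normH2 D (u - v)))
        = 2 * k₁ * normH2 D (u - v) * bondScale ε ξ ^ 3 := fun ξ => by ring
    refine ⟨fun ξ => 2 * bondScale ε ξ * (k₁ * normH2 D (u - v)), fun ξ => ?_, fun ξ =>
      (hu.isStrainBound_sub hk hD hv ε ξ).sup, ?_, ?_⟩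
    · have := bondScale_nonneg ε ξ; positivity
    · simp only [e]
      exact (hJ.integrable_bondScale_pow hε 3 (by norm_num) hfin).const_mul _
    · simp only [e]
      rw [integral_const_mul, hJ.integral_bondScale_cube hε, constL3]
      exact le_of_eq (by ring)
  · obtain rfl : d = 2 := hd.resolve_right fun h3 => hfin (hJ.jbarFinite (by omega) (by
      rw [h3]; norm_num))
    obtain ⟨C, hC, hinc⟩ := exists_increment_bound hD hDb
    have hj := hJ.jbar_nonneg (d := 2) (3 / 2)
    -- The 8 is the 4 of the claim times the 2 in the integral of s². The power ε^(-5/2) is weakened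
    -- to ε^(-3) at the end.
    refine ⟨8 * supDeriv f 4 * k₂ ^ 2 * C * Jbar 2 J (3 / 2), by positivity,
      fun h => absurd h hfin, ?_⟩
    intro ε hε hε1 u v hu hv
    have hW := normH2_nonneg D (u - v)
    -- Hölder continuity of exponent 1/2 makes the bound independent of the bond.
    refine ⟨fun _ => C * normH2 D (u - v), fun _ => by positivity, fun ξ => ?_, ?_, ?_⟩
    · have hm := (hu.isStrainBound_sub hk hD hv ε ξ).sup.meas
      refine ⟨hm, by positivity, eLpNormEssSup_le_of_ae_bound (ae_restrict_of_ae ?_)⟩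
      have hz := zeroExt_sub_ae_eq hD hu.1.1.1 hv.1.1.1 (c := u - v) EventuallyEq.rfl
      have hz' := (measurePreserving_add_right (volume : Measure (Sp 2))
        (ε • ξ)).quasiMeasurePreserving.ae_eq_comp hz
      filter_upwards [hz, hz', hinc (u - v) (hu.sub hD hv) (ε • ξ)] with x h1 h2 h3
      have h2' : zeroExt D u (x + ε • ξ) - zeroExt D v (x + ε • ξ)
        = D.indicator (u - v) (x + ε • ξ) := h2
      have hb := abs_bondStrain_le ε ξ (fun x => zeroExt D u x - zeroExt D v x) x
      rw [bondStrain_sub, h1, h2'] at hb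
      refine hb.trans ((mul_le_mul_of_nonneg_left h3 (bondScale_nonneg ε ξ)).trans ?_)
      -- The Hölder factor cancels the bond scale. It is an inequality because of ξ = 0, where the
      -- scale is zero by convention.
      have hs : bondScale ε ξ * ‖ε • ξ‖ ^ (1 / 2 : ℝ) ≤ 1 := by
        rw [norm_smul, Real.norm_of_nonneg hε.le, ← Real.sqrt_eq_rpow, bondScale]
        exact inv_mul_le_one
      calc bondScale ε ξ * (C * ‖ε • ξ‖ ^ (1 / 2 : ℝ) * normH2 D (u - v))
          = bondScale ε ξ * ‖ε • ξ‖ ^ (1 / 2 : ℝ) * (C * normH2 D (u - v)) := by ring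
        _ ≤ _ := mul_le_of_le_one_left (by positivity) hs
    · exact (hJ.integrable_bondScale_sq le_rfl hε).mul_const _
    · rw [integral_mul_const, hJ.integral_bondScale_sq hε, div_eq_mul_inv]
      have := inv_rpow_le_inv_pow_three hε hε1
      calc 4 * supDeriv f 4 * k₂ ^ 2
            * (2 * Jbar 2 J (3 / 2) * (ε ^ (5 / 2 : ℝ))⁻¹ * (C * normH2 D (u - v)))
          = 8 * supDeriv f 4 * k₂ ^ 2 * C * Jbar 2 J (3 / 2) * (ε ^ (5 / 2 : ℝ))⁻¹
            * normH2 D (u - v) := by ring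
        _ ≤ _ := by gcongr

end Constants

end
end Peridynamics

/-! ### The theorem: assembling the constants -/

theorem mainTheorem2 (d : ℕ) (hd : d = 2 ∨ d = 3)
    (D : Set (Sp d)) (hDo : IsOpen D) (hDb : Bornology.IsBounded D)
    (hDc : HasC1Boundary D)
    (f J : ℝ → ℝ) (hf : IsPotential f) (hJ : IsInfluence J) :
    -- the embedding constants and the integrals in the formulas are finite
    (∃ ce1 ce2 : ℝ≥0, AreEmbeddingConstants D ce1 ce2) ∧
    JbarFinite d J 1 ∧ JbarFinite d J (3 / 2) ∧
    (d = 3 → JbarFinite d J 2) ∧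
    ∀ ce1 ce2 : ℝ≥0, AreEmbeddingConstants D ce1 ce2 →
      ∃ Lbar3 : ℝ, 0 ≤ Lbar3 ∧
        (JbarFinite d J 2 → Lbar3 = constL3 d f J ce1 ce2) ∧
        ∀ (cw1 cw2 ε : ℝ) (w : Sp d → ℝ), 0 < ε → ε < 1 →
          0 ≤ cw1 → 0 ≤ cw2 → IsBoundaryFunction D ε cw1 cw2 w →
          (∀ u : Sp d → Sp d, MemW D u →
            MemH2 D (force D f J w ε u) ∧
            normH2 D (force D f J w ε u) ≤
              (constLbar1 d f J cw1 cw2 * normH2 D u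
                + constL4 d f J ce2 * normH2 D u ^ 2)
                / ε ^ (5 / 2 : ℝ)) ∧
          (∀ u v : Sp d → Sp d,
            MemW D u → MemW D v →
            MemH2 D
              (force D f J w ε u - force D f J w ε v) ∧
            normH2 D
              (force D f J w ε u - force D f J w ε v) ≤
              (constLbar1 d f J cw1 cw2
                + constLbar2 d f J ce1 ce2 cw1
                  * (normH2 D u + normH2 D v)
                + Lbar3 * (normH2 D u + normH2 D v) ^ 2)
                / ε ^ 3 * normH2 D (u - v)) := by

  have hd2 : 2 ≤ d := by omega
  have hd2' : (2 : ℝ) ≤ d := by exact_mod_cast hd2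
  have hfin : volume D ≠ ⊤ := hDb.measure_lt_top.ne
  refine ⟨exists_embeddingConstants hd hDo hDb, hJ.jbarFinite (by omega) (by linarith),
    hJ.jbarFinite (by omega) (by linarith), fun h3 => hJ.jbarFinite (by omega) (by
      rw [h3]; norm_num), ?_⟩
  intro ce1 ce2 hk
  obtain ⟨L, hL, hL3, hT⟩ := exists_cubic_constant hd hDo hDb f hJ hk
  refine ⟨L, hL, hL3, ?_⟩
  intro cw1 cw2 ε w hε hε1 hc1 hc2 hw
  have i₁ := hJ.integrable_bondScale hd2 hε
  have i₂ := hJ.integrable_bondScale_sq hd2 hε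
  have s2 := supDeriv_nonneg f 2
  have s3 := supDeriv_nonneg f 3
  have j1 := hJ.jbar_nonneg (d := d) 1
  have j2 := hJ.jbar_nonneg (d := d) (3 / 2)
  have hb0 : 0 ≤ (ε ^ (5 / 2 : ℝ))⁻¹ := inv_nonneg.2 (Real.rpow_nonneg hε.le _)
  have hab := inv_pow_two_le_inv_rpow hε hε1
  have hbc := inv_rpow_le_inv_pow_three hε hε1
  have force_mem := fun (u : Sp d → Sp d) (hu : MemW D u) =>
    memH2_force hk hf hJ hε hDo hfin hc1 hc2 hw hu i₁ i₂
  rw [hJ.integral_bondScale hε, hJ.integral_bondScale_sq hε] at force_mem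
  refine ⟨fun u hu => ⟨(force_mem u hu).1, (force_mem u hu).2.trans ?_⟩, fun u v hu hv =>
    ⟨(force_mem u hu).1.sub hDo (force_mem v hv).1, ?_⟩⟩
  · have hU := normH2_nonneg D u
    generalize normH2 D u = U at hU
    simp only [div_eq_mul_inv, constLbar1, constL1, constL4]
    -- The bounds obtained have 3 in place of 4 and 8 in place of 16; `h2` and `h3` are the
    -- corresponding slack, and `h1` replaces ε^(-2) by ε^(-5/2).
    have h1 := mul_le_mul_of_nonneg_left hab
      (show 0 ≤ (3 + 3 * cw1 + cw2) * (4 * supDeriv f 2 * Jbar d J 1) * U by positivity)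
    have h2 : 0 ≤ supDeriv f 2 * Jbar d J 1 * U * (ε ^ (5 / 2 : ℝ))⁻¹ := by positivity
    have h3 : 0 ≤ supDeriv f 3 * ce2 ^ 2 * Jbar d J (3 / 2) * U ^ 2 * (ε ^ (5 / 2 : ℝ))⁻¹ := by
      positivity
    linarith
  · obtain ⟨T, hT0, hTn, hTi, hTle⟩ := hT ε hε hε1 u v hu hv
    have key := normH2_force_sub_le hk hf hJ hε hDo hfin hc1 hc2 hw hu hv rfl rfl rfl i₁ i₂ hT0
      (fun ξ _ => hTn ξ) hTi
    refine key.trans ?_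
    rw [hJ.integral_bondScale hε, hJ.integral_bondScale_sq hε]
    have hU := normH2_nonneg D u
    have hV := normH2_nonneg D v
    have hW := normH2_nonneg D (u - v)
    -- From here on only real numbers matter. Naming the norms and the integral leaves an inequality
    -- that is linear in a few products.
    clear key
    generalize ∫ ξ, bondScale ε ξ ^ 2 * T ξ ∂(bondMeasure d J ε) = I at hTle ⊢
    generalize normH2 D u = U at hU ⊢
    generalize normH2 D v = V at hV ⊢
    generalize normH2 D (u - v) = W at hW hTle ⊢
    simp only [div_eq_mul_inv, constLbar1, constLbar2, constL1, constL2, constL4]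
    have hc0 : 0 ≤ (ε ^ 3)⁻¹ := by positivity
    have h1 := mul_le_mul_of_nonneg_left (hab.trans hbc)
      (show 0 ≤ (3 + 3 * cw1 + cw2) * (4 * supDeriv f 2 * Jbar d J 1) * W by positivity)
    have h2 := mul_le_mul_of_nonneg_left hbc
      (show 0 ≤ ((1 + cw1) * (8 * supDeriv f 3 * ce1 * Jbar d J (3 / 2))
        + 8 * supDeriv f 3 * ce2 ^ 2 * Jbar d J (3 / 2)) * (U + V) * W by positivity)
    have h3 := mul_le_mul_of_nonneg_left hTle (show 0 ≤ 1 / 2 * (U ^ 2 + V ^ 2) by positivity)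
    have h4 : 0 ≤ supDeriv f 2 * Jbar d J 1 * W * (ε ^ 3)⁻¹ := by positivity
    -- Slack between 1 + C_{ω₁} and 1 + 2C_{ω₁}; the next one is the slack between 8 and 16 in the
    -- coefficient of C_{e₂}².
    have h5 : 0 ≤ cw1 * (supDeriv f 3 * ce1 * Jbar d J (3 / 2)) * (U + V) * W * (ε ^ 3)⁻¹ := by
      positivity
    have h6 : 0 ≤ supDeriv f 3 * ce2 ^ 2 * Jbar d J (3 / 2) * (U + V) * W * (ε ^ 3)⁻¹ := by
      positivity
    -- The estimate yields half of U² + V²; this is what remains up to (U + V)².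
    have h7 : 0 ≤ (1 / 2 * (U ^ 2 + V ^ 2) + 2 * U * V) * (L * (ε ^ 3)⁻¹ * W) := by positivity
    linarith
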